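/- Let $(\boldsymbol x,y)$ be a random pair with values in $\mathbb R^d\times\mathbb R$, $d\ge 1$, with $E\|\boldsymbol x\|^4<\infty$, such that $R_x=E[\boldsymbol x\boldsymbol x^T]$ is invertible, and let $\mu>0$ be the smallest eigenvalue of $R_x$. Suppose that the components of $\boldsymbol x$ are identically distributed and uncorrelated (that is, $E[x_ix_j]=0$ for $i\ne j$), so that $R_x=\mu I_d$. Let $f(\boldsymbol\omega)=E[(\boldsymbol x^T\boldsymbol\omega-y)^2]$, let $\Omega\subset\mathbb R^d$ be compact and convex, and let $\boldsymbol\omega^*$ be a minimizer of $f$ over $\Omega$ that lies in the interior of $\Omega$; put $f^*=f(\boldsymbol\omega^*)$. Suppose that the noise $v=\boldsymbol x^T\boldsymbol\omega^*-y$ is square integrable with $E[v\mid\boldsymbol x]=0$ and $E[v^2\mid\boldsymbol x]=\sigma^2$ (for instance, $v$ independent of $\boldsymbol x$ with mean $0$ and variance $\sigma^2$). Let $(\boldsymbol x_k,y_k)$, $k=0,1,2,\dots$, be i.i.d. copies of $(\boldsymbol x,y)$, let $\boldsymbol\omega_0\in\Omega$ be an initial estimate, possibly random, independent of the samples, let $\gamma\ge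 2$ and $\alpha_k=\frac{\gamma}{\gamma+k}$. The projected stochastic gradient descent algorithm with weighted averaging (PSGD-WA) is $$\boldsymbol\omega_{k+1}=\arg\min_{\boldsymbol\omega\in\Omega}\Big\{\lambda_k\boldsymbol g_k^T(\boldsymbol\omega-\boldsymbol\omega_k)+\tfrac12\|\boldsymbol\omega-\boldsymbol\omega_k\|^2\Big\},\qquad \boldsymbol g_k=2\boldsymbol x_k(\boldsymbol x_k^T\boldsymbol\omega_k-y_k),\quad \lambda_k=\frac{\alpha_k}{2\mu},$$ $$\bar{\boldsymbol\omega}_k=\sum_{i=0}^k\beta_{k,i}\boldsymbol\omega_i,\qquad \beta_{k,i}=\frac{1/\alpha_i}{\sum_{r=0}^k1/\alpha_r}.$$ Let $\boldsymbol\omega_k^{ERM}$ be any (measurable) minimizer over $\Omega$ of the empirical risk $\frac1k\sum_{i=0}^{k-1}(\boldsymbol x_i^T\boldsymbol\omega-y_i)^2$ of the first $k$ samples. Then all expectations below are finite, all limits below exist, and $$\lim_{k\to\infty}k\big(E[f(\bar{\boldsymbol\omega}_k)]-f^*\big)\le 4d\sigma^2,\qquad \lim_{k\to\infty}k\big(E[f(\boldsymbol\omega_k^{ERM})]-f^*\big)=d\sigma^2.$$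 If moreover $\sigma\neq0$, then the asymptotic ratio satisfies $$\rho=\lim_{k\to\infty}\frac{E[f(\bar{\boldsymbol\omega}_k)]-f^*}{E[f(\boldsymbol\omega_k^{ERM})]-f^*}\le 4 .$$ -/

import Mathlib

open MeasureTheory ProbabilityTheory Filter Topology

noncomputable section

namespace PSGDWA

/-- Column vectors in `ℝ^d` with the Euclidean norm. -/
abbrev Vec (d : ℕ) : Type := EuclideanSpace ℝ (Fin d)

variable {d : ℕ}

/-- Mean squares loss `f(w) = E[(xᵀw - y)²]`, where `ν` is the joint law of `(x, y)`. -/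
def risk (ν : Measure (Vec d × ℝ)) (w : Vec d) : ℝ :=
  ∫ z, (inner ℝ z.1 w - z.2) ^ 2 ∂ν

/-- Correlation matrix `R_x = E[x xᵀ]`. -/
def corrMatrix (ν : Measure (Vec d × ℝ)) : Matrix (Fin d) (Fin d) ℝ :=
  Matrix.of fun i j => ∫ z, z.1 i * z.1 j ∂ν

/-- Residual `v = xᵀw - y` of the sample `z = (x, y)` at the parameter `w`. -/
def residual (w : Vec d) (z : Vec d × ℝ) : ℝ := inner ℝ z.1 w - z.2

/-- Single-sample gradient estimate `g(w) = 2 x (xᵀw - y)`. -/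
def stochGrad (z : Vec d × ℝ) (w : Vec d) : Vec d := (2 * residual w z) • z.1

/-- `α_k = γ / (γ + k)`. -/
def alpha (γ : ℝ) (k : ℕ) : ℝ := γ / (γ + k)

/-- Step size `λ_k = α_k / (2μ)`. -/
def stepSize (μ γ : ℝ) (k : ℕ) : ℝ := 1 / (2 * μ) * alpha γ k

/-- A minimizer of `q` over `Ω`. It is used only where the minimizer exists and is unique
(strongly convex continuous `q`, nonempty compact convex `Ω`). -/
def argminOn (Ω : Set (Vec d)) (q : Vec d → ℝ) : Vec d :=
  Classical.epsilon fun w => w ∈ Ω ∧ IsMinOn q Ω w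

/-- Projected SGD along the data stream `z_0, z_1, …`, started at `w₀`:
`w_{k+1} = argmin_{u ∈ Ω} { λ_k g_kᵀ(u - w_k) + ½‖u - w_k‖² }`, `g_k = g(w_k)` on sample `z_k`. -/
def iter (Ω : Set (Vec d)) (μ γ : ℝ) (w₀ : Vec d) (z : ℕ → Vec d × ℝ) : ℕ → Vec d
  | 0 => w₀
  | k + 1 =>
    argminOn Ω fun u =>
      stepSize μ γ k *
          inner ℝ (stochGrad (z k) (iter Ω μ γ w₀ z k)) (u - iter Ω μ γ w₀ z k) +
        1 / 2 * ‖u - iter Ω μ γ w₀ z k‖ ^ 2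

/-- Averaging weights `β_{k,i} = (1/α_i) / ∑_{r=0}^k 1/α_r`. -/
def weight (γ : ℝ) (k i : ℕ) : ℝ :=
  (1 / alpha γ i) / ∑ r ∈ Finset.range (k + 1), 1 / alpha γ r

/-- Weighted average `∑_{i=0}^k β_{k,i} w_i` of the projected SGD iterates. -/
def avgIter (Ω : Set (Vec d)) (μ γ : ℝ) (w₀ : Vec d) (z : ℕ → Vec d × ℝ) (k : ℕ) : Vec d :=
  ∑ i ∈ Finset.range (k + 1), weight γ k i • iter Ω μ γ w₀ z i

/-- Empirical risk of the first `k` samples. -/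
def empRisk (z : ℕ → Vec d × ℝ) (k : ℕ) (w : Vec d) : ℝ :=
  1 / (k : ℝ) * ∑ i ∈ Finset.range k, (inner ℝ (z i).1 w - (z i).2) ^ 2

/-- `w` is an empirical risk minimizer over `Ω` for the first `k` samples
(for small `k` it need not be unique). -/
def IsERM (Ω : Set (Vec d)) (z : ℕ → Vec d × ℝ) (k : ℕ) (w : Vec d) : Prop :=
  w ∈ Ω ∧ IsMinOn (empRisk z k) Ω w

end PSGDWA

end

set_option linter.unusedSectionVars false

/-! Isotropy makes the excess risk exactly quadratic, `risk ν w = risk ν wopt + μ * ‖w - wopt‖ ^ 2`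
(`LinearModel.risk_eq`), so both limits concern `k` times a mean squared error. Each estimator is
shown to agree, up to an error that is `o(1/k)` in mean square, with a linear function of the i.i.d.
centred vectors `Z_i = -(1/μ) v_i x_i` (`noise`), and `E‖Z‖² = dσ²/μ`.

Projected SGD. Before projection, the error `e_k` at the iterate satisfies `e_{k+1} = (1 - α_k) e_k
+ α_k (Z_k + m_k)`, where `m_k = e_k - (1/μ) x_k x_kᵀ e_k` is centred given the past. It is compared
with `L_{k+1} = (1 - α_k) L_k + α_k Z_k`, `L_0 = 0` (`linIter`). Since `E‖e_k‖² = O(1/k)`, the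
multiplicative noise adds only `o(α_k²)`. As the optimum is interior, the projection acts only when
`e_k` is far from zero or a single step is long. Excursions of `e_k` cost `o(1/k)`
(`NoisyContraction.tendsto_excess`), and long steps are handled by a Lindeberg-type truncation.
Hence `E‖e_k - L_k‖² = o(1/k)` (`tendsto_gap`), and Jensen with Cesàro means carries this over to
the weighted averages. For `L` and its weighted sums `T`, the moments `E‖L‖²`, `E⟪T, L⟫`, `E‖T‖²`
obey a triangular system of scalar recursions. It gives the exact limit `8γ² / (3(γ+1)(2γ-1)) * dσ²`
(`Stream.tendsto_linAvg`), whose coefficient is below 4.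

ERM. The empirical risk is an isotropic quadratic perturbed by the mean noise `n` and by the
deviation `C` of the empirical correlation matrix from `μ I`. When both have norm at most a small
`ε`, the minimizer's error differs from `n` by at most `(4ε/μ)‖n‖` (`erm_sub_noise_le`). Empirical
means are `linIter` with `γ = 1`, so the same excess estimate makes the exceptional event cost
`o(1/k)`. This leaves `k E‖n‖²`, of limit `dσ²/μ`. -/

namespace PSGDWA

/-! ### Scalar affine recursions with contraction rate `c / k` -/

/-- A nonnegative sequence with `y (k+1) ≤ A k * y k + B k`, where `1 - A k ∼ c / k` and
`B k = o(1 / k)`, tends to zero. -/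
theorem tendsto_zero_of_le_affine {y A B : ℕ → ℝ} {c : ℝ} (hc : 0 < c) (hy : ∀ k, 0 ≤ y k)
    (hA : Tendsto (fun k : ℕ => (k : ℝ) * (1 - A k)) atTop (𝓝 c))
    (hB : Tendsto (fun k : ℕ => (k : ℝ) * B k) atTop (𝓝 0))
    (h : ∀ k, y (k + 1) ≤ A k * y k + B k) : Tendsto y atTop (𝓝 0) := by
  rw [Metric.tendsto_atTop]
  intro ε hε
  have hc2 : 0 < c / 2 := by positivity
  have e1 : ∀ᶠ k : ℕ in atTop, c / 2 < (k : ℝ) * (1 - A k) :=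
    hA.eventually (lt_mem_nhds (by linarith))
  have e3 : ∀ᶠ k : ℕ in atTop, (k : ℝ) * B k < c / 2 * (ε / 2) :=
    hB.eventually (gt_mem_nhds (by positivity))
  have e4 : ∀ᶠ k : ℕ in atTop, c + 1 < (k : ℝ) :=
    tendsto_natCast_atTop_atTop.eventually (eventually_gt_atTop (c + 1))
  obtain ⟨K, hK⟩ := eventually_atTop.1 (e1.and (e3.and e4))
  -- Half of the asymptotic rate. From `K` on, `A k ≤ 1 - θ k` and `B k ≤ θ k * (ε / 2)`, so the
  -- part of `y` above the level `ε / 2` shrinks by the factor `1 - θ k`. The divergence of the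
  -- harmonic series drives it to zero.
  set θ : ℕ → ℝ := fun k => c / 2 / k with hθ
  have step : ∀ k, K ≤ k → 0 < θ k ∧ θ k < 1 ∧
      max (y (k + 1) - ε / 2) 0 ≤ (1 - θ k) * max (y k - ε / 2) 0 := by
    intro k hk
    obtain ⟨h1, h3, h4⟩ := hK k hk
    have hk0 : (0 : ℝ) < k := by linarith
    have hθk : θ k * k = c / 2 := by simp only [hθ]; field_simp
    have hθ0 : 0 < θ k := by simp only [hθ]; positivity
    have hθ1 : θ k < 1 := by
      simp only [hθ]; rw [div_lt_one hk0]; linarith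
    have hA' : A k ≤ 1 - θ k := by
      have : θ k * k ≤ (1 - A k) * k := by rw [hθk]; linarith
      linarith [le_of_mul_le_mul_right this hk0]
    have hB' : B k ≤ θ k * (ε / 2) := by
      have : B k * k ≤ θ k * (ε / 2) * k := by
        have : θ k * (ε / 2) * k = c / 2 * (ε / 2) := by rw [← hθk]; ring
        linarith
      exact le_of_mul_le_mul_right this hk0
    refine ⟨hθ0, hθ1, max_le ?_ (mul_nonneg (by linarith) (le_max_right _ _))⟩
    have h5 := h k
    have h6 : A k * y k ≤ (1 - θ k) * y k := mul_le_mul_of_nonneg_right hA' (hy k)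
    have h7 : (1 - θ k) * (y k - ε / 2) ≤ (1 - θ k) * max (y k - ε / 2) 0 :=
      mul_le_mul_of_nonneg_left (le_max_left _ _) (by linarith)
    nlinarith
  set x : ℕ → ℝ := fun k => max (y k - ε / 2) 0 with hx
  have hx0 : ∀ k, 0 ≤ x k := fun k => le_max_right _ _
  have bound : ∀ n, x (K + n) ≤ x K * Real.exp (-∑ i ∈ Finset.range n, θ (K + i)) := by
    intro n
    induction n with
    | zero => simp
    | succ n ih =>
      obtain ⟨h1, h2, h3⟩ := step (K + n) (by omega)
      rw [Finset.sum_range_succ, neg_add, Real.exp_add, ← mul_assoc]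
      calc x (K + (n + 1)) ≤ (1 - θ (K + n)) * x (K + n) := h3
        _ ≤ Real.exp (-θ (K + n)) * (x K * Real.exp (-∑ i ∈ Finset.range n, θ (K + i))) := by
          apply mul_le_mul _ ih (hx0 _) (Real.exp_pos _).le
          have := Real.add_one_le_exp (-θ (K + n)); linarith
        _ = _ := by ring
  have hdiv : Tendsto (fun n => ∑ i ∈ Finset.range n, θ (K + i)) atTop atTop := by
    have hns : ¬ Summable (fun i => θ (K + i)) := by
      intro hs
      have hs' : Summable θ := by
        have : Summable (fun i => θ (i + K)) := by simpa [add_comm] using hs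
        exact (summable_nat_add_iff K).1 this
      have : Summable (fun k : ℕ => (1 : ℝ) / k) := by
        refine (hs'.mul_left (2 / c)).congr fun k => ?_
        simp only [hθ]; field_simp
      exact Real.not_summable_one_div_natCast this
    exact (not_summable_iff_tendsto_nat_atTop_of_nonneg
      (fun i => (step (K + i) (by omega)).1.le)).1 hns
  have hx_lim : Tendsto (fun n => x (K + n)) atTop (𝓝 0) := by
    refine squeeze_zero (fun n => hx0 _) bound ?_
    have := (Real.tendsto_exp_neg_atTop_nhds_zero.comp hdiv).const_mul (x K)
    simpa using this
  obtain ⟨M, hM⟩ := eventually_atTop.1 (hx_lim.eventually (gt_mem_nhds (half_pos hε)))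
  refine ⟨K + M, fun k hk => ?_⟩
  have := hM (k - K) (by omega)
  rw [show K + (k - K) = k by omega] at this
  have h8 : y k - ε / 2 ≤ x k := le_max_left _ _
  rw [Real.dist_eq, sub_zero, abs_of_nonneg (hy k)]
  linarith

/-- A nonnegative sequence with `y (k+1) ≤ A k * y k + B k`, where `1 - A k ∼ c / k` and
`B k = O(1 / k)`, is bounded. -/
theorem bounded_of_le_affine {y A B : ℕ → ℝ} {c b : ℝ} (hc : 0 < c) (hy : ∀ k, 0 ≤ y k)
    (hA : Tendsto (fun k : ℕ => (k : ℝ) * (1 - A k)) atTop (𝓝 c))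
    (hB : ∀ k : ℕ, (k : ℝ) * B k ≤ b)
    (h : ∀ k, y (k + 1) ≤ A k * y k + B k) : ∃ C, 0 ≤ C ∧ ∀ k, y k ≤ C := by
  have e1 : ∀ᶠ k : ℕ in atTop, c / 2 < (k : ℝ) * (1 - A k) :=
    hA.eventually (lt_mem_nhds (by linarith))
  have e2 : ∀ᶠ k : ℕ in atTop, (k : ℝ) * (1 - A k) < c + 1 :=
    hA.eventually (gt_mem_nhds (by linarith))
  have e4 : ∀ᶠ k : ℕ in atTop, c + 1 < (k : ℝ) :=
    tendsto_natCast_atTop_atTop.eventually (eventually_gt_atTop (c + 1))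
  obtain ⟨K, hK⟩ := eventually_atTop.1 (e1.and (e2.and e4))
  -- The first argument covers the terms up to `K`. The second gives `B k ≤ (1 - A k) * C`
  -- afterwards, so the level `C` is never crossed.
  set C := max (∑ i ∈ Finset.range (K + 1), y i) (|b| / (c / 2)) with hC
  have hyC : ∀ k, k ≤ K → y k ≤ C := fun k hk =>
    (Finset.single_le_sum (fun i _ => hy i) (Finset.mem_range.2 (by omega))).trans (le_max_left _ _)
  have hC0 : 0 ≤ C := le_max_of_le_right (by positivity)
  refine ⟨C, hC0, fun k => ?_⟩
  rcases le_total k K with hk | hk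
  · exact hyC k hk
  · induction k, hk using Nat.le_induction with
    | base => exact hyC K le_rfl
    | succ k hk ih =>
      obtain ⟨h1, h2, h4⟩ := hK k hk
      have hk0 : (0 : ℝ) < k := by linarith
      have hA0 : 0 ≤ A k := by
        by_contra hneg
        push Not at hneg
        nlinarith
      have hbC : |b| ≤ c / 2 * C := by
        have : |b| / (c / 2) ≤ C := le_max_right _ _
        rw [div_le_iff₀ (by positivity)] at this
        linarith
      have hB' : B k ≤ (1 - A k) * C := by
        have : B k * k ≤ (1 - A k) * C * k := by
          have h5 := hB k
          have h6 := le_abs_self b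
          have h7 : c / 2 * C ≤ (k : ℝ) * (1 - A k) * C := mul_le_mul_of_nonneg_right h1.le hC0
          linarith
        exact le_of_mul_le_mul_right this hk0
      have := h k
      have := mul_le_mul_of_nonneg_left ih hA0
      linarith

/-- If `y (k+1) = A k * y k + B k`, where `1 - A k ∼ c / k` and `B k ∼ b / k`, then
`y` tends to `b / c`. -/
theorem tendsto_of_eq_affine {y A B : ℕ → ℝ} {c b : ℝ} (hc : 0 < c)
    (hA : Tendsto (fun k : ℕ => (k : ℝ) * (1 - A k)) atTop (𝓝 c))
    (hB : Tendsto (fun k : ℕ => (k : ℝ) * B k) atTop (𝓝 b))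
    (h : ∀ k, y (k + 1) = A k * y k + B k) : Tendsto y atTop (𝓝 (b / c)) := by
  have hmain : Tendsto (fun k => |y k - b / c|) atTop (𝓝 0) := by
    have e2 : ∀ᶠ k : ℕ in atTop, (k : ℝ) * (1 - A k) < c + 1 :=
      hA.eventually (gt_mem_nhds (by linarith))
    have e4 : ∀ᶠ k : ℕ in atTop, c + 1 < (k : ℝ) :=
      tendsto_natCast_atTop_atTop.eventually (eventually_gt_atTop (c + 1))
    have hev : ∀ᶠ k : ℕ in atTop, |A k| = A k := by
      filter_upwards [e2, e4] with k h2 h4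
      apply abs_of_nonneg
      by_contra hneg
      push Not at hneg
      nlinarith
    -- The constant `b / c` solves the recursion up to `o(1 / k)`, so the distance to it obeys a
    -- homogeneous recursion with negligible forcing. `A k` may be negative for finitely many `k`,
    -- hence the absolute value.
    refine tendsto_zero_of_le_affine (A := fun k => |A k|)
      (B := fun k => |A k * (b / c) + B k - b / c|) hc (fun k => abs_nonneg _) ?_ ?_ ?_
    · refine hA.congr' ?_
      filter_upwards [hev] with k hk
      rw [hk]
    · have h1 : Tendsto (fun k : ℕ => (k : ℝ) * B k - (k : ℝ) * (1 - A k) * (b / c)) atTop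
          (𝓝 (b - c * (b / c))) := hB.sub (hA.mul_const _)
      rw [mul_div_cancel₀ _ hc.ne', sub_self] at h1
      have h2 := h1.abs
      rw [abs_zero] at h2
      refine h2.congr fun k => ?_
      rw [← abs_of_nonneg (Nat.cast_nonneg (α := ℝ) k), ← abs_mul,
        abs_of_nonneg (Nat.cast_nonneg (α := ℝ) k)]
      congr 1; ring
    · intro k
      rw [h k, ← abs_mul]
      calc |A k * y k + B k - b / c|
          = |A k * (y k - b / c) + (A k * (b / c) + B k - b / c)| := by congr 1; ring
        _ ≤ _ := abs_add_le _ _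
  have := (tendsto_zero_iff_abs_tendsto_zero _).2 hmain
  simpa using this.add_const (b / c)

/-! ### Independence of the past and the fresh sample -/

section Independence

variable {S X Y 𝓩 E : Type*} [MeasurableSpace S] {P : Measure S} [IsProbabilityMeasure P]
  [MeasurableSpace X] [MeasurableSpace Y] [MeasurableSpace 𝓩] {ν : Measure 𝓩}
  [IsProbabilityMeasure ν]
  [NormedAddCommGroup E] [InnerProductSpace ℝ E] [CompleteSpace E]

/-- The joint law of the three variables is a triple product, and reassociating it moves `A` next to
`U`. Applied with `U` the initial estimate, `A` the earlier samples and `B` the current one. -/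
theorem indepFun_prodMk_left {U : S → X} {A : S → Y} {B : S → 𝓩} (hU : Measurable U)
    (hA : Measurable A) (hB : Measurable B) (h : IndepFun U (fun s => (A s, B s)) P)
    (hAB : IndepFun A B P) : IndepFun (fun s => (U s, A s)) B P := by
  have hUA : IndepFun U A P := h.comp measurable_id measurable_fst
  have : IsProbabilityMeasure (P.map U) := Measure.isProbabilityMeasure_map hU.aemeasurable
  have : IsProbabilityMeasure (P.map A) := Measure.isProbabilityMeasure_map hA.aemeasurable
  have : IsProbabilityMeasure (P.map B) := Measure.isProbabilityMeasure_map hB.aemeasurable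
  rw [indepFun_iff_map_prod_eq_prod_map_map (by fun_prop) (by fun_prop)] at h hAB hUA ⊢
  rw [hUA]
  rw [hAB] at h
  have hassoc := (measurePreserving_prodAssoc (P.map U) (P.map A) (P.map B)).symm.map_eq
  rw [← hassoc, ← h, Measure.map_map (by fun_prop) (by fun_prop)]
  rfl

/-- The information carried by the initial estimate and the samples before time `k`. -/
abbrev past (w₀ : S → X) (z : ℕ → S → 𝓩) (k : ℕ) : MeasurableSpace S :=
  MeasurableSpace.comap (fun s => (w₀ s, fun i : Finset.range k => z i s)) inferInstance

omit [MeasurableSpace S] in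
theorem past_mono (w₀ : S → X) (z : ℕ → S → 𝓩) (k : ℕ) : past w₀ z k ≤ past w₀ z (k + 1) := by
  have hm : Measurable[past w₀ z (k + 1)]
      (fun s => (w₀ s, fun i : Finset.range (k + 1) => z i s)) := comap_measurable _
  have : Measurable[past w₀ z (k + 1)] (fun s => (w₀ s, fun i : Finset.range k => z i s)) := by
    have hg : Measurable (fun q : X × (Finset.range (k + 1) → 𝓩) =>
        (q.1, fun i : Finset.range k =>
          q.2 ⟨i.1, Finset.mem_range.2 ((Finset.mem_range.1 i.2).trans (Nat.lt_succ_self k))⟩)) := by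
      fun_prop
    exact hg.comp hm
  exact this.comap_le

omit [MeasurableSpace S] in
theorem measurable_past_init (w₀ : S → X) (z : ℕ → S → 𝓩) (k : ℕ) :
    Measurable[past w₀ z k] w₀ :=
  measurable_fst.comp (comap_measurable (fun s => (w₀ s, fun i : Finset.range k => z i s)))

omit [MeasurableSpace S] in
theorem measurable_past_succ (w₀ : S → X) (z : ℕ → S → 𝓩) (k : ℕ) :
    Measurable[past w₀ z (k + 1)] (z k) := by
  have hm : Measurable[past w₀ z (k + 1)]
      (fun s => (w₀ s, fun i : Finset.range (k + 1) => z i s)) := comap_measurable _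
  have hg : Measurable (fun q : X × (Finset.range (k + 1) → 𝓩) =>
      q.2 ⟨k, Finset.mem_range.2 (Nat.lt_succ_self k)⟩) := by fun_prop
  exact hg.comp hm

theorem past_le {w₀ : S → X} {z : ℕ → S → 𝓩} (hw : Measurable w₀) (hz : ∀ k, Measurable (z k))
    (k : ℕ) : past w₀ z k ≤ ‹MeasurableSpace S› := by
  have : Measurable (fun s => (w₀ s, fun i : Finset.range k => z i s)) := by fun_prop
  exact this.comap_le

/-- A quantity determined by the past is independent of the current sample. -/
theorem indepFun_of_measurable_past {w₀ : S → X} {z : ℕ → S → 𝓩} (hw : Measurable w₀)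
    (hz : ∀ k, Measurable (z k)) (hi : iIndepFun z P)
    (hwi : IndepFun w₀ (fun s k => z k s) P) {k : ℕ} {U : S → Y}
    (hU : Measurable[past w₀ z k] U) : IndepFun U (z k) P := by
  have h1 : IndepFun (fun s => (fun i : Finset.range k => z i s)) (z k) P := by
    have := hi.indepFun_finset (Finset.range k) {k} (by simp) hz
    exact this.comp (φ := id) (ψ := fun q : (({k} : Finset ℕ) → 𝓩) => q ⟨k, by simp⟩)
      measurable_id (by fun_prop)
  have h2 : IndepFun w₀ (fun s => ((fun i : Finset.range k => z i s), z k s)) P :=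
    hwi.comp (φ := id) (ψ := fun q : ℕ → 𝓩 => ((fun i : Finset.range k => q i), q k))
      measurable_id (by fun_prop)
  have h3 := indepFun_prodMk_left hw (by fun_prop) (hz k) h2 h1
  rw [IndepFun_iff_Indep] at h3 ⊢
  exact indep_of_indep_of_le_left h3 hU.comap_le

/-- Fubini for the product law of `(U, Z)`: the state is frozen and the fresh sample is integrated
out. This takes the place of conditioning on the past. -/
theorem integral_comp_indep {U : S → X} {Z : S → 𝓩} (hU : Measurable U) (hZ : Measurable Z)
    (hlaw : P.map Z = ν) (hi : IndepFun U Z P) {F : X → 𝓩 → ℝ}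
    (hF : Measurable (Function.uncurry F)) (hint : Integrable (fun s => F (U s) (Z s)) P) :
    ∫ s, F (U s) (Z s) ∂P = ∫ s, ∫ ζ, F (U s) ζ ∂ν ∂P := by
  have hprod : P.map (fun s => (U s, Z s)) = (P.map U).prod ν := by
    rw [(indepFun_iff_map_prod_eq_prod_map_map hU.aemeasurable hZ.aemeasurable).1 hi, hlaw]
  have : IsProbabilityMeasure (P.map U) := Measure.isProbabilityMeasure_map hU.aemeasurable
  have hUZ : Measurable (fun s => (U s, Z s)) := hU.prodMk hZ
  have e1 : ∫ s, F (U s) (Z s) ∂P = ∫ q, Function.uncurry F q ∂(P.map (fun s => (U s, Z s))) :=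
    (integral_map hUZ.aemeasurable hF.aestronglyMeasurable).symm
  have hint' : Integrable (Function.uncurry F) ((P.map U).prod ν) := by
    rw [← hprod]
    exact (integrable_map_measure hF.aestronglyMeasurable hUZ.aemeasurable).2 hint
  rw [e1, hprod, integral_prod _ hint', integral_map hU.aemeasurable]
  · rfl
  · exact hint'.integral_prod_left.aestronglyMeasurable

variable [MeasurableSpace E] [BorelSpace E] [SecondCountableTopology E]

theorem integral_inner_indep {U : S → X} {Z : S → 𝓩} (hU : Measurable U) (hZ : Measurable Z)
    (hlaw : P.map Z = ν) (hi : IndepFun U Z P) {g : X → E} {F : X → 𝓩 → E} (hg : Measurable g)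
    (hF : Measurable (Function.uncurry F)) (hFi : ∀ s, Integrable (F (U s)) ν)
    (hint : Integrable (fun s => inner ℝ (g (U s)) (F (U s) (Z s))) P) :
    ∫ s, inner ℝ (g (U s)) (F (U s) (Z s)) ∂P =
      ∫ s, inner ℝ (g (U s)) (∫ ζ, F (U s) ζ ∂ν) ∂P := by
  rw [integral_comp_indep hU hZ hlaw hi (F := fun x ζ => inner ℝ (g x) (F x ζ)) ?_ hint]
  · refine integral_congr_ae (ae_of_all _ fun s => ?_)
    exact integral_inner (hFi s) _
  · exact Measurable.inner (hg.comp measurable_fst) hF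

theorem integral_mul_indep {U : S → X} {Z : S → 𝓩} (hU : Measurable U) (hZ : Measurable Z)
    (hlaw : P.map Z = ν) (hi : IndepFun U Z P) {f : X → ℝ} {g : 𝓩 → ℝ} (hf : Measurable f)
    (hg : Measurable g) : ∫ s, f (U s) * g (Z s) ∂P = (∫ s, f (U s) ∂P) * ∫ ζ, g ζ ∂ν := by
  rw [hi.integral_fun_comp_mul_comp hU.aemeasurable hZ.aemeasurable hf.aestronglyMeasurable
    hg.aestronglyMeasurable, ← hlaw, integral_map hZ.aemeasurable hg.aestronglyMeasurable]

theorem integrable_mul_indep {U : S → X} {Z : S → 𝓩} (hZ : Measurable Z)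
    (hlaw : P.map Z = ν) (hi : IndepFun U Z P) {f : X → ℝ} {g : 𝓩 → ℝ} (hf : Measurable f)
    (hg : Measurable g) (hfi : Integrable (fun s => f (U s)) P) (hgi : Integrable g ν) :
    Integrable (fun s => f (U s) * g (Z s)) P := by
  have hgi' : Integrable (fun s => g (Z s)) P := by
    rw [← hlaw] at hgi
    exact hgi.comp_measurable hZ
  exact (hi.comp hf hg).integrable_mul hfi hgi'

end Independence

/-! ### The step sizes and recursions at scale `1 / k` -/

section Alpha

variable {γ : ℝ}

theorem alpha_pos (hγ : 0 < γ) (k : ℕ) : 0 < alpha γ k := by unfold alpha; positivity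

theorem alpha_le_one (hγ : 0 < γ) (k : ℕ) : alpha γ k ≤ 1 := by
  unfold alpha
  rw [div_le_one (by positivity)]
  simp

theorem tendsto_natCast_div_add (a : ℝ) :
    Tendsto (fun k : ℕ => (k : ℝ) / (a + k)) atTop (𝓝 1) := by
  have := tendsto_natCast_div_add_atTop (𝕜 := ℝ) a
  simpa [add_comm] using this

theorem tendsto_inv_add (a : ℝ) : Tendsto (fun k : ℕ => 1 / (a + (k : ℝ))) atTop (𝓝 0) := by
  have h : Tendsto (fun k : ℕ => a + (k : ℝ)) atTop atTop :=
    tendsto_atTop_add_const_left _ _ tendsto_natCast_atTop_atTop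
  simp only [one_div]
  exact h.inv_tendsto_atTop

theorem tendsto_alpha (γ : ℝ) : Tendsto (alpha γ) atTop (𝓝 0) := by
  have := (tendsto_inv_add γ).const_mul γ
  rw [mul_zero] at this
  refine this.congr fun k => ?_
  unfold alpha; ring

/-- If `u ≥ 0` satisfies `u (k+1) ≤ A k * u k + α_k² * τ k` with `1 - A k ∼ c α_k`,
`c γ > 1` and `τ → 0`, then `u k = o(1 / k)`. -/
theorem tendsto_mul_zero_of_step (hγ : 0 < γ) {u A τ : ℕ → ℝ} {c : ℝ} (hc : 1 < c * γ)
    (hu : ∀ k, 0 ≤ u k) (hA : Tendsto (fun k => (1 - A k) / alpha γ k) atTop (𝓝 c))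
    (hτ : Tendsto τ atTop (𝓝 0))
    (h : ∀ k, u (k + 1) ≤ A k * u k + alpha γ k ^ 2 * τ k) :
    Tendsto (fun k : ℕ => (γ + k) * u k) atTop (𝓝 0) := by
  have hq := tendsto_natCast_div_add γ
  have hi := tendsto_inv_add γ
  have hN : ∀ k : ℕ, 0 < γ + (k : ℝ) := fun k => by positivity
  -- The contraction `c α_k` is about `cγ / k`, and multiplication by `γ + k` expands by about `1 +
  -- 1 / k`. The net rate is `(cγ - 1) / k`, which explains the condition `1 < c * γ`.
  refine tendsto_zero_of_le_affine (c := c * γ - 1) (by linarith)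
    (A := fun k : ℕ => (γ + k + 1) / (γ + k) * A k)
    (B := fun k : ℕ => (γ + k + 1) * alpha γ k ^ 2 * τ k)
    (fun k => mul_nonneg (hN k).le (hu k)) ?_ ?_ ?_
  · have h1 : Tendsto (fun k : ℕ => ((k : ℝ) / (γ + k)) * ((1 + 1 / (γ + (k : ℝ))) *
        ((1 - A k) / alpha γ k * γ) - 1)) atTop (𝓝 (1 * ((1 + 0) * (c * γ) - 1))) :=
      hq.mul (((hi.const_add 1).mul (hA.mul_const γ)).sub_const 1)
    simp only [one_mul, add_zero] at h1
    refine h1.congr fun k => ?_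
    have := (hN k).ne'
    unfold alpha
    field_simp
    ring
  · have h1 : Tendsto (fun k : ℕ => ((k : ℝ) / (γ + k)) * (1 + 1 / (γ + (k : ℝ))) * γ ^ 2 * τ k)
        atTop (𝓝 (1 * (1 + 0) * γ ^ 2 * 0)) :=
      ((hq.mul (hi.const_add 1)).mul_const _).mul hτ
    simp only [mul_zero] at h1
    refine h1.congr fun k => ?_
    have := (hN k).ne'
    unfold alpha
    field_simp
  · intro k
    have := mul_le_mul_of_nonneg_left (h k) (hN (k + 1)).le
    have h2 := (hN k).ne'
    calc (γ + ((k + 1 : ℕ) : ℝ)) * u (k + 1)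
        ≤ (γ + ((k + 1 : ℕ) : ℝ)) * (A k * u k + alpha γ k ^ 2 * τ k) := this
      _ = _ := by push_cast; field_simp; ring

/-- If `u ≥ 0` satisfies `u (k+1) ≤ A k * u k + α_k² * τ` with `1 - A k ∼ c α_k` and
`c γ > 1`, then `u k = O(1 / k)`. -/
theorem bounded_mul_of_step (hγ : 0 < γ) {u A : ℕ → ℝ} {c τ : ℝ} (hc : 1 < c * γ) (hτ : 0 ≤ τ)
    (hu : ∀ k, 0 ≤ u k) (hA : Tendsto (fun k => (1 - A k) / alpha γ k) atTop (𝓝 c))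
    (h : ∀ k, u (k + 1) ≤ A k * u k + alpha γ k ^ 2 * τ) :
    ∃ C, 0 ≤ C ∧ ∀ k : ℕ, (γ + k) * u k ≤ C := by
  have hq := tendsto_natCast_div_add γ
  have hi := tendsto_inv_add γ
  have hN : ∀ k : ℕ, 0 < γ + (k : ℝ) := fun k => by positivity
  refine bounded_of_le_affine (c := c * γ - 1) (by linarith)
    (A := fun k : ℕ => (γ + k + 1) / (γ + k) * A k)
    (B := fun k : ℕ => (γ + k + 1) * alpha γ k ^ 2 * τ) (b := (1 + 1 / γ) * γ ^ 2 * τ)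
    (fun k => mul_nonneg (hN k).le (hu k)) ?_ ?_ ?_
  · have h1 : Tendsto (fun k : ℕ => ((k : ℝ) / (γ + k)) * ((1 + 1 / (γ + (k : ℝ))) *
        ((1 - A k) / alpha γ k * γ) - 1)) atTop (𝓝 (1 * ((1 + 0) * (c * γ) - 1))) :=
      hq.mul (((hi.const_add 1).mul (hA.mul_const γ)).sub_const 1)
    simp only [one_mul, add_zero] at h1
    refine h1.congr fun k => ?_
    have := (hN k).ne'
    unfold alpha
    field_simp
    ring
  · intro k
    have e : (k : ℝ) * ((γ + k + 1) * alpha γ k ^ 2 * τ) =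
        ((k : ℝ) / (γ + k)) * (1 + 1 / (γ + (k : ℝ))) * (γ ^ 2 * τ) := by
      have := (hN k).ne'
      unfold alpha
      field_simp
    rw [e, mul_assoc (1 + 1 / γ)]
    apply mul_le_mul_of_nonneg_right _ (by positivity)
    have h1 : (k : ℝ) / (γ + k) ≤ 1 := by rw [div_le_one (hN k)]; linarith
    have h2 : 1 / (γ + (k : ℝ)) ≤ 1 / γ := by
      apply one_div_le_one_div_of_le hγ; simp
    calc (k : ℝ) / (γ + k) * (1 + 1 / (γ + (k : ℝ))) ≤ 1 * (1 + 1 / γ) :=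
          mul_le_mul h1 (by linarith) (by have := hN k; positivity) (by norm_num)
      _ = _ := one_mul _
  · intro k
    have := mul_le_mul_of_nonneg_left (h k) (hN (k + 1)).le
    have h2 := (hN k).ne'
    calc (γ + ((k + 1 : ℕ) : ℝ)) * u (k + 1)
        ≤ (γ + ((k + 1 : ℕ) : ℝ)) * (A k * u k + alpha γ k ^ 2 * τ) := this
      _ = _ := by push_cast; field_simp; ring

theorem tendsto_of_mul_bounded {u : ℕ → ℝ} {C : ℝ} (hγ : 0 < γ) (hu : ∀ k, 0 ≤ u k)
    (h : ∀ k : ℕ, (γ + k) * u k ≤ C) : Tendsto u atTop (𝓝 0) := by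
  have h1 := (tendsto_inv_add γ).mul_const C
  rw [zero_mul] at h1
  refine squeeze_zero hu (fun k => ?_) h1
  have hN : 0 < γ + (k : ℝ) := by positivity
  rw [one_div, inv_mul_eq_div, le_div_iff₀ hN]
  linarith [h k]

end Alpha

/-! ### Distance to a centred ball -/

section Excess

variable {E : Type*} [NormedAddCommGroup E] [InnerProductSpace ℝ E]

/-- Distance of `u` to the centred ball of radius `ρ`. -/
def excess (ρ : ℝ) (u : E) : ℝ := max (‖u‖ - ρ) 0

/-- Vector from the nearest point of the centred ball of radius `ρ` to `u`. -/
noncomputable def excessVec (ρ : ℝ) (u : E) : E := (excess ρ u / ‖u‖) • u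

theorem excess_nonneg (ρ : ℝ) (u : E) : 0 ≤ excess ρ u := le_max_right _ _

theorem excess_le_norm {ρ : ℝ} (hρ : 0 ≤ ρ) (u : E) : excess ρ u ≤ ‖u‖ :=
  max_le (by linarith) (norm_nonneg u)

theorem excess_eq_zero {ρ : ℝ} {u : E} (h : ‖u‖ ≤ ρ) : excess ρ u = 0 :=
  max_eq_right (by linarith)

theorem norm_excessVec {ρ : ℝ} (hρ : 0 ≤ ρ) (u : E) : ‖excessVec ρ u‖ = excess ρ u := by
  by_cases h : ‖u‖ = 0
  · have := excess_le_norm hρ u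
    have h2 := excess_nonneg ρ u
    have : excess ρ u = 0 := by linarith
    simp [excessVec, this]
  · rw [excessVec, norm_smul, Real.norm_eq_abs, abs_of_nonneg
      (div_nonneg (excess_nonneg _ _) (norm_nonneg _)), div_mul_cancel₀ _ h]

/-- For nonzero `u` the right-hand side is `excess ρ u * ‖u‖`. Consequently a mean drift `-u`
contracts the squared excess at least as fast as it contracts the squared norm. -/
theorem sq_excess_le_inner {ρ : ℝ} (hρ : 0 ≤ ρ) (u : E) :
    excess ρ u ^ 2 ≤ inner ℝ (excessVec ρ u) u := by
  by_cases h : ‖u‖ = 0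
  · have := excess_le_norm hρ u
    have h2 := excess_nonneg ρ u
    have : excess ρ u = 0 := by linarith
    simp [excessVec, this]
  · rw [excessVec, real_inner_smul_left, real_inner_self_eq_norm_sq]
    have : excess ρ u / ‖u‖ * ‖u‖ ^ 2 = excess ρ u * ‖u‖ := by field_simp
    rw [this, sq]
    exact mul_le_mul_of_nonneg_left (excess_le_norm hρ u) (excess_nonneg _ _)

theorem norm_sub_excessVec_le {ρ : ℝ} (hρ : 0 ≤ ρ) (u : E) : ‖u - excessVec ρ u‖ ≤ ρ := by
  rcases le_total ‖u‖ ρ with h | h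
  · simpa [excessVec, excess_eq_zero h] using h
  · by_cases h0 : ‖u‖ = 0
    · have : u = 0 := norm_eq_zero.1 h0
      simp [this, excessVec, hρ]
    · have hpos : 0 < ‖u‖ := lt_of_le_of_ne (norm_nonneg _) (Ne.symm h0)
      have e : u - excessVec ρ u = (ρ / ‖u‖) • u := by
        have he : excess ρ u = ‖u‖ - ρ := max_eq_left (by linarith)
        rw [excessVec, he]
        nth_rewrite 1 [← one_smul ℝ u]
        rw [← sub_smul]
        congr 1
        field_simp
        ring
      rw [e, norm_smul, Real.norm_eq_abs, abs_of_nonneg (by positivity), div_mul_cancel₀ _ h0]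

/-- Second order expansion of the squared excess. -/
theorem sq_excess_step {ρ : ℝ} (hρ : 0 ≤ ρ) {u δ v : E} (hv : ‖v‖ ≤ ‖u + δ‖) :
    excess ρ v ^ 2 ≤ excess ρ u ^ 2 + 2 * inner ℝ (excessVec ρ u) δ + ‖δ‖ ^ 2 := by
  -- The nearest point `u - excessVec ρ u` of the ball has norm at most `ρ`; the rest of `u + δ` is
  -- `excessVec ρ u + δ`.
  have h1 : ‖v‖ - ρ ≤ ‖excessVec ρ u + δ‖ := by
    have h2 := norm_sub_excessVec_le hρ u
    have h3 : ‖u + δ‖ ≤ ‖u - excessVec ρ u‖ + ‖excessVec ρ u + δ‖ := by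
      calc ‖u + δ‖ = ‖(u - excessVec ρ u) + (excessVec ρ u + δ)‖ := by congr 1; abel
        _ ≤ _ := norm_add_le _ _
    linarith
  have h4 : excess ρ v ≤ ‖excessVec ρ u + δ‖ := max_le h1 (norm_nonneg _)
  have h5 := norm_add_sq_real (excessVec ρ u) δ
  rw [norm_excessVec hρ] at h5
  calc excess ρ v ^ 2 ≤ ‖excessVec ρ u + δ‖ ^ 2 := by
        gcongr
        exact excess_nonneg _ _
    _ = _ := h5

/-- In `sq_excess_step` the quadratic term is only needed when `u` or `δ` is not small. -/
theorem sq_excess_step' {ρ : ℝ} (hρ : 0 < ρ) {u δ v : E} (hv : ‖v‖ ≤ ‖u + δ‖) {q : ℝ}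
    (hq0 : 0 ≤ q) (hq : ρ / 2 < ‖u‖ ∨ ρ / 2 < ‖δ‖ → ‖δ‖ ^ 2 ≤ q) :
    excess ρ v ^ 2 ≤ excess ρ u ^ 2 + 2 * inner ℝ (excessVec ρ u) δ + q := by
  by_cases hb : ρ / 2 < ‖u‖ ∨ ρ / 2 < ‖δ‖
  · linarith [sq_excess_step hρ.le hv, hq hb]
  -- Here `u`, `u + δ` and hence `v` all stay in the ball, so both excesses vanish and no quadratic
  -- term is paid.
  · push Not at hb
    have h1 : excess ρ u = 0 := excess_eq_zero (by linarith [hb.1])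
    have h2 : excess ρ v = 0 := excess_eq_zero (by linarith [norm_add_le u δ, hb.1, hb.2])
    simp [h1, h2, excessVec, hq0]

variable [MeasurableSpace E] [BorelSpace E] [SecondCountableTopology E]

theorem measurable_excess (ρ : ℝ) : Measurable (excess ρ : E → ℝ) := by
  unfold excess; fun_prop

theorem measurable_excessVec (ρ : ℝ) : Measurable (excessVec ρ : E → E) := by
  unfold excessVec
  exact ((measurable_excess ρ).div measurable_norm).smul measurable_id

end Excess

/-! ### Moment bounds for noisy contractions -/

section NoisyContraction

variable {S 𝓩 E : Type*} [MeasurableSpace S] {P : Measure S} [IsProbabilityMeasure P]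
  [MeasurableSpace 𝓩] {ν : Measure 𝓩} [IsProbabilityMeasure ν]
  [NormedAddCommGroup E] [InnerProductSpace ℝ E] [CompleteSpace E]
  [MeasurableSpace E] [BorelSpace E] [SecondCountableTopology E]

theorem memLp_comp_law {F : Type*} [NormedAddCommGroup F] {Z : S → 𝓩} (hZ : Measurable Z)
    (hlaw : P.map Z = ν) {f : 𝓩 → F} {p : ENNReal} (hf : MemLp f p ν) :
    MemLp (fun s => f (Z s)) p P := by
  subst hlaw
  exact hf.comp_of_map hZ.aemeasurable

theorem integral_comp_law {F : Type*} [NormedAddCommGroup F] [NormedSpace ℝ F] {Z : S → 𝓩}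
    (hZ : Measurable Z) (hlaw : P.map Z = ν) {f : 𝓩 → F} (hf : AEStronglyMeasurable f ν) :
    ∫ s, f (Z s) ∂P = ∫ ζ, f ζ ∂ν := by
  subst hlaw
  exact (integral_map hZ.aemeasurable hf).symm

theorem integrable_inner_of_memLp {f g : S → E} (hf : MemLp f 2 P) (hg : MemLp g 2 P) :
    Integrable (fun s => inner ℝ (f s) (g s)) P := by
  refine (hf.norm.integrable_mul hg.norm).mono'
    (hf.aestronglyMeasurable.inner hg.aestronglyMeasurable) (ae_of_all _ fun s => ?_)
  exact abs_real_inner_le_norm _ _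

omit [IsProbabilityMeasure P] in
theorem integral_add_add {f g q : S → ℝ} (hf : Integrable f P) (hg : Integrable g P)
    (hq : Integrable q P) :
    ∫ s, (f s + g s + q s) ∂P = ∫ s, f s ∂P + ∫ s, g s ∂P + ∫ s, q s ∂P := by
  rw [← integral_add hf hg]
  exact integral_add (hf.add hg) hq

/-- Dominated convergence with majorant `h ^ 2`: as `α_k → 0`, each fixed `ζ` eventually leaves the
set. This Lindeberg-type truncation requires only a second moment of `h`. -/
theorem tendsto_integral_truncated_sq {h : 𝓩 → ℝ} (hm : Measurable h) (h2 : MemLp h 2 ν)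
    {γ c : ℝ} (hc : 0 < c) :
    Tendsto (fun k => ∫ ζ, {ζ | c < alpha γ k * h ζ}.indicator (fun ζ => h ζ ^ 2) ζ ∂ν)
      atTop (𝓝 0) := by
  have := tendsto_integral_of_dominated_convergence (μ := ν) (f := fun _ => (0 : ℝ))
    (F := fun k ζ => {ζ | c < alpha γ k * h ζ}.indicator (fun ζ => h ζ ^ 2) ζ)
    (fun ζ => h ζ ^ 2) ?_ h2.integrable_sq ?_ ?_
  · simpa using this
  · intro k
    refine (Measurable.indicator (by fun_prop) ?_).aestronglyMeasurable
    exact measurableSet_lt measurable_const (by fun_prop)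
  · intro k
    refine ae_of_all _ fun ζ => ?_
    rw [Set.indicator_apply]
    split_ifs
    · simp
    · simpa using sq_nonneg _
  · refine ae_of_all _ fun ζ => ?_
    have h1 := (tendsto_alpha γ).mul_const (h ζ)
    rw [zero_mul] at h1
    refine tendsto_const_nhds.congr' ?_
    filter_upwards [h1.eventually (gt_mem_nhds hc)] with k hk
    rw [Set.indicator_of_notMem]
    simp only [Set.mem_ofPred_eq, not_lt]
    exact hk.le

/-- A stochastic process with `‖e (k+1)‖ ≤ ‖e k + α_k η (e k) z_k‖`, where the fresh sample `z_k`
is independent of `e k` and `E η (u, z) = -u`. -/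
structure NoisyContraction (P : Measure S) (ν : Measure 𝓩) (γ : ℝ) (e : ℕ → S → E)
    (z : ℕ → S → 𝓩) (η : E → 𝓩 → E) (h : 𝓩 → ℝ) : Prop where
  meas_sample : ∀ k, Measurable (z k)
  law : ∀ k, P.map (z k) = ν
  meas : ∀ k, Measurable (e k)
  memLp : ∀ k, MemLp (e k) 2 P
  indep : ∀ k, IndepFun (e k) (z k) P
  meas_dir : Measurable (Function.uncurry η)
  meas_bound : Measurable h
  memLp_bound : MemLp h 2 ν
  bound_nonneg : ∀ ζ, 0 ≤ h ζ
  bound : ∀ k s ζ, ‖η (e k s) ζ‖ ≤ h ζ + ‖e k s‖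
  mean : ∀ u, ∫ ζ, η u ζ ∂ν = -u
  step : ∀ k s, ‖e (k + 1) s‖ ≤ ‖e k s + alpha γ k • η (e k s) (z k s)‖

namespace NoisyContraction

variable {γ : ℝ} {e : ℕ → S → E} {z : ℕ → S → 𝓩} {η : E → 𝓩 → E} {h : 𝓩 → ℝ}

theorem memLp_bound_comp (H : NoisyContraction P ν γ e z η h) (k : ℕ) :
    MemLp (fun s => h (z k s)) 2 P :=
  memLp_comp_law (H.meas_sample k) (H.law k) H.memLp_bound

theorem memLp_dir (H : NoisyContraction P ν γ e z η h) (k : ℕ) :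
    MemLp (fun s => η (e k s) (z k s)) 2 P := by
  refine ((H.memLp_bound_comp k).add (H.memLp k).norm).mono ?_ (ae_of_all _ fun s => ?_)
  · exact (H.meas_dir.comp ((H.meas k).prodMk (H.meas_sample k))).aestronglyMeasurable
  · refine (H.bound k s _).trans (le_of_eq ?_)
    rw [Pi.add_apply, Real.norm_eq_abs, abs_of_nonneg]
    exact add_nonneg (H.bound_nonneg _) (norm_nonneg _)

theorem memLp_excess (H : NoisyContraction P ν γ e z η h) {ρ : ℝ} (hρ : 0 ≤ ρ) (k : ℕ) :
    MemLp (fun s => excess ρ (e k s)) 2 P := by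
  refine (H.memLp k).mono ((measurable_excess ρ).comp (H.meas k)).aestronglyMeasurable
    (ae_of_all _ fun s => ?_)
  rw [Real.norm_eq_abs, abs_of_nonneg (excess_nonneg _ _)]
  exact excess_le_norm hρ _

theorem memLp_excessVec (H : NoisyContraction P ν γ e z η h) {ρ : ℝ} (hρ : 0 ≤ ρ) (k : ℕ) :
    MemLp (fun s => excessVec ρ (e k s)) 2 P := by
  refine (H.memLp k).mono ((measurable_excessVec ρ).comp (H.meas k)).aestronglyMeasurable
    (ae_of_all _ fun s => ?_)
  rw [norm_excessVec hρ]
  exact excess_le_norm hρ _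

/-- Integrating out the fresh sample replaces the direction by its mean `-e k`, and
`sq_excess_le_inner` turns the cross term into a contraction by `1 - 2 α_k`. The bound `q` on the
second order term is left free: a crude choice with `ρ = 0` gives `O(1 / k)`, a truncated one with
`ρ > 0` gives `o(1 / k)`. -/
theorem integral_excess_step (H : NoisyContraction P ν γ e z η h) (hγ : 0 < γ) {ρ : ℝ}
    (hρ : 0 ≤ ρ) (k : ℕ) {q : S → ℝ} (hq : Integrable q P)
    (hle : ∀ s, excess ρ (e (k + 1) s) ^ 2 ≤ excess ρ (e k s) ^ 2 +
      2 * inner ℝ (excessVec ρ (e k s)) (alpha γ k • η (e k s) (z k s)) + alpha γ k ^ 2 * q s) :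
    ∫ s, excess ρ (e (k + 1) s) ^ 2 ∂P ≤
      (1 - 2 * alpha γ k) * ∫ s, excess ρ (e k s) ^ 2 ∂P + alpha γ k ^ 2 * ∫ s, q s ∂P := by
  have hα := alpha_pos hγ k
  have i1 := (H.memLp_excess hρ (k + 1)).integrable_sq
  have i2 := (H.memLp_excess hρ k).integrable_sq
  have i3 := integrable_inner_of_memLp (H.memLp_excessVec hρ k) (H.memLp_dir k)
  have i4 := integrable_inner_of_memLp (H.memLp_excessVec hρ k) (H.memLp k)
  have hfib : ∀ s, Integrable (η (e k s)) ν := by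
    intro s
    refine ((H.memLp_bound.integrable one_le_two).add (integrable_const ‖e k s‖)).mono'
      (H.meas_dir.comp measurable_prodMk_left).aestronglyMeasurable
      (ae_of_all _ fun ζ => H.bound k s ζ)
  have hcross : ∫ s, inner ℝ (excessVec ρ (e k s)) (η (e k s) (z k s)) ∂P ≤
      -∫ s, excess ρ (e k s) ^ 2 ∂P := by
    rw [integral_inner_indep (H.meas k) (H.meas_sample k) (H.law k) (H.indep k)
      (measurable_excessVec ρ) H.meas_dir hfib i3, ← integral_neg]
    simp only [H.mean, inner_neg_right]
    exact integral_mono i4.neg i2.neg fun s => neg_le_neg (sq_excess_le_inner hρ _)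
  calc ∫ s, excess ρ (e (k + 1) s) ^ 2 ∂P
      ≤ ∫ s, (excess ρ (e k s) ^ 2 +
          2 * alpha γ k * inner ℝ (excessVec ρ (e k s)) (η (e k s) (z k s)) +
          alpha γ k ^ 2 * q s) ∂P := by
        refine integral_mono i1 ((i2.add (i3.const_mul _)).add (hq.const_mul _)) fun s => ?_
        have := hle s
        rw [real_inner_smul_right] at this
        beta_reduce
        linarith
    _ = ∫ s, excess ρ (e k s) ^ 2 ∂P +
          2 * alpha γ k * ∫ s, inner ℝ (excessVec ρ (e k s)) (η (e k s) (z k s)) ∂P +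
          alpha γ k ^ 2 * ∫ s, q s ∂P := by
        rw [integral_add_add i2 (i3.const_mul _) (hq.const_mul _), integral_const_mul,
          integral_const_mul]
    _ ≤ _ := by nlinarith

theorem norm_dir_sq_le (H : NoisyContraction P ν γ e z η h) (k : ℕ) (s : S) (ζ : 𝓩) :
    ‖η (e k s) ζ‖ ^ 2 ≤ 2 * h ζ ^ 2 + 2 * ‖e k s‖ ^ 2 := by
  have h1 := H.bound k s ζ
  have h2 := norm_nonneg (η (e k s) ζ)
  nlinarith [sq_nonneg (h ζ - ‖e k s‖)]

/-- The second moments are `O(1 / k)`. -/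
theorem second_moment_bound (H : NoisyContraction P ν γ e z η h) (hγ : 1 / 2 < γ) :
    ∃ C, 0 ≤ C ∧ ∀ k : ℕ, (γ + k) * ∫ s, ‖e k s‖ ^ 2 ∂P ≤ C := by
  have hγ0 : 0 < γ := by linarith
  -- The excess at radius `0` is the norm. The limiting rate `c = 2` is what requires `γ > 1 / 2`.
  refine bounded_mul_of_step hγ0 (c := 2) (τ := 2 * ∫ ζ, h ζ ^ 2 ∂ν)
    (A := fun k => 1 - 2 * alpha γ k + 2 * alpha γ k ^ 2) (by linarith)
    (mul_nonneg (by norm_num) (integral_nonneg fun ζ => sq_nonneg _))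
    (fun k => integral_nonneg fun s => sq_nonneg _) ?_ ?_
  · have h1 := ((tendsto_alpha γ).const_mul 2).const_sub 2
    rw [mul_zero, sub_zero] at h1
    refine h1.congr fun k => ?_
    have := (alpha_pos hγ0 k).ne'
    field_simp
    ring
  · intro k
    have hh := (H.memLp_bound_comp k).integrable_sq
    have he := (H.memLp k).norm.integrable_sq
    have e0 : ∀ u : E, excess 0 u = ‖u‖ := fun u => by simp [excess]
    have := H.integral_excess_step hγ0 le_rfl k
      (q := fun s => 2 * h (z k s) ^ 2 + 2 * ‖e k s‖ ^ 2)
      ((hh.const_mul 2).add (he.const_mul 2)) ?_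
    · simp only [e0] at this
      rw [integral_add (hh.const_mul 2) (he.const_mul 2), integral_const_mul,
        integral_const_mul, integral_comp_law (H.meas_sample k) (H.law k)
          (f := fun ζ => h ζ ^ 2) (H.meas_bound.pow_const 2).aestronglyMeasurable] at this
      refine this.trans (le_of_eq ?_)
      ring
    · intro s
      have h1 := sq_excess_step le_rfl (H.step k s)
      have h2 := H.norm_dir_sq_le k s (z k s)
      rw [norm_smul, mul_pow, Real.norm_eq_abs, sq_abs] at h1
      have h3 := mul_le_mul_of_nonneg_left h2 (sq_nonneg (alpha γ k))
      linarith

/-- The mass of the second moment away from the origin is `o(1 / k)`. -/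
theorem tendsto_excess (H : NoisyContraction P ν γ e z η h) (hγ : 1 / 2 < γ) {ρ : ℝ}
    (hρ : 0 < ρ) :
    Tendsto (fun k : ℕ => (γ + k) * ∫ s, excess ρ (e k s) ^ 2 ∂P) atTop (𝓝 0) := by
  have hγ0 : 0 < γ := by linarith
  obtain ⟨C, hC0, hC⟩ := H.second_moment_bound hγ
  have hu := tendsto_of_mul_bounded hγ0
    (fun k => integral_nonneg fun s => sq_nonneg ‖e k s‖) hC
  set u : ℕ → ℝ := fun k => ∫ s, ‖e k s‖ ^ 2 ∂P with hu_def
  set I : ℕ → 𝓩 → ℝ := fun k =>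
    {ζ | ρ / 4 < alpha γ k * h ζ}.indicator (fun ζ => h ζ ^ 2) with hI
  have hImeas : ∀ k, Measurable (I k) := fun k =>
    Measurable.indicator (H.meas_bound.pow_const 2)
      (measurableSet_lt measurable_const (H.meas_bound.const_mul _))
  have hI0 : ∀ k ζ, 0 ≤ I k ζ := fun k ζ => Set.indicator_nonneg (fun _ _ => sq_nonneg _) _
  have hIi : ∀ k, Integrable (I k) ν := fun k =>
    H.memLp_bound.integrable_sq.indicator
      (measurableSet_lt measurable_const (H.meas_bound.const_mul _))
  have hIt : Tendsto (fun k => ∫ ζ, I k ζ ∂ν) atTop (𝓝 0) :=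
    tendsto_integral_truncated_sq H.meas_bound H.memLp_bound (by positivity)
  -- The three terms of `τ` come from a large error, a large sample, and the part of the direction
  -- bounded by `‖e k‖`. All tend to zero because `u` does and by truncation.
  refine tendsto_mul_zero_of_step hγ0 (c := 2) (A := fun k => 1 - 2 * alpha γ k)
    (τ := fun k => 2 * (16 / ρ ^ 2) * (u k * ∫ ζ, h ζ ^ 2 ∂ν) + 2 * ∫ ζ, I k ζ ∂ν + 2 * u k)
    (by linarith) (fun k => integral_nonneg fun s => sq_nonneg _) ?_ ?_ ?_
  · refine tendsto_const_nhds.congr fun k => ?_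
    have := (alpha_pos hγ0 k).ne'
    field_simp
    ring
  · have := (((hu.mul_const (∫ ζ, h ζ ^ 2 ∂ν)).const_mul (2 * (16 / ρ ^ 2))).add
      (hIt.const_mul 2)).add (hu.const_mul 2)
    simpa using this
  · intro k
    have he := (H.memLp k).norm.integrable_sq
    have i1 : Integrable (fun s => ‖e k s‖ ^ 2 * h (z k s) ^ 2) P :=
      integrable_mul_indep (H.meas_sample k) (H.law k) (H.indep k)
        (f := fun v : E => ‖v‖ ^ 2) (g := fun ζ => h ζ ^ 2) (by fun_prop)
        (H.meas_bound.pow_const 2) he H.memLp_bound.integrable_sq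
    have e1 : ∫ s, ‖e k s‖ ^ 2 * h (z k s) ^ 2 ∂P = u k * ∫ ζ, h ζ ^ 2 ∂ν :=
      integral_mul_indep (H.meas k) (H.meas_sample k) (H.law k) (H.indep k)
        (f := fun v : E => ‖v‖ ^ 2) (g := fun ζ => h ζ ^ 2) (by fun_prop)
        (H.meas_bound.pow_const 2)
    have i2 : Integrable (fun s => I k (z k s)) P :=
      memLp_one_iff_integrable.1 (memLp_comp_law (H.meas_sample k) (H.law k)
        (memLp_one_iff_integrable.2 (hIi k)))
    have e2 : ∫ s, I k (z k s) ∂P = ∫ ζ, I k ζ ∂ν :=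
      integral_comp_law (H.meas_sample k) (H.law k) (hImeas k).aestronglyMeasurable
    have hα := alpha_pos hγ0 k
    have hα1 := alpha_le_one hγ0 k
    have := H.integral_excess_step hγ0 hρ.le k
      (q := fun s => 2 * (16 / ρ ^ 2) * (‖e k s‖ ^ 2 * h (z k s) ^ 2) + 2 * I k (z k s) +
        2 * ‖e k s‖ ^ 2)
      (((i1.const_mul _).add (i2.const_mul _)).add (he.const_mul 2)) ?_
    · rw [integral_add_add (i1.const_mul _) (i2.const_mul _) (he.const_mul 2), integral_const_mul,
        integral_const_mul, integral_const_mul, e1, e2] at this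
      exact this
    · intro s
      refine sq_excess_step' hρ (H.step k s) ?_ ?_
      · have := hI0 k (z k s)
        positivity
      · intro hb
        have h2 := H.norm_dir_sq_le k s (z k s)
        have h0 := H.bound_nonneg (z k s)
        have hn := norm_nonneg (e k s)
        rw [norm_smul, Real.norm_eq_abs, abs_of_pos hα] at hb ⊢
        rw [mul_pow]
        refine mul_le_mul_of_nonneg_left (h2.trans ?_) (sq_nonneg _)
        -- As `α_k ≤ 1` and `‖η‖ ≤ h + ‖e‖`, an error or step longer than `ρ / 2` forces `‖e‖ > ρ /
        -- 4` or `α_k h > ρ / 4`. In the first case `1 ≤ 16 / ρ ^ 2 * ‖e‖ ^ 2`, and independence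
        -- factors the resulting product, so no fourth moment of `e` is needed.
        have key : h (z k s) ^ 2 ≤ 16 / ρ ^ 2 * (‖e k s‖ ^ 2 * h (z k s) ^ 2) + I k (z k s) := by
          by_cases hbig : ρ / 4 < ‖e k s‖
          · have h3 : 1 ≤ 16 / ρ ^ 2 * ‖e k s‖ ^ 2 := by
              rw [div_mul_eq_mul_div, one_le_div (by positivity)]
              nlinarith
            have h4 := mul_le_mul_of_nonneg_right h3 (sq_nonneg (h (z k s)))
            have := hI0 k (z k s)
            linarith
          · have h5 : ρ / 4 < alpha γ k * h (z k s) := by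
              push Not at hbig
              rcases hb with hb | hb
              · linarith
              · have h6 := mul_le_mul_of_nonneg_left (H.bound k s (z k s)) hα.le
                nlinarith
            have h7 : I k (z k s) = h (z k s) ^ 2 :=
              Set.indicator_of_mem (s := {ζ | ρ / 4 < alpha γ k * h ζ}) h5 _
            rw [h7]
            have : 0 ≤ 16 / ρ ^ 2 * (‖e k s‖ ^ 2 * h (z k s) ^ 2) := by positivity
            linarith
        linarith

end NoisyContraction

end NoisyContraction

/-! ### The linearized recursion driven by an i.i.d. stream -/

section Stream

variable {S X 𝓩 E : Type*} [MeasurableSpace S] {P : Measure S} [IsProbabilityMeasure P]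
  [MeasurableSpace X] [MeasurableSpace 𝓩] {ν : Measure 𝓩} [IsProbabilityMeasure ν]
  [NormedAddCommGroup E] [InnerProductSpace ℝ E] [CompleteSpace E]
  [MeasurableSpace E] [BorelSpace E] [SecondCountableTopology E]

/-- An i.i.d. stream `z` with law `ν`, and a random variable `w₀` independent of it. -/
structure Stream (P : Measure S) (ν : Measure 𝓩) (w₀ : S → X) (z : ℕ → S → 𝓩) : Prop where
  meas_init : Measurable w₀
  meas : ∀ k, Measurable (z k)
  law : ∀ k, P.map (z k) = ν
  iIndep : iIndepFun z P
  indep_init : IndepFun w₀ (fun s k => z k s) P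

variable {w₀ : S → X} {z : ℕ → S → 𝓩} {γ : ℝ} {ξ : 𝓩 → E}

theorem Stream.indep (H : Stream P ν w₀ z) {Y : Type*} [MeasurableSpace Y] {k : ℕ} {U : S → Y}
    (hU : Measurable[past w₀ z k] U) : IndepFun U (z k) P :=
  indepFun_of_measurable_past H.meas_init H.meas H.iIndep H.indep_init hU

theorem Stream.measurable (H : Stream P ν w₀ z) {Y : Type*} [MeasurableSpace Y] {k : ℕ}
    {U : S → Y} (hU : Measurable[past w₀ z k] U) : Measurable U :=
  hU.mono (past_le H.meas_init H.meas k) le_rfl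

/-- A centred function of the current sample is orthogonal to the past. -/
theorem Stream.integral_inner_eq_zero (H : Stream P ν w₀ z) (hξ : Measurable ξ)
    (hξ2 : MemLp ξ 2 ν) (hξ0 : ∫ ζ, ξ ζ ∂ν = 0) {k : ℕ} {U : S → E}
    (hU : Measurable[past w₀ z k] U) (hU2 : MemLp U 2 P) :
    ∫ s, inner ℝ (U s) (ξ (z k s)) ∂P = 0 := by
  have := integral_inner_indep (H.measurable hU) (H.meas k) (H.law k) (H.indep hU)
    (g := id) (F := fun _ ζ => ξ ζ) measurable_id (hξ.comp measurable_snd)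
    (fun _ => hξ2.integrable one_le_two)
    (integrable_inner_of_memLp hU2 (memLp_comp_law (H.meas k) (H.law k) hξ2))
  simpa [hξ0] using this

/-- The linear recursion `L (k+1) = (1 - α_k) L k + α_k Z k`, started at zero. -/
noncomputable def linIter (γ : ℝ) (Z : ℕ → E) : ℕ → E
  | 0 => 0
  | k + 1 => (1 - alpha γ k) • linIter γ Z k + alpha γ k • Z k

/-- The unnormalized weighted sum of the first `k` linear iterates. -/
noncomputable def linSum (γ : ℝ) (Z : ℕ → E) (k : ℕ) : E :=
  ∑ i ∈ Finset.range k, (1 / alpha γ i) • linIter γ Z i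

theorem measurable_linIter (hξ : Measurable ξ) (γ : ℝ) (w₀ : S → X) (z : ℕ → S → 𝓩) (k : ℕ) :
    Measurable[past w₀ z k] (fun s => linIter γ (fun i => ξ (z i s)) k) := by
  induction k with
  | zero => exact measurable_const
  | succ k ih =>
    have h1 : Measurable[past w₀ z (k + 1)] (fun s => linIter γ (fun i => ξ (z i s)) k) :=
      ih.mono (past_mono w₀ z k) le_rfl
    have h2 : Measurable[past w₀ z (k + 1)] (fun s => ξ (z k s)) :=
      hξ.comp (measurable_past_succ w₀ z k)
    exact (h1.const_smul _).add (h2.const_smul _)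

theorem measurable_linSum (hξ : Measurable ξ) (γ : ℝ) (w₀ : S → X) (z : ℕ → S → 𝓩) (k : ℕ) :
    Measurable[past w₀ z k] (fun s => linSum γ (fun i => ξ (z i s)) k) := by
  unfold linSum
  refine Finset.measurable_fun_sum _ fun i hi => ?_
  have hmono : past w₀ z i ≤ past w₀ z k :=
    monotone_nat_of_le_succ (past_mono w₀ z) (Finset.mem_range.1 hi).le
  exact ((measurable_linIter hξ γ w₀ z i).mono hmono le_rfl).const_smul _

theorem Stream.memLp_linIter (H : Stream P ν w₀ z) (hξ2 : MemLp ξ 2 ν) (γ : ℝ) (k : ℕ) :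
    MemLp (fun s => linIter γ (fun i => ξ (z i s)) k) 2 P := by
  induction k with
  | zero => exact memLp_const 0
  | succ k ih =>
    exact (ih.const_smul (1 - alpha γ k)).add
      ((memLp_comp_law (H.meas k) (H.law k) hξ2).const_smul (alpha γ k))

theorem Stream.memLp_linSum (H : Stream P ν w₀ z) (hξ2 : MemLp ξ 2 ν) (γ : ℝ) (k : ℕ) :
    MemLp (fun s => linSum γ (fun i => ξ (z i s)) k) 2 P := by
  unfold linSum
  exact memLp_finsetSum _ fun i _ => (H.memLp_linIter hξ2 γ i).const_smul _

theorem Stream.noisyContraction_linIter (H : Stream P ν w₀ z) (hξ : Measurable ξ)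
    (hξ2 : MemLp ξ 2 ν) (hξ0 : ∫ ζ, ξ ζ ∂ν = 0) (γ : ℝ) :
    NoisyContraction P ν γ (fun k s => linIter γ (fun i => ξ (z i s)) k) z
      (fun u ζ => ξ ζ - u) (fun ζ => ‖ξ ζ‖) where
  meas_sample := H.meas
  law := H.law
  meas k := H.measurable (measurable_linIter hξ γ w₀ z k)
  memLp k := H.memLp_linIter hξ2 γ k
  indep k := H.indep (measurable_linIter hξ γ w₀ z k)
  meas_dir := (hξ.comp measurable_snd).sub measurable_fst
  meas_bound := hξ.norm
  memLp_bound := hξ2.norm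
  bound_nonneg _ := norm_nonneg _
  bound _ _ _ := norm_sub_le _ _
  mean u := by
    rw [integral_sub (hξ2.integrable one_le_two) (integrable_const _), hξ0]
    simp
  step k s := by
    apply le_of_eq
    congr 1
    simp only [linIter]
    module

/-- The cross term vanishes because the fresh centred noise is orthogonal to the past. -/
theorem Stream.linIter_sq_succ (H : Stream P ν w₀ z) (hξ : Measurable ξ)
    (hξ2 : MemLp ξ 2 ν) (hξ0 : ∫ ζ, ξ ζ ∂ν = 0) (γ : ℝ) (k : ℕ) :
    ∫ s, ‖linIter γ (fun i => ξ (z i s)) (k + 1)‖ ^ 2 ∂P =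
      (1 - alpha γ k) ^ 2 * ∫ s, ‖linIter γ (fun i => ξ (z i s)) k‖ ^ 2 ∂P +
        alpha γ k ^ 2 * ∫ ζ, ‖ξ ζ‖ ^ 2 ∂ν := by
  have hL := H.memLp_linIter hξ2 γ k
  have hZ := memLp_comp_law (H.meas k) (H.law k) hξ2
  have e1 := H.integral_inner_eq_zero hξ hξ2 hξ0 (measurable_linIter hξ γ w₀ z k) hL
  have e2 : ∫ s, ‖ξ (z k s)‖ ^ 2 ∂P = ∫ ζ, ‖ξ ζ‖ ^ 2 ∂ν :=
    integral_comp_law (H.meas k) (H.law k) (f := fun ζ => ‖ξ ζ‖ ^ 2)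
      (hξ.norm.pow_const 2).aestronglyMeasurable
  have i1 := hL.norm.integrable_sq
  have i2 := integrable_inner_of_memLp hL hZ
  have i3 := hZ.norm.integrable_sq
  calc ∫ s, ‖linIter γ (fun i => ξ (z i s)) (k + 1)‖ ^ 2 ∂P
      = ∫ s, ((1 - alpha γ k) ^ 2 * ‖linIter γ (fun i => ξ (z i s)) k‖ ^ 2 +
          2 * (1 - alpha γ k) * alpha γ k *
            inner ℝ (linIter γ (fun i => ξ (z i s)) k) (ξ (z k s)) +
          alpha γ k ^ 2 * ‖ξ (z k s)‖ ^ 2) ∂P := by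
        refine integral_congr_ae (ae_of_all _ fun s => ?_)
        simp only [linIter]
        rw [norm_add_sq_real, norm_smul, norm_smul, real_inner_smul_left, real_inner_smul_right,
          mul_pow, mul_pow, Real.norm_eq_abs, Real.norm_eq_abs, sq_abs, sq_abs]
        ring
    _ = _ := by
        rw [integral_add_add (i1.const_mul _) (i2.const_mul _) (i3.const_mul _),
          integral_const_mul, integral_const_mul, integral_const_mul, e1, e2]
        ring

/-- Only the old part of the new iterate survives: the fresh noise is orthogonal both to the sum and
to the last iterate. Together with the recursions for the two squared norms this closes the system
of second moments. -/
theorem Stream.linSum_inner_succ (H : Stream P ν w₀ z) (hξ : Measurable ξ)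
    (hξ2 : MemLp ξ 2 ν) (hξ0 : ∫ ζ, ξ ζ ∂ν = 0) (γ : ℝ) (k : ℕ) :
    ∫ s, inner ℝ (linSum γ (fun i => ξ (z i s)) (k + 1))
        (linIter γ (fun i => ξ (z i s)) (k + 1)) ∂P =
      (1 - alpha γ k) * (∫ s, inner ℝ (linSum γ (fun i => ξ (z i s)) k)
        (linIter γ (fun i => ξ (z i s)) k) ∂P +
          1 / alpha γ k * ∫ s, ‖linIter γ (fun i => ξ (z i s)) k‖ ^ 2 ∂P) := by
  have hL := H.memLp_linIter hξ2 γ k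
  have hT := H.memLp_linSum hξ2 γ k
  have hZ := memLp_comp_law (H.meas k) (H.law k) hξ2
  have e1 := H.integral_inner_eq_zero hξ hξ2 hξ0 (measurable_linIter hξ γ w₀ z k) hL
  have e2 := H.integral_inner_eq_zero hξ hξ2 hξ0 (measurable_linSum hξ γ w₀ z k) hT
  have i1 := integrable_inner_of_memLp hT hL
  have i2 := hL.norm.integrable_sq
  have i3 := integrable_inner_of_memLp hT hZ
  have i4 := integrable_inner_of_memLp hL hZ
  calc _ = ∫ s, ((1 - alpha γ k) * (inner ℝ (linSum γ (fun i => ξ (z i s)) k)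
            (linIter γ (fun i => ξ (z i s)) k) +
            1 / alpha γ k * ‖linIter γ (fun i => ξ (z i s)) k‖ ^ 2) +
          alpha γ k * inner ℝ (linSum γ (fun i => ξ (z i s)) k) (ξ (z k s)) +
          alpha γ k * (1 / alpha γ k) *
            inner ℝ (linIter γ (fun i => ξ (z i s)) k) (ξ (z k s))) ∂P := by
        refine integral_congr_ae (ae_of_all _ fun s => ?_)
        simp only [linIter, linSum, Finset.sum_range_succ]
        simp only [inner_add_left, inner_add_right, real_inner_smul_left, real_inner_smul_right,
          real_inner_self_eq_norm_sq]
        ring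
    _ = _ := by
        have i5 : Integrable (fun s => (1 - alpha γ k) *
            (inner ℝ (linSum γ (fun i => ξ (z i s)) k) (linIter γ (fun i => ξ (z i s)) k) +
              1 / alpha γ k * ‖linIter γ (fun i => ξ (z i s)) k‖ ^ 2)) P :=
          (i1.add (i2.const_mul _)).const_mul _
        rw [integral_add_add i5 (i3.const_mul _) (i4.const_mul _), integral_const_mul, integral_const_mul, integral_const_mul, e1, e2,
          integral_add i1 (i2.const_mul _), integral_const_mul]
        ring

theorem Stream.linSum_sq_succ (H : Stream P ν w₀ z) (hξ2 : MemLp ξ 2 ν) (γ : ℝ) (k : ℕ) :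
    ∫ s, ‖linSum γ (fun i => ξ (z i s)) (k + 1)‖ ^ 2 ∂P =
      ∫ s, ‖linSum γ (fun i => ξ (z i s)) k‖ ^ 2 ∂P +
        2 * (1 / alpha γ k) * ∫ s, inner ℝ (linSum γ (fun i => ξ (z i s)) k)
          (linIter γ (fun i => ξ (z i s)) k) ∂P +
        (1 / alpha γ k) ^ 2 * ∫ s, ‖linIter γ (fun i => ξ (z i s)) k‖ ^ 2 ∂P := by
  have hL := H.memLp_linIter hξ2 γ k
  have hT := H.memLp_linSum hξ2 γ k
  rw [← integral_const_mul, ← integral_const_mul, ← integral_add_add hT.norm.integrable_sq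
    ((integrable_inner_of_memLp hT hL).const_mul _) (hL.norm.integrable_sq.const_mul _)]
  refine integral_congr_ae (ae_of_all _ fun s => ?_)
  simp only [linSum, Finset.sum_range_succ]
  rw [norm_add_sq_real, norm_smul, real_inner_smul_right, mul_pow, Real.norm_eq_abs, sq_abs]
  ring

end Stream

/-! ### Asymptotics of the three second-moment recursions -/

section Asymptotics

variable {γ s : ℝ} {a b c : ℕ → ℝ}

theorem tendsto_add_div_add (x : ℝ) {y : ℝ} (hy : 0 < y) :
    Tendsto (fun k : ℕ => (x + k) / (y + k)) atTop (𝓝 1) := by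
  have := ((tendsto_inv_add y).const_mul (x - y)).const_add 1
  rw [mul_zero, add_zero] at this
  refine this.congr fun k => ?_
  have : y + (k : ℝ) ≠ 0 := by positivity
  field_simp
  ring

/-- Heuristically `a k ∼ A / k`, where the decay rate `2γ / k`, less `1 / k` from the rescaling,
balances the forcing `γ² s / k²`. -/
theorem tendsto_linIter_sq (hγ : 1 / 2 < γ)
    (ha : ∀ k, a (k + 1) = (1 - alpha γ k) ^ 2 * a k + alpha γ k ^ 2 * s) :
    Tendsto (fun k : ℕ => (γ + k) * a k) atTop (𝓝 (γ ^ 2 * s / (2 * γ - 1))) := by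
  have hγ0 : 0 < γ := by linarith
  have hN : ∀ k : ℕ, γ + (k : ℝ) ≠ 0 := fun k => by positivity
  have hq := tendsto_natCast_div_add γ
  have hi := tendsto_inv_add γ
  refine tendsto_of_eq_affine (by linarith)
    (A := fun k : ℕ => (γ + k + 1) / (γ + k) * (1 - alpha γ k) ^ 2)
    (B := fun k : ℕ => (γ + k + 1) * alpha γ k ^ 2 * s) ?_ ?_ ?_
  · have h1 := hq.mul ((((hi.const_mul (2 * γ - γ ^ 2)).const_add (2 * γ - 1))).sub
      ((hi.pow 2).const_mul (γ ^ 2)))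
    have e : (1 : ℝ) * (2 * γ - 1 + (2 * γ - γ ^ 2) * 0 - γ ^ 2 * 0 ^ 2) = 2 * γ - 1 := by ring
    rw [e] at h1
    refine h1.congr fun k => ?_
    have := hN k
    unfold alpha
    field_simp
    ring
  · have h1 := (hq.mul (hi.const_add 1)).mul_const (γ ^ 2 * s)
    have e : (1 : ℝ) * (1 + 0) * (γ ^ 2 * s) = γ ^ 2 * s := by ring
    rw [e] at h1
    refine h1.congr fun k => ?_
    have := hN k
    unfold alpha
    field_simp
  · intro k
    have := hN k
    rw [ha k]
    push_cast
    field_simp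
    ring

/-- The forcing `a k / α_k` tends to the constant `A / γ`, against a decay of rate `γ / k`; hence
linear growth with slope `A / (γ (γ + 1))`. -/
theorem tendsto_linSum_inner (hγ : 0 < γ) {A : ℝ}
    (hA : Tendsto (fun k : ℕ => (γ + k) * a k) atTop (𝓝 A))
    (hb : ∀ k, b (k + 1) = (1 - alpha γ k) * (b k + 1 / alpha γ k * a k)) :
    Tendsto (fun k : ℕ => b k / (γ + k)) atTop (𝓝 (A / γ / (γ + 1))) := by
  have hN : ∀ k : ℕ, γ + (k : ℝ) ≠ 0 := fun k => by positivity
  have hN1 : ∀ k : ℕ, γ + 1 + (k : ℝ) ≠ 0 := fun k => by positivity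
  have hq := tendsto_natCast_div_add γ
  have hq1 := tendsto_natCast_div_add (γ + 1)
  refine tendsto_of_eq_affine (by linarith)
    (A := fun k : ℕ => k / (γ + 1 + k))
    (B := fun k : ℕ => k * a k / (γ * (γ + 1 + k))) ?_ ?_ ?_
  · have h1 := hq1.mul_const (γ + 1)
    rw [one_mul] at h1
    refine h1.congr fun k => ?_
    have := hN1 k
    field_simp
    ring
  · have h1 := (hq1.mul hq).mul (hA.div_const γ)
    rw [one_mul, one_mul] at h1
    refine h1.congr fun k => ?_
    have := hN k
    have := hN1 k
    field_simp
  · intro k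
    have := hN k
    have := hN1 k
    have e : γ + ((k + 1 : ℕ) : ℝ) = γ + 1 + k := by push_cast; ring
    rw [hb k, e]
    unfold alpha
    field_simp
    ring

/-- The increments are about `2 B k² / γ`, which sum to a cubic. The term in `a` grows only linearly
and does not reach the limit. -/
theorem tendsto_linSum_sq (hγ : 0 < γ) {A B : ℝ}
    (hA : Tendsto (fun k : ℕ => (γ + k) * a k) atTop (𝓝 A))
    (hB : Tendsto (fun k : ℕ => b k / (γ + k)) atTop (𝓝 B))
    (hc : ∀ k, c (k + 1) = c k + 2 * (1 / alpha γ k) * b k + (1 / alpha γ k) ^ 2 * a k) :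
    Tendsto (fun k : ℕ => c k / (γ + k) ^ 3) atTop (𝓝 (2 * B / γ / 3)) := by
  have hN : ∀ k : ℕ, γ + (k : ℝ) ≠ 0 := fun k => by positivity
  have hN1 : ∀ k : ℕ, γ + 1 + (k : ℝ) ≠ 0 := fun k => by positivity
  have hj := tendsto_inv_add (γ + 1)
  have hq1 := tendsto_natCast_div_add (γ + 1)
  refine tendsto_of_eq_affine (by norm_num)
    (A := fun k : ℕ => ((γ + k) / (γ + 1 + k)) ^ 3)
    (B := fun k : ℕ => (2 * (1 / alpha γ k) * b k + (1 / alpha γ k) ^ 2 * a k) /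
      (γ + 1 + k) ^ 3) ?_ ?_ ?_
  · have h1 := hq1.mul (((hj.const_mul 3).const_sub 3).add (hj.pow 2))
    have e : (1 : ℝ) * (3 - 3 * 0 + 0 ^ 2) = 3 := by norm_num
    rw [e] at h1
    refine h1.congr fun k => ?_
    have := hN1 k
    field_simp
    ring
  · have h1 := (hq1.mul (((hj.const_sub 1).pow 2).mul ((hB.const_mul 2).div_const γ))).add
      (hq1.mul (((hj.const_sub 1).mul hj).mul (hA.div_const (γ ^ 2))))
    have e : (1 : ℝ) * ((1 - 0) ^ 2 * (2 * B / γ)) + 1 * ((1 - 0) * 0 * (A / γ ^ 2)) =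
      2 * B / γ := by ring
    rw [e] at h1
    refine h1.congr fun k => ?_
    have := hN k
    have := hN1 k
    have e2 : 1 - 1 / (γ + 1 + (k : ℝ)) = (γ + k) / (γ + 1 + k) := by field_simp; ring
    rw [e2]
    unfold alpha
    field_simp
  · intro k
    have := hN k
    have := hN1 k
    have e : γ + ((k + 1 : ℕ) : ℝ) = γ + 1 + k := by push_cast; ring
    rw [hc k, e]
    have := (alpha_pos hγ k).ne'
    field_simp
    ring

theorem sum_one_div_alpha (hγ : γ ≠ 0) (k : ℕ) :
    ∑ r ∈ Finset.range (k + 1), 1 / alpha γ r = (1 + k) * (2 * γ + k) / (2 * γ) := by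
  induction k with
  | zero => simp [alpha]; field_simp
  | succ k ih =>
    rw [Finset.sum_range_succ, ih]
    unfold alpha
    push_cast
    field_simp
    ring

end Asymptotics

/-! ### Mean square of the weighted average of the linear recursion -/

section

variable {S X 𝓩 E : Type*} [MeasurableSpace S] {P : Measure S} [IsProbabilityMeasure P]
  [MeasurableSpace X] [MeasurableSpace 𝓩] {ν : Measure 𝓩} [IsProbabilityMeasure ν]
  [NormedAddCommGroup E] [InnerProductSpace ℝ E] [CompleteSpace E]
  [MeasurableSpace E] [BorelSpace E] [SecondCountableTopology E]
  {w₀ : S → X} {z : ℕ → S → 𝓩} {γ : ℝ} {ξ : 𝓩 → E}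

theorem Stream.tendsto_linIter (H : Stream P ν w₀ z) (hξ : Measurable ξ)
    (hξ2 : MemLp ξ 2 ν) (hξ0 : ∫ ζ, ξ ζ ∂ν = 0) (hγ : 1 / 2 < γ) :
    Tendsto (fun k : ℕ => (γ + k) * ∫ s, ‖linIter γ (fun i => ξ (z i s)) k‖ ^ 2 ∂P) atTop
      (𝓝 (γ ^ 2 * (∫ ζ, ‖ξ ζ‖ ^ 2 ∂ν) / (2 * γ - 1))) :=
  tendsto_linIter_sq hγ fun k => H.linIter_sq_succ hξ hξ2 hξ0 γ k

/-- Exact asymptotics of the weighted average of the linear recursion. -/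
theorem Stream.tendsto_linAvg (H : Stream P ν w₀ z) (hξ : Measurable ξ)
    (hξ2 : MemLp ξ 2 ν) (hξ0 : ∫ ζ, ξ ζ ∂ν = 0) (hγ : 1 / 2 < γ) :
    Tendsto (fun k : ℕ => (k : ℝ) * ∫ s, ‖∑ i ∈ Finset.range (k + 1),
        weight γ k i • linIter γ (fun i => ξ (z i s)) i‖ ^ 2 ∂P) atTop
      (𝓝 (8 * γ ^ 2 * (∫ ζ, ‖ξ ζ‖ ^ 2 ∂ν) / (3 * (γ + 1) * (2 * γ - 1)))) := by
  have hγ0 : 0 < γ := by linarith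
  have h1 := H.tendsto_linIter hξ hξ2 hξ0 hγ
  have h2 := tendsto_linSum_inner (b := fun k => ∫ s, inner ℝ (linSum γ (fun i => ξ (z i s)) k)
    (linIter γ (fun i => ξ (z i s)) k) ∂P) hγ0 h1 fun k => H.linSum_inner_succ hξ hξ2 hξ0 γ k
  have h3 := tendsto_linSum_sq
    (c := fun k => ∫ s, ‖linSum γ (fun i => ξ (z i s)) k‖ ^ 2 ∂P) hγ0 h1 h2 fun k => H.linSum_sq_succ hξ2 γ k
  have h4 := (tendsto_add_atTop_iff_nat 1).2 h3
  -- The total weight is `(1 + k) (2γ + k) / (2γ)`, so the normalized second moment is `4γ²` times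
  -- `E‖T_{k+1}‖² / (γ + 1 + k)³` up to ratios tending to one.
  have r1 := tendsto_natCast_div_add (1 : ℝ)
  have r2 := tendsto_add_div_add (γ + 1) (y := 1) one_pos
  have r3 := (tendsto_add_div_add (γ + 1) (y := 2 * γ) (by linarith)).pow 2
  have h5 := (((r1.mul r2).mul r3).mul_const (4 * γ ^ 2)).mul h4
  have hlim : 1 * 1 * 1 ^ 2 * (4 * γ ^ 2) * (2 * (γ ^ 2 * (∫ ζ, ‖ξ ζ‖ ^ 2 ∂ν) / (2 * γ - 1) / γ /
      (γ + 1)) / γ / 3) = 8 * γ ^ 2 * (∫ ζ, ‖ξ ζ‖ ^ 2 ∂ν) / (3 * (γ + 1) * (2 * γ - 1)) := by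
    have : 2 * γ - 1 ≠ 0 := by linarith
    field_simp
    ring
  rw [hlim] at h5
  refine h5.congr fun k => ?_
  have e1 : ∀ s, ‖∑ i ∈ Finset.range (k + 1), weight γ k i • linIter γ (fun i => ξ (z i s)) i‖ ^ 2
      = (1 / ((1 + k) * (2 * γ + k) / (2 * γ))) ^ 2 *
        ‖linSum γ (fun i => ξ (z i s)) (k + 1)‖ ^ 2 := by
    intro s
    have : ∑ i ∈ Finset.range (k + 1), weight γ k i • linIter γ (fun i => ξ (z i s)) i =
        (1 / ((1 + k) * (2 * γ + k) / (2 * γ))) • linSum γ (fun i => ξ (z i s)) (k + 1) := by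
      rw [linSum, Finset.smul_sum]
      refine Finset.sum_congr rfl fun i _ => ?_
      rw [smul_smul, weight, sum_one_div_alpha hγ0.ne']
      congr 1
      ring
    rw [this, norm_smul, mul_pow, Real.norm_eq_abs, sq_abs]
  simp only [e1]
  rw [integral_const_mul]
  have n1 : γ + 1 + (k : ℝ) ≠ 0 := by positivity
  have n2 : (1 : ℝ) + k ≠ 0 := by positivity
  have n3 : 2 * γ + (k : ℝ) ≠ 0 := by positivity
  have e : γ + ((k + 1 : ℕ) : ℝ) = γ + 1 + k := by push_cast; ring
  rw [e]
  field_simp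
  norm_num

end

/-! ### Projection onto the constraint set -/

section Projection

variable {d : ℕ} {Ω : Set (Vec d)}

/-- Variational characterization of the minimizer defining a projected gradient step. -/
theorem argminOn_spec (hc : IsCompact Ω) (hconv : Convex ℝ Ω) {w : Vec d} (hw : w ∈ Ω) (t : ℝ)
    (g : Vec d) :
    let v := argminOn Ω fun u => t * inner ℝ g (u - w) + 1 / 2 * ‖u - w‖ ^ 2
    v ∈ Ω ∧ ∀ y ∈ Ω, inner ℝ (w - t • g - v) (y - v) ≤ 0 := by
  intro v
  have hex : ∃ v, v ∈ Ω ∧ IsMinOn (fun u => t * inner ℝ g (u - w) + 1 / 2 * ‖u - w‖ ^ 2) Ω v :=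
    hc.exists_isMinOn ⟨w, hw⟩ (by fun_prop)
  have hv : v ∈ Ω ∧ IsMinOn (fun u => t * inner ℝ g (u - w) + 1 / 2 * ‖u - w‖ ^ 2) Ω v :=
    Classical.epsilon_spec hex
  refine ⟨hv.1, fun y hy => ?_⟩
  set c := inner ℝ (w - t • g - v) (y - v) with hcdef
  set D := ‖y - v‖ ^ 2 with hD
  have hD0 : 0 ≤ D := sq_nonneg _
  have key : ∀ r : ℝ, 0 < r → r ≤ 1 → c ≤ r / 2 * D := by
    intro r hr hr1
    have hmem : v + r • (y - v) ∈ Ω := hconv.add_smul_sub_mem hv.1 hy ⟨hr.le, hr1⟩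
    have h1 : t * inner ℝ g (v - w) + 1 / 2 * ‖v - w‖ ^ 2 ≤
      t * inner ℝ g (v + r • (y - v) - w) + 1 / 2 * ‖v + r • (y - v) - w‖ ^ 2 := hv.2 hmem
    have e1 : v + r • (y - v) - w = (v - w) + r • (y - v) := by abel
    rw [e1, norm_add_sq_real, inner_add_right, real_inner_smul_right, real_inner_smul_right,
      norm_smul, mul_pow, Real.norm_eq_abs, sq_abs] at h1
    have e2 : c = -(inner ℝ (v - w) (y - v)) - t * inner ℝ g (y - v) := by
      rw [hcdef, show w - t • g - v = -(v - w) - t • g by abel, inner_sub_left, inner_neg_left,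
        real_inner_smul_left]
    rw [e2]
    have h2 : r * (-(inner ℝ (v - w) (y - v)) - t * inner ℝ g (y - v)) ≤ r * (r / 2 * D) := by
      nlinarith
    exact le_of_mul_le_mul_left h2 hr
  by_contra hpos
  push Not at hpos
  -- With this fraction `r` of the segment, `r * D ≤ c`, so `key` would give `c ≤ c / 2`.
  have hr : 0 < min 1 (c / (D + 1)) := lt_min one_pos (by positivity)
  have h3 := key _ hr (min_le_left _ _)
  have h4 : min 1 (c / (D + 1)) * (D + 1) ≤ c := by
    have := min_le_right 1 (c / (D + 1))
    rwa [le_div_iff₀ (by positivity)] at this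
  nlinarith

/-- The projection onto a convex set, given by its variational characterization. -/
noncomputable def projOn (Ω : Set (Vec d)) (u : Vec d) : Vec d :=
  Classical.epsilon fun v => v ∈ Ω ∧ ∀ y ∈ Ω, inner ℝ (u - v) (y - v) ≤ 0

/-- Each inequality is tested at the other point and the two are added; Cauchy–Schwarz finishes.
Uniqueness, nonexpansiveness and continuity of the projection all follow from this. -/
theorem norm_sub_le_of_variational {u₁ u₂ v₁ v₂ : Vec d} (hv₁ : v₁ ∈ Ω) (hv₂ : v₂ ∈ Ω)
    (h₁ : ∀ y ∈ Ω, inner ℝ (u₁ - v₁) (y - v₁) ≤ 0)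
    (h₂ : ∀ y ∈ Ω, inner ℝ (u₂ - v₂) (y - v₂) ≤ 0) : ‖v₁ - v₂‖ ≤ ‖u₁ - u₂‖ := by
  have e1 := h₁ v₂ hv₂
  have e2 := h₂ v₁ hv₁
  have e3 : ‖v₁ - v₂‖ ^ 2 = inner ℝ (u₁ - u₂) (v₁ - v₂) + inner ℝ (u₁ - v₁) (v₂ - v₁) +
      inner ℝ (u₂ - v₂) (v₁ - v₂) := by
    rw [show v₂ - v₁ = -(v₁ - v₂) by abel, inner_neg_right, ← real_inner_self_eq_norm_sq]
    simp only [inner_sub_left]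
    ring
  have e4 := real_inner_le_norm (u₁ - u₂) (v₁ - v₂)
  by_contra hlt
  push Not at hlt
  have hn := norm_nonneg (u₁ - u₂)
  nlinarith

theorem projOn_spec (hc : IsCompact Ω) (hconv : Convex ℝ Ω) (hne : Ω.Nonempty) (u : Vec d) :
    projOn Ω u ∈ Ω ∧ ∀ y ∈ Ω, inner ℝ (u - projOn Ω u) (y - projOn Ω u) ≤ 0 := by
  obtain ⟨w, hw⟩ := hne
  -- With unit step and gradient `w - u`, the gradient step from `w` lands exactly at `u`.
  have := argminOn_spec hc hconv hw 1 (w - u)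
  simp only [one_smul, sub_sub_cancel] at this
  exact Classical.epsilon_spec (p := fun v => v ∈ Ω ∧ ∀ y ∈ Ω, inner ℝ (u - v) (y - v) ≤ 0)
    ⟨_, this⟩

theorem projOn_eq (hc : IsCompact Ω) (hconv : Convex ℝ Ω) {u v : Vec d} (hv : v ∈ Ω)
    (h : ∀ y ∈ Ω, inner ℝ (u - v) (y - v) ≤ 0) : projOn Ω u = v := by
  have hs := projOn_spec hc hconv ⟨v, hv⟩ u
  have := norm_sub_le_of_variational hs.1 hv hs.2 h
  rw [sub_self, norm_zero] at this
  exact sub_eq_zero.1 (norm_le_zero_iff.1 this)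

theorem projOn_self (hc : IsCompact Ω) (hconv : Convex ℝ Ω) {u : Vec d} (hu : u ∈ Ω) :
    projOn Ω u = u :=
  projOn_eq hc hconv hu (by simp)

theorem norm_projOn_sub_le (hc : IsCompact Ω) (hconv : Convex ℝ Ω) (u : Vec d) {y : Vec d}
    (hy : y ∈ Ω) : ‖projOn Ω u - y‖ ≤ ‖u - y‖ := by
  have hs := projOn_spec hc hconv ⟨y, hy⟩ u
  exact norm_sub_le_of_variational hs.1 hy hs.2 (by simp)

/-- With `y` the previous iterate, this bounds the displacement due to the projection by the length
of the gradient step. -/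
theorem norm_projOn_sub_self_le (hc : IsCompact Ω) (hconv : Convex ℝ Ω) (u : Vec d) {y : Vec d}
    (hy : y ∈ Ω) : ‖projOn Ω u - u‖ ≤ ‖u - y‖ := by
  have hs := (projOn_spec hc hconv ⟨y, hy⟩ u).2 y hy
  set v := projOn Ω u
  have e : ‖u - y‖ ^ 2 = ‖u - v‖ ^ 2 - 2 * inner ℝ (u - v) (y - v) + ‖y - v‖ ^ 2 := by
    rw [← norm_sub_sq_real]
    congr 2
    abel
  rw [norm_sub_rev]
  by_contra hlt
  push Not at hlt
  have := norm_nonneg (u - y)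
  nlinarith [sq_nonneg ‖y - v‖]

theorem continuous_projOn (hc : IsCompact Ω) (hconv : Convex ℝ Ω) (hne : Ω.Nonempty) :
    Continuous (projOn Ω) := by
  refine (LipschitzWith.of_dist_le_mul (K := 1) fun u₁ u₂ => ?_).continuous
  have h1 := projOn_spec hc hconv hne u₁
  have h2 := projOn_spec hc hconv hne u₂
  rw [dist_eq_norm, dist_eq_norm, NNReal.coe_one, one_mul]
  exact norm_sub_le_of_variational h1.1 h2.1 h1.2 h2.2

variable {μ γ : ℝ} {w₀ : Vec d} {z : ℕ → Vec d × ℝ}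

theorem iter_mem (hc : IsCompact Ω) (hconv : Convex ℝ Ω) (hw : w₀ ∈ Ω) (k : ℕ) :
    iter Ω μ γ w₀ z k ∈ Ω := by
  induction k with
  | zero => exact hw
  | succ k ih => exact (argminOn_spec hc hconv ih _ _).1

theorem iter_succ (hc : IsCompact Ω) (hconv : Convex ℝ Ω) (hw : w₀ ∈ Ω) (k : ℕ) :
    iter Ω μ γ w₀ z (k + 1) = projOn Ω (iter Ω μ γ w₀ z k -
      stepSize μ γ k • stochGrad (z k) (iter Ω μ γ w₀ z k)) := by
  have := argminOn_spec hc hconv (iter_mem (μ := μ) (γ := γ) (z := z) hc hconv hw k)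
    (stepSize μ γ k) (stochGrad (z k) (iter Ω μ γ w₀ z k))
  exact (projOn_eq hc hconv this.1 this.2).symm

theorem residual_eq (w w' : Vec d) (ζ : Vec d × ℝ) :
    residual w ζ = inner ℝ ζ.1 (w - w') + residual w' ζ := by
  unfold residual
  rw [inner_sub_right]
  ring

theorem measurable_residual (w : Vec d) : Measurable (residual w) := by
  unfold residual; fun_prop

theorem measurable_iter {S : Type*} [MeasurableSpace S] (hc : IsCompact Ω) (hconv : Convex ℝ Ω)
    {w₀ : S → Vec d} (hw : ∀ s, w₀ s ∈ Ω) (hne : Ω.Nonempty) (z : ℕ → S → Vec d × ℝ) (k : ℕ) :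
    Measurable[past w₀ z k] (fun s => iter Ω μ γ (w₀ s) (fun i => z i s) k) := by
  induction k with
  | zero => exact measurable_past_init w₀ z 0
  | succ k ih =>
    have h1 := ih.mono (past_mono w₀ z k) le_rfl
    have h2 := measurable_past_succ w₀ z k
    have hΦ : Measurable (fun q : Vec d × (Vec d × ℝ) =>
        projOn Ω (q.1 - stepSize μ γ k • stochGrad q.2 q.1)) := by
      refine (continuous_projOn hc hconv hne).measurable.comp ?_
      unfold stochGrad residual
      fun_prop
    have h3 := hΦ.comp (h1.prodMk h2)
    have e : (fun s => iter Ω μ γ (w₀ s) (fun i => z i s) (k + 1)) =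
        (fun q : Vec d × (Vec d × ℝ) => projOn Ω (q.1 - stepSize μ γ k • stochGrad q.2 q.1)) ∘
          (fun s => (iter Ω μ γ (w₀ s) (fun i => z i s) k, z k s)) := by
      funext s
      exact iter_succ hc hconv (hw s) k
    rw [e]
    exact h3

end Projection

/-! ### Moment identities of the isotropic linear model -/

section Model

variable {d : ℕ} {ν : Measure (Vec d × ℝ)} [IsProbabilityMeasure ν] {wopt : Vec d} {μ σ : ℝ}

/-- The moment identities of the linear regression model with isotropic regressors. -/
structure LinearModel (ν : Measure (Vec d × ℝ)) (wopt : Vec d) (μ σ : ℝ) : Prop where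
  memLp_x : MemLp (fun z : Vec d × ℝ => z.1) 4 ν
  memLp_res : MemLp (residual wopt) 2 ν
  mu_pos : 0 < μ
  corr : ∀ i j : Fin d, ∫ z, z.1 i * z.1 j ∂ν = if i = j then μ else 0
  cross : ∀ i : Fin d, ∫ z, z.1 i * residual wopt z ∂ν = 0
  memLp_noise : MemLp (fun z : Vec d × ℝ => residual wopt z • z.1) 2 ν
  noise_sq : ∫ z, ‖residual wopt z • z.1‖ ^ 2 ∂ν = d * μ * σ ^ 2

theorem memLp_coord (h : MemLp (fun z : Vec d × ℝ => z.1) 4 ν) (i : Fin d) :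
    MemLp (fun z : Vec d × ℝ => z.1 i) 4 ν := by
  refine h.mono (by fun_prop) (ae_of_all _ fun z => ?_)
  exact PiLp.norm_apply_le z.1 i

theorem memLp_coord_two (h : MemLp (fun z : Vec d × ℝ => z.1) 4 ν) (i : Fin d) :
    MemLp (fun z : Vec d × ℝ => z.1 i) 2 ν :=
  (memLp_coord h i).mono_exponent (by norm_num)

theorem memLp_two_norm_sq (h : MemLp (fun z : Vec d × ℝ => z.1) 4 ν) :
    MemLp (fun z : Vec d × ℝ => ‖z.1‖ ^ 2) 2 ν := by
  rw [memLp_two_iff_integrable_sq (by fun_prop)]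
  refine (h.integrable_norm_pow (p := 4) (by norm_num)).congr (ae_of_all _ fun z => ?_)
  simp only
  ring

/-- The weighted second moment identity `E[g(x) v²] = σ² E[g(x)]`, as an identity of lower
integrals. -/
theorem lintegral_mul_of_condExp_const {X Y : Type*} [MeasurableSpace X] [MeasurableSpace Y]
    {ν : Measure (X × Y)} [IsProbabilityMeasure ν] {q : X × Y → ℝ} {c : ℝ} (hq0 : ∀ z, 0 ≤ q z)
    (hqm : Measurable q) (hq : Integrable q ν)
    (h : ν[q | MeasurableSpace.comap (fun z : X × Y => z.1) inferInstance] =ᵐ[ν] fun _ => c)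
    {g : X → ENNReal} (hg : Measurable g) :
    ∫⁻ z, g z.1 * ENNReal.ofReal (q z) ∂ν = ENNReal.ofReal c * ∫⁻ z, g z.1 ∂ν := by
  -- The conditional expectation hypothesis says that reweighting by `q` multiplies the law of the
  -- first component by `c`. Every nonnegative `g` can then be integrated without knowing in advance
  -- that the product is integrable.
  have hmap : (ν.withDensity fun z => ENNReal.ofReal (q z)).map Prod.fst =
      ENNReal.ofReal c • ν.map Prod.fst := by
    ext A hA
    have hA' : MeasurableSet (Prod.fst ⁻¹' A : Set (X × Y)) := measurable_fst hA
    have hAm : MeasurableSet[MeasurableSpace.comap (fun z : X × Y => z.1) inferInstance]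
        (Prod.fst ⁻¹' A : Set (X × Y)) := ⟨A, hA, rfl⟩
    rw [Measure.map_apply measurable_fst hA, withDensity_apply _ hA', Measure.smul_apply,
      Measure.map_apply measurable_fst hA, ← ofReal_integral_eq_lintegral_ofReal hq.integrableOn
        (ae_of_all _ hq0), ← setIntegral_condExp measurable_fst.comap_le hq hAm,
      setIntegral_congr_ae hA' (h.mono fun z hz _ => hz), setIntegral_const, smul_eq_mul,
      ENNReal.ofReal_mul measureReal_nonneg, Measure.real, ENNReal.ofReal_toReal (by finiteness),
      smul_eq_mul, mul_comm]
  have h1 : ∫⁻ x, g x ∂((ν.withDensity fun z => ENNReal.ofReal (q z)).map Prod.fst) =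
      ∫⁻ z, g z.1 * ENNReal.ofReal (q z) ∂ν := by
    rw [lintegral_map hg measurable_fst, lintegral_withDensity_eq_lintegral_mul _
      hqm.ennreal_ofReal (show Measurable fun z : X × Y => g z.1 from hg.comp measurable_fst)]
    refine lintegral_congr fun z => ?_
    simp [mul_comm]
  rw [← h1, hmap, lintegral_smul_measure, lintegral_map hg measurable_fst, smul_eq_mul]

/-- Finiteness of the lower integral yields integrability of the product. Thus `‖x‖² v²` is
integrable although `v` is only square integrable. -/
theorem integrable_mul_of_condExp_const {X Y : Type*} [MeasurableSpace X] [MeasurableSpace Y]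
    {ν : Measure (X × Y)} [IsProbabilityMeasure ν] {q : X × Y → ℝ} {c : ℝ} (hq0 : ∀ z, 0 ≤ q z)
    (hqm : Measurable q) (hq : Integrable q ν) (hc : 0 ≤ c)
    (h : ν[q | MeasurableSpace.comap (fun z : X × Y => z.1) inferInstance] =ᵐ[ν] fun _ => c)
    {g : X → ℝ} (hg0 : ∀ x, 0 ≤ g x) (hg : Measurable g)
    (hgi : Integrable (fun z : X × Y => g z.1) ν) :
    Integrable (fun z => g z.1 * q z) ν ∧
      ∫ z, g z.1 * q z ∂ν = c * ∫ z, g z.1 ∂ν := by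
  have key := lintegral_mul_of_condExp_const hq0 hqm hq h hg.ennreal_ofReal
  simp only [← ENNReal.ofReal_mul (hg0 _)] at key
  have hm : Measurable (fun z : X × Y => g z.1 * q z) := (hg.comp measurable_fst).mul hqm
  have hn : ∀ z : X × Y, 0 ≤ g z.1 * q z := fun z => mul_nonneg (hg0 _) (hq0 _)
  have hgn : ∫⁻ z : X × Y, ENNReal.ofReal (g z.1) ∂ν = ENNReal.ofReal (∫ z, g z.1 ∂ν) :=
    (ofReal_integral_eq_lintegral_ofReal hgi (ae_of_all _ fun z => hg0 _)).symm
  constructor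
  · refine ⟨hm.aestronglyMeasurable, ?_⟩
    rw [hasFiniteIntegral_iff_ofReal (ae_of_all _ hn), key, hgn]
    exact ENNReal.mul_lt_top ENNReal.ofReal_lt_top ENNReal.ofReal_lt_top
  · rw [integral_eq_lintegral_of_nonneg_ae (ae_of_all _ hn) hm.aestronglyMeasurable, key, hgn,
      ← ENNReal.ofReal_mul hc, ENNReal.toReal_ofReal]
    exact mul_nonneg hc (integral_nonneg fun z => hg0 _)

/-- Equal laws make the diagonal a constant `c`, so the matrix is `c` times the identity and `c` is
its only eigenvalue. Invertibility in positive dimension excludes `c = 0`. -/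
theorem corrMatrix_diag
    (hR : IsUnit (corrMatrix ν)) (hd : 1 ≤ d)
    (hμ : IsLeast {t : ℝ | Module.End.HasEigenvalue (Matrix.toLin' (corrMatrix ν)) t} μ)
    (hident : ∀ i j : Fin d, IdentDistrib
      (fun z : Vec d × ℝ => z.1 i) (fun z : Vec d × ℝ => z.1 j) ν ν)
    (huncorr : ∀ i j : Fin d, i ≠ j → ∫ z, z.1 i * z.1 j ∂ν = 0) :
    0 < μ ∧ ∀ i j : Fin d, ∫ z, z.1 i * z.1 j ∂ν = if i = j then μ else 0 := by
  let i₀ : Fin d := ⟨0, hd⟩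
  set c := ∫ z, z.1 i₀ * z.1 i₀ ∂ν with hc
  have hdiag : ∀ i : Fin d, ∫ z, z.1 i * z.1 i ∂ν = c := by
    intro i
    have h1 := ((hident i i₀).comp (u := fun t : ℝ => t * t) (by fun_prop)).integral_eq
    exact h1
  have hmat : corrMatrix ν = c • (1 : Matrix (Fin d) (Fin d) ℝ) := by
    ext i j
    rw [corrMatrix, Matrix.of_apply, Matrix.smul_apply, Matrix.one_apply]
    split_ifs with hij
    · rw [hij, hdiag]; simp
    · rw [huncorr i j hij]; simp
  have hμc : μ = c := by
    obtain ⟨v, hv⟩ := Module.End.HasEigenvalue.exists_hasEigenvector hμ.1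
    have h1 := hv.apply_eq_smul
    rw [hmat] at h1
    simp only [map_smul, Matrix.toLin'_one, LinearMap.smul_apply, LinearMap.id_apply] at h1
    have h2 : (c - μ) • v = 0 := by rw [sub_smul, h1, sub_self]
    rcases smul_eq_zero.1 h2 with h | h
    · linarith
    · exact absurd h hv.2
  have hc0 : 0 ≤ c := integral_nonneg fun z => mul_self_nonneg _
  have hcne : c ≠ 0 := by
    intro h0
    rw [hmat, h0, zero_smul] at hR
    have : Nonempty (Fin d) := ⟨i₀⟩
    exact not_isUnit_zero hR
  refine ⟨hμc ▸ lt_of_le_of_ne hc0 (Ne.symm hcne), fun i j => ?_⟩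
  split_ifs with hij
  · rw [hij, hdiag, hμc]
  · exact huncorr i j hij

/-- The cross moments vanish by pulling `x` out of the conditional expectation. The noise energy is
`σ² E‖x‖²`, and `E‖x‖²` is the trace `d * μ`. -/
theorem linearModel_of_condExp (hx4 : MemLp (fun z : Vec d × ℝ => z.1) 4 ν) (hμ : 0 < μ)
    (hcorr : ∀ i j : Fin d, ∫ z, z.1 i * z.1 j ∂ν = if i = j then μ else 0)
    (hv2 : MemLp (residual wopt) 2 ν)
    (hv_mean : ν[residual wopt |
      MeasurableSpace.comap (fun z : Vec d × ℝ => z.1) inferInstance] =ᵐ[ν] fun _ => 0)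
    (hv_var : ν[fun z => residual wopt z ^ 2 |
      MeasurableSpace.comap (fun z : Vec d × ℝ => z.1) inferInstance] =ᵐ[ν] fun _ => σ ^ 2) :
    LinearModel ν wopt μ σ := by
  have hx2 : MemLp (fun z : Vec d × ℝ => z.1) 2 ν := hx4.mono_exponent (by norm_num)
  obtain ⟨h1, h2⟩ := integrable_mul_of_condExp_const (g := fun x : Vec d => ‖x‖ ^ 2)
    (fun z => sq_nonneg _) ((measurable_residual wopt).pow_const 2) hv2.integrable_sq
    (sq_nonneg σ) hv_var (fun x => sq_nonneg _) (by fun_prop) hx2.norm.integrable_sq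
  have hsq : ∀ z : Vec d × ℝ, ‖residual wopt z • z.1‖ ^ 2 = ‖z.1‖ ^ 2 * residual wopt z ^ 2 := by
    intro z
    rw [norm_smul, mul_pow, Real.norm_eq_abs, sq_abs, mul_comm]
  refine ⟨hx4, hv2, hμ, hcorr, fun i => ?_, ?_, ?_⟩
  · have hle : MeasurableSpace.comap (fun z : Vec d × ℝ => z.1) inferInstance ≤
        (inferInstance : MeasurableSpace (Vec d × ℝ)) := measurable_fst.comap_le
    have hsm : StronglyMeasurable[MeasurableSpace.comap (fun z : Vec d × ℝ => z.1) inferInstance]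
        (fun z : Vec d × ℝ => z.1 i) := by
      have : Measurable[MeasurableSpace.comap (fun z : Vec d × ℝ => z.1) inferInstance]
          (fun z : Vec d × ℝ => z.1 i) :=
        (by fun_prop : Measurable (fun x : Vec d => x i)).comp (comap_measurable _)
      exact this.stronglyMeasurable
    have hint : Integrable (fun z : Vec d × ℝ => z.1 i * residual wopt z) ν :=
      (memLp_coord_two hx4 i).integrable_mul hv2
    have hpull := condExp_mul_of_stronglyMeasurable_left hsm hint (hv2.integrable one_le_two)
    rw [← integral_condExp hle]
    have : ν[fun z : Vec d × ℝ => z.1 i * residual wopt z |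
        MeasurableSpace.comap (fun z : Vec d × ℝ => z.1) inferInstance] =ᵐ[ν] fun _ => 0 := by
      filter_upwards [hpull, hv_mean] with z hz1 hz2
      exact hz1.trans (by simp [hz2])
    rw [integral_congr_ae this]
    simp
  · rw [memLp_two_iff_integrable_sq_norm]
    · simpa only [hsq] using h1
    · exact ((measurable_residual wopt).smul measurable_fst).aestronglyMeasurable
  · simp only [hsq]
    rw [h2]
    have hn : ∀ z : Vec d × ℝ, ‖z.1‖ ^ 2 = ∑ i, z.1 i * z.1 i := by
      intro z
      rw [EuclideanSpace.norm_sq_eq]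
      simp [sq]
    simp only [hn]
    have hi : ∀ i : Fin d, Integrable (fun z : Vec d × ℝ => z.1 i * z.1 i) ν := fun i =>
      (memLp_coord_two hx4 i).integrable_mul (memLp_coord_two hx4 i)
    rw [integral_finsetSum _ fun i _ => hi i]
    simp only [hcorr, if_true, Finset.sum_const, Finset.card_univ, Fintype.card_fin, nsmul_eq_mul]
    ring

namespace LinearModel

theorem memLp_inner (M : LinearModel ν wopt μ σ) (u : Vec d) :
    MemLp (fun z : Vec d × ℝ => inner ℝ z.1 u) 2 ν := by
  refine ((M.memLp_x.mono_exponent (by norm_num : (2 : ENNReal) ≤ 4)).norm.mul_const ‖u‖).mono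
    (by fun_prop) (ae_of_all _ fun z => ?_)
  rw [norm_mul, norm_norm, norm_norm]
  exact norm_inner_le_norm _ _

theorem integral_inner_mul_inner (M : LinearModel ν wopt μ σ) (u w : Vec d) :
    ∫ z, inner ℝ z.1 u * inner ℝ z.1 w ∂ν = μ * inner ℝ u w := by
  have e : ∀ z : Vec d × ℝ, inner ℝ z.1 u * inner ℝ z.1 w =
      ∑ i, ∑ j, (u i * w j) * (z.1 i * z.1 j) := by
    intro z
    simp only [PiLp.inner_apply, RCLike.inner_apply, conj_trivial, Finset.sum_mul_sum]
    refine Finset.sum_congr rfl fun i _ => Finset.sum_congr rfl fun j _ => ?_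
    ring
  have hij : ∀ i j : Fin d, Integrable (fun z : Vec d × ℝ => (u i * w j) * (z.1 i * z.1 j)) ν :=
    fun i j => ((memLp_coord_two M.memLp_x i).integrable_mul
      (memLp_coord_two M.memLp_x j)).const_mul _
  simp only [e]
  rw [integral_finsetSum _ fun i _ => integrable_finsetSum _ fun j _ => hij i j]
  simp only [integral_finsetSum _ fun j _ => hij _ j, integral_const_mul, M.corr]
  simp only [mul_ite, mul_zero, Finset.sum_ite_eq, Finset.mem_univ, if_true]
  rw [PiLp.inner_apply, Finset.mul_sum]
  refine Finset.sum_congr rfl fun i _ => ?_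
  simp only [RCLike.inner_apply, conj_trivial]
  ring

theorem integral_residual_mul_inner (M : LinearModel ν wopt μ σ) (u : Vec d) :
    ∫ z, residual wopt z * inner ℝ z.1 u ∂ν = 0 := by
  have e : ∀ z : Vec d × ℝ, residual wopt z * inner ℝ z.1 u =
      ∑ i, u i * (z.1 i * residual wopt z) := by
    intro z
    simp only [PiLp.inner_apply, RCLike.inner_apply, conj_trivial, Finset.mul_sum]
    refine Finset.sum_congr rfl fun i _ => ?_
    ring
  have hi : ∀ i : Fin d, Integrable (fun z : Vec d × ℝ => z.1 i * residual wopt z) ν := fun i =>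
    (memLp_coord_two M.memLp_x i).integrable_mul M.memLp_res
  simp only [e]
  rw [integral_finsetSum _ fun i _ => (hi i).const_mul _]
  simp [integral_const_mul, M.cross]

theorem integral_noise (M : LinearModel ν wopt μ σ) :
    ∫ z, residual wopt z • z.1 ∂ν = 0 := by
  refine ext_inner_left ℝ fun u => ?_
  rw [← integral_inner (M.memLp_noise.integrable one_le_two), inner_zero_right,
    ← M.integral_residual_mul_inner u]
  simp only [real_inner_smul_right, real_inner_comm]

theorem memLp_inner_smul (M : LinearModel ν wopt μ σ) (u : Vec d) :
    MemLp (fun z : Vec d × ℝ => (inner ℝ z.1 u : ℝ) • z.1) 2 ν := by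
  refine ((memLp_two_norm_sq M.memLp_x).mul_const ‖u‖).mono (by fun_prop)
    (ae_of_all _ fun z => ?_)
  rw [norm_smul, norm_mul, norm_norm, norm_pow, norm_norm]
  have := norm_inner_le_norm (𝕜 := ℝ) z.1 u
  nlinarith [norm_nonneg z.1]

theorem integral_inner_smul (M : LinearModel ν wopt μ σ) (u : Vec d) :
    ∫ z, (inner ℝ z.1 u : ℝ) • z.1 ∂ν = μ • u := by
  refine ext_inner_left ℝ fun w => ?_
  rw [← integral_inner ((M.memLp_inner_smul u).integrable one_le_two), real_inner_smul_right,
    real_inner_comm, ← M.integral_inner_mul_inner u w]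
  refine integral_congr_ae (ae_of_all _ fun z => ?_)
  simp only [real_inner_smul_right]
  rw [real_inner_comm w z.1]

/-- The excess risk is an isotropic quadratic. -/
theorem risk_eq (M : LinearModel ν wopt μ σ) (w : Vec d) :
    risk ν w = risk ν wopt + μ * ‖w - wopt‖ ^ 2 := by
  have i1 := M.memLp_res.integrable_sq
  have i2 : Integrable (fun z => residual wopt z * inner ℝ z.1 (w - wopt)) ν :=
    M.memLp_res.integrable_mul (M.memLp_inner (w - wopt))
  have i3 : Integrable (fun z : Vec d × ℝ =>
      (inner ℝ z.1 (w - wopt) : ℝ) * inner ℝ z.1 (w - wopt)) ν :=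
    (M.memLp_inner (w - wopt)).integrable_mul (M.memLp_inner (w - wopt))
  have e : ∀ z : Vec d × ℝ, (inner ℝ z.1 w - z.2) ^ 2 = residual wopt z ^ 2 +
      2 * (residual wopt z * inner ℝ z.1 (w - wopt)) +
      (inner ℝ z.1 (w - wopt) : ℝ) * inner ℝ z.1 (w - wopt) := by
    intro z
    have := residual_eq w wopt z
    unfold residual at this ⊢
    rw [this]
    ring
  have e2 : risk ν wopt = ∫ z, residual wopt z ^ 2 ∂ν := rfl
  rw [risk]
  simp only [e]
  rw [integral_add_add i1 (i2.const_mul 2) i3, integral_const_mul, M.integral_residual_mul_inner,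
    M.integral_inner_mul_inner, real_inner_self_eq_norm_sq, e2]
  ring

end LinearModel

end Model

/-! ### Mean-square perturbations -/

section Perturbation

variable {S E : Type*} [MeasurableSpace S] {P : Measure S} [IsProbabilityMeasure P]
  [NormedAddCommGroup E] [InnerProductSpace ℝ E]

/-- Cauchy–Schwarz, from the discriminant of the nonnegative quadratic `t ↦ E‖t f + g‖²`. -/
theorem sq_integral_inner_le {f g : S → E} (hf : MemLp f 2 P) (hg : MemLp g 2 P) :
    (∫ s, inner ℝ (f s) (g s) ∂P) ^ 2 ≤ (∫ s, ‖f s‖ ^ 2 ∂P) * ∫ s, ‖g s‖ ^ 2 ∂P := by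
  have hfg : Integrable (fun s => inner ℝ (f s) (g s)) P := by
    refine (hf.norm.integrable_mul hg.norm).mono'
      (hf.aestronglyMeasurable.inner hg.aestronglyMeasurable) (ae_of_all _ fun s => ?_)
    exact abs_real_inner_le_norm _ _
  have h := discrim_le_zero (a := ∫ s, ‖f s‖ ^ 2 ∂P) (b := 2 * ∫ s, inner ℝ (f s) (g s) ∂P)
    (c := ∫ s, ‖g s‖ ^ 2 ∂P) fun t => by
      have e : ∫ s, ‖t • f s + g s‖ ^ 2 ∂P = (∫ s, ‖f s‖ ^ 2 ∂P) * (t * t) +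
          (2 * ∫ s, inner ℝ (f s) (g s) ∂P) * t + ∫ s, ‖g s‖ ^ 2 ∂P := by
        have e1 : ∀ s, ‖t • f s + g s‖ ^ 2 =
            t * t * ‖f s‖ ^ 2 + 2 * t * inner ℝ (f s) (g s) + ‖g s‖ ^ 2 := by
          intro s
          rw [norm_add_sq_real, norm_smul, real_inner_smul_left, mul_pow, Real.norm_eq_abs, sq_abs]
          ring
        simp only [e1]
        rw [integral_add_add (hf.norm.integrable_sq.const_mul _) (hfg.const_mul _)
          hg.norm.integrable_sq, integral_const_mul, integral_const_mul]
        ring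
      rw [← e]
      exact integral_nonneg fun s => sq_nonneg _
  rw [discrim] at h
  nlinarith

/-- Adding a term that is negligible in mean square does not change the asymptotics of the
second moment. -/
theorem tendsto_sq_norm_add {f g : ℕ → S → E} (hf : ∀ k, MemLp (f k) 2 P)
    (hg : ∀ k, MemLp (g k) 2 P) {l : ℝ}
    (hfl : Tendsto (fun k : ℕ => (k : ℝ) * ∫ s, ‖f k s‖ ^ 2 ∂P) atTop (𝓝 l))
    (hgl : Tendsto (fun k : ℕ => (k : ℝ) * ∫ s, ‖g k s‖ ^ 2 ∂P) atTop (𝓝 0)) :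
    Tendsto (fun k : ℕ => (k : ℝ) * ∫ s, ‖f k s + g k s‖ ^ 2 ∂P) atTop (𝓝 l) := by
  have hcross : Tendsto (fun k : ℕ => (k : ℝ) * ∫ s, inner ℝ (f k s) (g k s) ∂P) atTop (𝓝 0) := by
    have h1 := hfl.mul hgl
    rw [mul_zero] at h1
    have h2 : Tendsto (fun k : ℕ => ((k : ℝ) * ∫ s, inner ℝ (f k s) (g k s) ∂P) ^ 2) atTop
        (𝓝 0) := by
      refine squeeze_zero (fun k => sq_nonneg _) (fun k => ?_) h1
      have := mul_le_mul_of_nonneg_left (sq_integral_inner_le (hf k) (hg k)) (sq_nonneg (k : ℝ))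
      linarith
    have h3 := h2.sqrt
    simp only [Real.sqrt_sq_eq_abs, Real.sqrt_zero] at h3
    exact (tendsto_zero_iff_abs_tendsto_zero _).2 h3
  have h4 := (hfl.add (hcross.const_mul 2)).add hgl
  rw [mul_zero, add_zero, add_zero] at h4
  refine h4.congr fun k => ?_
  have hfg : Integrable (fun s => inner ℝ (f k s) (g k s)) P := by
    refine ((hf k).norm.integrable_mul (hg k).norm).mono'
      ((hf k).aestronglyMeasurable.inner (hg k).aestronglyMeasurable) (ae_of_all _ fun s => ?_)
    exact abs_real_inner_le_norm _ _
  simp only [norm_add_sq_real]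
  rw [integral_add_add (hf k).norm.integrable_sq (hfg.const_mul 2) (hg k).norm.integrable_sq,
    integral_const_mul]
  ring

end Perturbation

/-! ### The error recursion of projected SGD -/

section Coupling

variable {d : ℕ} {ν : Measure (Vec d × ℝ)} [IsProbabilityMeasure ν] {wopt : Vec d} {μ σ : ℝ}
  {S : Type*} [MeasurableSpace S] {P : Measure S} [IsProbabilityMeasure P]
  {Ω : Set (Vec d)} {w₀ : S → Vec d} {z : ℕ → S → Vec d × ℝ} {γ R r : ℝ}

/-- The negative normalized stochastic gradient at `wopt + u`. -/
noncomputable def descentDir (wopt : Vec d) (μ : ℝ) (u : Vec d) (ζ : Vec d × ℝ) : Vec d :=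
  -(1 / μ) • ((inner ℝ ζ.1 u + residual wopt ζ) • ζ.1)

/-- The part of the gradient noise that does not depend on the current error. -/
noncomputable def noise (wopt : Vec d) (μ : ℝ) (ζ : Vec d × ℝ) : Vec d :=
  -(1 / μ) • (residual wopt ζ • ζ.1)

/-- The part of the gradient noise that is linear in the current error. -/
noncomputable def mulNoise (μ : ℝ) (u : Vec d) (ζ : Vec d × ℝ) : Vec d :=
  u - (1 / μ) • ((inner ℝ ζ.1 u : ℝ) • ζ.1)

/-- A square integrable bound for all directions at errors of norm at most `R`. -/
noncomputable def dirBound (wopt : Vec d) (μ R : ℝ) (ζ : Vec d × ℝ) : ℝ :=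
  R + 1 / μ * (R * ‖ζ.1‖ ^ 2 + ‖residual wopt ζ • ζ.1‖)

/-- The error of projected SGD. -/
noncomputable def sgdError (Ω : Set (Vec d)) (μ γ : ℝ) (wopt : Vec d) (w₀ : S → Vec d)
    (z : ℕ → S → Vec d × ℝ) (k : ℕ) (s : S) : Vec d :=
  iter Ω μ γ (w₀ s) (fun i => z i s) k - wopt

/-- Splits the direction into the mean drift `-u`, the additive noise kept in the linearization, and
the centred multiplicative noise, which is small when `u` is. -/
theorem descentDir_eq (u : Vec d) (ζ : Vec d × ℝ) :
    descentDir wopt μ u ζ = noise wopt μ ζ + mulNoise μ u ζ - u := by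
  unfold descentDir noise mulNoise
  module

theorem measurable_noise : Measurable (noise wopt μ) :=
  ((measurable_residual wopt).smul measurable_fst).const_smul (-(1 / μ))

theorem measurable_descentDir : Measurable (Function.uncurry (descentDir wopt μ)) := by
  unfold Function.uncurry descentDir residual
  fun_prop

theorem measurable_mulNoise : Measurable (Function.uncurry (mulNoise (d := d) μ)) := by
  unfold Function.uncurry mulNoise
  fun_prop

theorem measurable_dirBound : Measurable (dirBound wopt μ R) := by
  unfold dirBound residual
  fun_prop

theorem dirBound_nonneg (hμ : 0 < μ) (hR : 0 ≤ R) (ζ : Vec d × ℝ) : 0 ≤ dirBound wopt μ R ζ := by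
  unfold dirBound; positivity

theorem norm_inner_smul_le {u : Vec d} (hu : ‖u‖ ≤ R) (x : Vec d) :
    ‖(inner ℝ x u : ℝ) • x‖ ≤ R * ‖x‖ ^ 2 := by
  rw [norm_smul]
  have h1 := norm_inner_le_norm (𝕜 := ℝ) x u
  have h2 : ‖x‖ * ‖u‖ ≤ ‖x‖ * R := mul_le_mul_of_nonneg_left hu (norm_nonneg _)
  have h3 := mul_le_mul_of_nonneg_right (h1.trans h2) (norm_nonneg x)
  linarith

theorem norm_descentDir_le (hμ : 0 < μ) {u : Vec d} (hu : ‖u‖ ≤ R) (ζ : Vec d × ℝ) :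
    ‖descentDir wopt μ u ζ‖ ≤ dirBound wopt μ R ζ := by
  have hR : 0 ≤ R := (norm_nonneg u).trans hu
  unfold descentDir dirBound
  rw [norm_smul, norm_neg, Real.norm_eq_abs, abs_of_pos (by positivity), add_smul]
  have h1 := norm_add_le ((inner ℝ ζ.1 u : ℝ) • ζ.1) (residual wopt ζ • ζ.1)
  have h2 := norm_inner_smul_le hu ζ.1
  have : 1 / μ * ‖(inner ℝ ζ.1 u : ℝ) • ζ.1 + residual wopt ζ • ζ.1‖ ≤
      1 / μ * (R * ‖ζ.1‖ ^ 2 + ‖residual wopt ζ • ζ.1‖) :=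
    mul_le_mul_of_nonneg_left (by linarith) (by positivity)
  linarith

theorem norm_mulNoise_le (hμ : 0 < μ) {u : Vec d} (hu : ‖u‖ ≤ R) (ζ : Vec d × ℝ) :
    ‖mulNoise μ u ζ‖ ≤ R * (1 + 1 / μ * ‖ζ.1‖ ^ 2) := by
  unfold mulNoise
  have h1 := norm_sub_le u ((1 / μ) • ((inner ℝ ζ.1 u : ℝ) • ζ.1))
  have h2 := norm_inner_smul_le hu ζ.1
  rw [norm_smul (1 / μ), Real.norm_eq_abs, abs_of_pos (by positivity : 0 < 1 / μ)] at h1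
  have h3 : 1 / μ * ‖(inner ℝ ζ.1 u : ℝ) • ζ.1‖ ≤ 1 / μ * (R * ‖ζ.1‖ ^ 2) :=
    mul_le_mul_of_nonneg_left h2 (by positivity)
  linarith

theorem norm_mulNoise_le_dirBound (hμ : 0 < μ) {u : Vec d} (hu : ‖u‖ ≤ R) (ζ : Vec d × ℝ) :
    ‖mulNoise μ u ζ‖ ≤ dirBound wopt μ R ζ := by
  refine (norm_mulNoise_le hμ hu ζ).trans ?_
  unfold dirBound
  have : 0 ≤ 1 / μ * ‖residual wopt ζ • ζ.1‖ := by positivity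
  linarith

namespace LinearModel

theorem memLp_dirBound (M : LinearModel ν wopt μ σ) : MemLp (dirBound wopt μ R) 2 ν := by
  have h := (memLp_const (μ := ν) R).add ((((memLp_two_norm_sq M.memLp_x).const_mul R).add
    M.memLp_noise.norm).const_mul (1 / μ))
  exact h

theorem memLp_noise' (M : LinearModel ν wopt μ σ) : MemLp (noise wopt μ) 2 ν :=
  M.memLp_noise.const_smul (-(1 / μ))

theorem integral_noise' (M : LinearModel ν wopt μ σ) : ∫ ζ, noise wopt μ ζ ∂ν = 0 := by
  unfold noise
  rw [integral_smul, M.integral_noise, smul_zero]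

theorem integral_noise_sq (M : LinearModel ν wopt μ σ) :
    ∫ ζ, ‖noise wopt μ ζ‖ ^ 2 ∂ν = d * σ ^ 2 / μ := by
  have hμ := M.mu_pos
  have e : ∀ ζ, ‖noise wopt μ ζ‖ ^ 2 = (1 / μ) ^ 2 * ‖residual wopt ζ • ζ.1‖ ^ 2 := by
    intro ζ
    rw [noise, norm_smul, mul_pow, norm_neg, Real.norm_eq_abs, sq_abs]
  simp only [e]
  rw [integral_const_mul, M.noise_sq]
  field_simp

theorem memLp_mulNoise (M : LinearModel ν wopt μ σ) (u : Vec d) : MemLp (mulNoise μ u) 2 ν :=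
  (memLp_const u).sub ((M.memLp_inner_smul u).const_smul (1 / μ))

theorem integral_mulNoise (M : LinearModel ν wopt μ σ) (u : Vec d) :
    ∫ ζ, mulNoise μ u ζ ∂ν = 0 := by
  unfold mulNoise
  have hi : Integrable (fun ζ : Vec d × ℝ => (1 / μ) • ((inner ℝ ζ.1 u : ℝ) • ζ.1)) ν :=
    ((M.memLp_inner_smul u).integrable one_le_two).smul (1 / μ)
  rw [integral_sub (integrable_const _) hi, integral_smul, M.integral_inner_smul, smul_smul, one_div_mul_cancel M.mu_pos.ne']
  simp

theorem integral_descentDir (M : LinearModel ν wopt μ σ) (u : Vec d) :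
    ∫ ζ, descentDir wopt μ u ζ ∂ν = -u := by
  have h1 := M.memLp_noise'.integrable one_le_two
  have h2 := (M.memLp_mulNoise u).integrable one_le_two
  simp only [descentDir_eq]
  have h3 : Integrable (fun ζ => noise wopt μ ζ + mulNoise μ u ζ) ν := h1.add h2
  rw [integral_sub h3 (integrable_const _), integral_add h1 h2, M.integral_noise',
    M.integral_mulNoise]
  simp

end LinearModel

/-- The factor `2` of the gradient cancels that of the step size `α_k / (2μ)`; the remaining `1 / μ`
normalizes the mean drift to `-u`. -/
theorem sgdError_succ (hc : IsCompact Ω) (hconv : Convex ℝ Ω) (hw : ∀ s, w₀ s ∈ Ω) (k : ℕ)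
    (s : S) :
    sgdError Ω μ γ wopt w₀ z (k + 1) s =
      projOn Ω (wopt + (sgdError Ω μ γ wopt w₀ z k s +
        alpha γ k • descentDir wopt μ (sgdError Ω μ γ wopt w₀ z k s) (z k s))) - wopt := by
  unfold sgdError
  rw [iter_succ hc hconv (hw s)]
  congr 2
  unfold descentDir stochGrad stepSize
  rw [residual_eq _ wopt]
  module

theorem norm_sgdError_le (hc : IsCompact Ω) (hconv : Convex ℝ Ω) (hw : ∀ s, w₀ s ∈ Ω)
    (hR : ∀ y ∈ Ω, ‖y - wopt‖ ≤ R) (k : ℕ) (s : S) : ‖sgdError Ω μ γ wopt w₀ z k s‖ ≤ R :=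
  hR _ (iter_mem hc hconv (hw s) k)

theorem measurable_sgdError (hc : IsCompact Ω) (hconv : Convex ℝ Ω) (hw : ∀ s, w₀ s ∈ Ω)
    (hopt : wopt ∈ Ω) (k : ℕ) :
    Measurable[past w₀ z k] (sgdError Ω μ γ wopt w₀ z k) :=
  (measurable_iter hc hconv hw ⟨wopt, hopt⟩ z k).sub_const wopt

theorem memLp_sgdError (H : Stream P ν w₀ z) (hc : IsCompact Ω) (hconv : Convex ℝ Ω)
    (hw : ∀ s, w₀ s ∈ Ω) (hopt : wopt ∈ Ω) (hR : ∀ y ∈ Ω, ‖y - wopt‖ ≤ R) (k : ℕ) :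
    MemLp (sgdError Ω μ γ wopt w₀ z k) 2 P :=
  MemLp.of_bound (H.measurable (measurable_sgdError hc hconv hw hopt k)).aestronglyMeasurable R
    (ae_of_all _ fun s => norm_sgdError_le hc hconv hw hR k s)

theorem noisyContraction_sgdError (M : LinearModel ν wopt μ σ) (H : Stream P ν w₀ z)
    (hc : IsCompact Ω) (hconv : Convex ℝ Ω) (hw : ∀ s, w₀ s ∈ Ω) (hopt : wopt ∈ Ω)
    (hR : ∀ y ∈ Ω, ‖y - wopt‖ ≤ R) :
    NoisyContraction P ν γ (sgdError Ω μ γ wopt w₀ z) z (descentDir wopt μ)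
      (dirBound wopt μ R) where
  meas_sample := H.meas
  law := H.law
  meas k := H.measurable (measurable_sgdError hc hconv hw hopt k)
  memLp := memLp_sgdError H hc hconv hw hopt hR
  indep k := H.indep (measurable_sgdError hc hconv hw hopt k)
  meas_dir := measurable_descentDir
  meas_bound := measurable_dirBound
  memLp_bound := M.memLp_dirBound
  bound_nonneg := dirBound_nonneg M.mu_pos ((norm_nonneg _).trans (hR wopt hopt))
  bound k s ζ := (norm_descentDir_le M.mu_pos (norm_sgdError_le hc hconv hw hR k s) ζ).trans
    (le_add_of_nonneg_right (norm_nonneg _))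
  mean := M.integral_descentDir
  step k s := by
    rw [sgdError_succ hc hconv hw]
    exact (norm_projOn_sub_le hc hconv _ hopt).trans (by simp)

/-- The displacement caused by the projection. -/
theorem projection_displacement (hμ : 0 < μ) (hγ : 0 < γ) (hc : IsCompact Ω) (hconv : Convex ℝ Ω)
    (hw : ∀ s, w₀ s ∈ Ω) (hR : ∀ y ∈ Ω, ‖y - wopt‖ ≤ R) (hr : 0 < r)
    (hball : Metric.closedBall wopt r ⊆ Ω) (k : ℕ) (s : S) :
    ∃ p : Vec d, sgdError Ω μ γ wopt w₀ z (k + 1) s = sgdError Ω μ γ wopt w₀ z k s +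
        alpha γ k • descentDir wopt μ (sgdError Ω μ γ wopt w₀ z k s) (z k s) + p ∧
      ‖p‖ ≤ alpha γ k * dirBound wopt μ R (z k s) ∧
      (‖p‖ = 0 ∨ 1 ≤ 16 / r ^ 2 * excess (r / 4) (sgdError Ω μ γ wopt w₀ z k s) ^ 2 ∨
        r / 2 < alpha γ k * dirBound wopt μ R (z k s)) := by
  set e := sgdError Ω μ γ wopt w₀ z k s with he
  set η := descentDir wopt μ e (z k s) with hη
  have hα := alpha_pos hγ k
  have hηle : ‖η‖ ≤ dirBound wopt μ R (z k s) :=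
    norm_descentDir_le hμ (norm_sgdError_le hc hconv hw hR k s) _
  have hαη : ‖alpha γ k • η‖ ≤ alpha γ k * dirBound wopt μ R (z k s) := by
    rw [norm_smul, Real.norm_eq_abs, abs_of_pos hα]
    exact mul_le_mul_of_nonneg_left hηle hα.le
  refine ⟨projOn Ω (wopt + (e + alpha γ k • η)) - (wopt + (e + alpha γ k • η)), ?_, ?_, ?_⟩
  · rw [sgdError_succ hc hconv hw]
    abel
  · refine (norm_projOn_sub_self_le hc hconv _
      (iter_mem (μ := μ) (γ := γ) (z := fun i => z i s) hc hconv (hw s) k)).trans ?_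
    have : wopt + (e + alpha γ k • η) - iter Ω μ γ (w₀ s) (fun i => z i s) k = alpha γ k • η := by
      rw [he]; unfold sgdError; abel
    rw [this]
    exact hαη
  -- If neither `‖e‖` nor the bound on the step exceeds `r / 2`, the unprojected point is in the
  -- ball inside `Ω` and does not move. If `‖e‖ > r / 2`, its excess over radius `r / 4` is at least
  -- `r / 4`.
  · by_cases h1 : r / 2 < ‖e‖
    · right; left
      have h2 : r / 4 ≤ excess (r / 4) e := le_max_of_le_left (by linarith)
      rw [div_mul_eq_mul_div, one_le_div (by positivity)]
      nlinarith
    · by_cases h3 : r / 2 < alpha γ k * dirBound wopt μ R (z k s)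
      · exact Or.inr (Or.inr h3)
      · left
        push Not at h1 h3
        have hmem : wopt + (e + alpha γ k • η) ∈ Ω := by
          apply hball
          rw [Metric.mem_closedBall, dist_eq_norm, add_sub_cancel_left]
          linarith [norm_add_le e (alpha γ k • η)]
        rw [projOn_self hc hconv hmem, sub_self, norm_zero]

/-- Bounds the increase of `‖V‖²` when `V`, of norm at most `D + α h`, is displaced by a vector of
norm `p`. For a far error (`X ≥ 1`), Young's inequality spends `α D²` of the contraction. For a long
step, `α h` is traded for `(2 / r) (α h)²`, so all terms are of second order in `α`. -/
theorem displacement_cost {α D h p X I : ℝ} (hα : 0 < α) (hα1 : α ≤ 1) (hD : 0 ≤ D)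
    (hh : 0 ≤ h) (hr : 0 < r) (hp0 : 0 ≤ p) (hp : p ≤ α * h) (hX : 0 ≤ X) (hI : 0 ≤ I)
    (hcase : p = 0 ∨ 1 ≤ X ∨ (r / 2 < α * h ∧ I = h ^ 2)) :
    2 * D * p + 2 * (α * h) * p + p ^ 2 ≤
      α * D ^ 2 + 4 * α * (X * h ^ 2) + α ^ 2 * (2 / r + 3) * I + α ^ 2 * (2 / r) * (D ^ 2 * I) := by
  have hgen : 2 * D * p + 2 * (α * h) * p + p ^ 2 ≤ 2 * D * (α * h) + 3 * (α * h) ^ 2 := by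
    have h1 : D * p ≤ D * (α * h) := mul_le_mul_of_nonneg_left hp hD
    have h2 : (α * h) * p ≤ (α * h) * (α * h) := mul_le_mul_of_nonneg_left hp (by positivity)
    have h3 : p ^ 2 ≤ (α * h) ^ 2 := by gcongr
    nlinarith
  have n1 : 0 ≤ α ^ 2 * (2 / r + 3) * I := by positivity
  have n2 : 0 ≤ α ^ 2 * (2 / r) * (D ^ 2 * I) := by positivity
  have n3 : 0 ≤ 4 * α * (X * h ^ 2) := by positivity
  have n4 : 0 ≤ α * D ^ 2 := by positivity
  rcases hcase with h0 | hX1 | ⟨hbig, hIh⟩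
  · rw [h0]
    have : 2 * D * 0 + 2 * (α * h) * 0 + (0 : ℝ) ^ 2 = 0 := by ring
    linarith
  · have h1 : α * h ^ 2 ≤ α * (X * h ^ 2) := by
      apply mul_le_mul_of_nonneg_left _ hα.le
      nlinarith [sq_nonneg h]
    have h2 : (α * h) ^ 2 ≤ α * h ^ 2 := by
      rw [mul_pow]
      apply mul_le_mul_of_nonneg_right _ (sq_nonneg h)
      nlinarith
    have h3 : 2 * D * (α * h) ≤ α * D ^ 2 + α * h ^ 2 := by
      nlinarith [mul_nonneg hα.le (sq_nonneg (D - h))]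
    linarith
  · have h1 : α * h ≤ 2 / r * (α * h) ^ 2 := by
      have : 1 ≤ 2 / r * (α * h) := by
        rw [div_mul_eq_mul_div, one_le_div hr]; linarith
      have := mul_le_mul_of_nonneg_right this (by positivity : 0 ≤ α * h)
      nlinarith
    have h2 : 2 * D * (α * h) ≤ 2 / r * (α * h) ^ 2 * (1 + D ^ 2) := by
      have h4 : 2 * D ≤ 1 + D ^ 2 := by nlinarith [sq_nonneg (D - 1)]
      calc 2 * D * (α * h) ≤ (1 + D ^ 2) * (α * h) :=
            mul_le_mul_of_nonneg_right h4 (by positivity)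
        _ ≤ (1 + D ^ 2) * (2 / r * (α * h) ^ 2) := mul_le_mul_of_nonneg_left h1 (by positivity)
        _ = _ := by ring
    rw [hIh]
    have e : α ^ 2 * (2 / r + 3) * h ^ 2 + α ^ 2 * (2 / r) * (D ^ 2 * h ^ 2) =
        2 / r * (α * h) ^ 2 * (1 + D ^ 2) + 3 * (α * h) ^ 2 := by ring
    linarith

end Coupling

/-! ### Comparison of projected SGD with its linearization -/

section Gap

variable {d : ℕ} {ν : Measure (Vec d × ℝ)} [IsProbabilityMeasure ν] {wopt : Vec d} {μ σ : ℝ}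
  {S : Type*} [MeasurableSpace S] {P : Measure S} [IsProbabilityMeasure P]
  {Ω : Set (Vec d)} {w₀ : S → Vec d} {z : ℕ → S → Vec d × ℝ} {γ R r : ℝ}

/-- Difference between the error of projected SGD and its linearization. -/
noncomputable def gap (Ω : Set (Vec d)) (μ γ : ℝ) (wopt : Vec d) (w₀ : S → Vec d)
    (z : ℕ → S → Vec d × ℝ) (k : ℕ) (s : S) : Vec d :=
  sgdError Ω μ γ wopt w₀ z k s - linIter γ (fun i => noise wopt μ (z i s)) k

theorem measurable_gap (hc : IsCompact Ω) (hconv : Convex ℝ Ω) (hw : ∀ s, w₀ s ∈ Ω)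
    (hopt : wopt ∈ Ω) (k : ℕ) : Measurable[past w₀ z k] (gap Ω μ γ wopt w₀ z k) :=
  (measurable_sgdError hc hconv hw hopt k).sub (measurable_linIter measurable_noise γ w₀ z k)

theorem memLp_gap (M : LinearModel ν wopt μ σ) (H : Stream P ν w₀ z)
    (hc : IsCompact Ω) (hconv : Convex ℝ Ω) (hw : ∀ s, w₀ s ∈ Ω) (hopt : wopt ∈ Ω)
    (hR : ∀ y ∈ Ω, ‖y - wopt‖ ≤ R) (k : ℕ) : MemLp (gap Ω μ γ wopt w₀ z k) 2 P :=
  (memLp_sgdError H hc hconv hw hopt hR k).sub (H.memLp_linIter M.memLp_noise' γ k)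

theorem integrable_law {Z : S → Vec d × ℝ} (hZ : Measurable Z) (hlaw : P.map Z = ν)
    {f : Vec d × ℝ → ℝ} (hf : Integrable f ν) : Integrable (fun s => f (Z s)) P :=
  memLp_one_iff_integrable.1 (memLp_comp_law hZ hlaw (memLp_one_iff_integrable.2 hf))

/-- The gap and the error are both determined by the past, and the multiplicative noise at a frozen
error is centred. -/
theorem integral_gap_inner_mulNoise (M : LinearModel ν wopt μ σ) (H : Stream P ν w₀ z)
    (hc : IsCompact Ω) (hconv : Convex ℝ Ω) (hw : ∀ s, w₀ s ∈ Ω) (hopt : wopt ∈ Ω)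
    (hR : ∀ y ∈ Ω, ‖y - wopt‖ ≤ R) (k : ℕ) :
    Integrable (fun s => inner ℝ (gap Ω μ γ wopt w₀ z k s)
      (mulNoise μ (sgdError Ω μ γ wopt w₀ z k s) (z k s))) P ∧
    ∫ s, inner ℝ (gap Ω μ γ wopt w₀ z k s)
      (mulNoise μ (sgdError Ω μ γ wopt w₀ z k s) (z k s)) ∂P = 0 := by
  have hgm : Measurable[past w₀ z k] (gap Ω μ γ wopt w₀ z k) := measurable_gap hc hconv hw hopt k
  have hem : Measurable[past w₀ z k] (sgdError Ω μ γ wopt w₀ z k) :=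
    measurable_sgdError hc hconv hw hopt k
  have hpair : Measurable[past w₀ z k]
      (fun s => (gap Ω μ γ wopt w₀ z k s, sgdError Ω μ γ wopt w₀ z k s)) := hgm.prodMk hem
  have hmul : MemLp (fun s => mulNoise μ (sgdError Ω μ γ wopt w₀ z k s) (z k s)) 2 P := by
    refine (memLp_comp_law (H.meas k) (H.law k) (M.memLp_dirBound (R := R))).mono
      (measurable_mulNoise.comp ((H.measurable hem).prodMk (H.meas k))).aestronglyMeasurable
      (ae_of_all _ fun s => ?_)
    exact (norm_mulNoise_le_dirBound M.mu_pos (norm_sgdError_le hc hconv hw hR k s) _).trans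
      (le_abs_self _)
  have hint := integrable_inner_of_memLp (memLp_gap M H hc hconv hw hopt hR (γ := γ) k) hmul
  refine ⟨hint, ?_⟩
  rw [integral_inner_indep (H.measurable hpair) (H.meas k) (H.law k) (H.indep hpair)
    (g := Prod.fst) (F := fun q ζ => mulNoise μ q.2 ζ) measurable_fst ?_ ?_ hint]
  · simp [M.integral_mulNoise]
  · exact measurable_mulNoise.comp
      ((measurable_snd.comp measurable_fst).prodMk measurable_snd)
  · exact fun s => (M.memLp_mulNoise _).integrable one_le_two

/-- The additive noise cancels, so the new gap is `(1 - α) D + α m + p` with `m` the multiplicative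
noise and `p` the projection displacement. Every forcing term is written as `α_k²` times a quantity
to be shown to vanish. -/
theorem integral_gap_sq_succ_le (M : LinearModel ν wopt μ σ) (H : Stream P ν w₀ z) (hγ : 0 < γ)
    (hc : IsCompact Ω) (hconv : Convex ℝ Ω) (hw : ∀ s, w₀ s ∈ Ω)
    (hR : ∀ y ∈ Ω, ‖y - wopt‖ ≤ R) (hr : 0 < r) (hball : Metric.closedBall wopt r ⊆ Ω) (k : ℕ) :
    ∫ s, ‖gap Ω μ γ wopt w₀ z (k + 1) s‖ ^ 2 ∂P ≤
      ((1 - alpha γ k) ^ 2 + alpha γ k + alpha γ k ^ 2 * (2 / r) *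
        ∫ ζ, {ζ | r / 2 < alpha γ k * dirBound wopt μ R ζ}.indicator
          (fun ζ => dirBound wopt μ R ζ ^ 2) ζ ∂ν) *
        ∫ s, ‖gap Ω μ γ wopt w₀ z k s‖ ^ 2 ∂P +
      alpha γ k ^ 2 * ((∫ s, ‖sgdError Ω μ γ wopt w₀ z k s‖ ^ 2 ∂P) *
          (∫ ζ, (1 + 1 / μ * ‖ζ.1‖ ^ 2) ^ 2 ∂ν) +
        4 * (16 / r ^ 2) / γ * (∫ ζ, dirBound wopt μ R ζ ^ 2 ∂ν) *
          ((γ + k) * ∫ s, excess (r / 4) (sgdError Ω μ γ wopt w₀ z k s) ^ 2 ∂P) +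
        (2 / r + 3) * ∫ ζ, {ζ | r / 2 < alpha γ k * dirBound wopt μ R ζ}.indicator
          (fun ζ => dirBound wopt μ R ζ ^ 2) ζ ∂ν) := by
  have hopt : wopt ∈ Ω := hball (Metric.mem_closedBall_self hr.le)
  have hR0 : 0 ≤ R := (norm_nonneg _).trans (hR wopt hopt)
  have N := noisyContraction_sgdError (γ := γ) M H hc hconv hw hopt hR
  set α := alpha γ k with hαdef
  have hα : 0 < α := alpha_pos hγ k
  have hα1 : α ≤ 1 := alpha_le_one hγ k
  set h := dirBound wopt μ R with hh
  set I : Vec d × ℝ → ℝ := fun ζ => {ζ | r / 2 < α * h ζ}.indicator (fun ζ => h ζ ^ 2) ζ with hI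
  have hhm : Measurable h := measurable_dirBound
  have hset : MeasurableSet {ζ | r / 2 < α * h ζ} :=
    measurableSet_lt measurable_const (hhm.const_mul _)
  have hIm : Measurable I := (hhm.pow_const 2).indicator hset
  have hI0 : ∀ ζ, 0 ≤ I ζ := fun ζ => Set.indicator_nonneg (fun _ _ => sq_nonneg _) _
  have hh2 : Integrable (fun ζ => h ζ ^ 2) ν := N.memLp_bound.integrable_sq
  have hIi : Integrable I ν := hh2.indicator hset
  set e := sgdError Ω μ γ wopt w₀ z k with he
  set D := gap Ω μ γ wopt w₀ z k with hD
  have hDm : Measurable[past w₀ z k] D := measurable_gap hc hconv hw hopt k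
  have hem : Measurable[past w₀ z k] e := measurable_sgdError hc hconv hw hopt k
  have hD2 : MemLp D 2 P := memLp_gap M H hc hconv hw hopt hR k
  have he2 : MemLp e 2 P := N.memLp k
  have hm2 : Integrable (fun ζ : Vec d × ℝ => (1 + 1 / μ * ‖ζ.1‖ ^ 2) ^ 2) ν :=
    ((memLp_const (1 : ℝ)).add ((memLp_two_norm_sq M.memLp_x).const_mul (1 / μ))).integrable_sq
  have hmm : Measurable (fun ζ : Vec d × ℝ => (1 + 1 / μ * ‖ζ.1‖ ^ 2) ^ 2) := by fun_prop
  have hXm : Measurable (fun u : Vec d => excess (r / 4) u ^ 2) :=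
    (measurable_excess _).pow_const 2
  have hsq : Measurable (fun u : Vec d => ‖u‖ ^ 2) := by fun_prop
  have hX2 : Integrable (fun s => excess (r / 4) (e s) ^ 2) P :=
    (N.memLp_excess (by positivity) k).integrable_sq
  obtain ⟨i2, e2⟩ := integral_gap_inner_mulNoise (γ := γ) M H hc hconv hw hopt hR k
  have i1 := hD2.norm.integrable_sq
  have i3 := integrable_mul_indep (H.meas k) (H.law k) (H.indep hem) hsq hmm
    he2.norm.integrable_sq hm2
  have e3 := integral_mul_indep (H.measurable hem) (H.meas k) (H.law k) (H.indep hem) hsq hmm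
  have i4 := integrable_mul_indep (H.meas k) (H.law k) (H.indep hem) hXm (hhm.pow_const 2) hX2 hh2
  have e4 := integral_mul_indep (H.measurable hem) (H.meas k) (H.law k) (H.indep hem) hXm
    (hhm.pow_const 2)
  have i5 := integrable_law (H.meas k) (H.law k) hIi
  have e5 := integral_comp_law (H.meas k) (H.law k) hIm.aestronglyMeasurable
  have i6 := integrable_mul_indep (H.meas k) (H.law k) (H.indep hDm) hsq hIm i1 hIi
  have e6 := integral_mul_indep (H.measurable hDm) (H.meas k) (H.law k) (H.indep hDm) hsq hIm
  have j1 : Integrable (fun s => ((1 - α) ^ 2 + α) * ‖D s‖ ^ 2 +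
      2 * (1 - α) * α * inner ℝ (D s) (mulNoise μ (e s) (z k s)) +
      α ^ 2 * (‖e s‖ ^ 2 * (1 + 1 / μ * ‖(z k s).1‖ ^ 2) ^ 2)) P :=
    ((i1.const_mul _).add (i2.const_mul _)).add (i3.const_mul _)
  have j2 : Integrable (fun s => 4 * α * (16 / r ^ 2) * (excess (r / 4) (e s) ^ 2 * h (z k s) ^ 2) +
      α ^ 2 * (2 / r + 3) * I (z k s) + α ^ 2 * (2 / r) * (‖D s‖ ^ 2 * I (z k s))) P :=
    ((i4.const_mul _).add (i5.const_mul _)).add (i6.const_mul _)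
  have hpt : ∀ s, ‖gap Ω μ γ wopt w₀ z (k + 1) s‖ ^ 2 ≤
      (((1 - α) ^ 2 + α) * ‖D s‖ ^ 2 +
      2 * (1 - α) * α * inner ℝ (D s) (mulNoise μ (e s) (z k s)) +
      α ^ 2 * (‖e s‖ ^ 2 * (1 + 1 / μ * ‖(z k s).1‖ ^ 2) ^ 2)) +
      (4 * α * (16 / r ^ 2) * (excess (r / 4) (e s) ^ 2 * h (z k s) ^ 2) +
      α ^ 2 * (2 / r + 3) * I (z k s) + α ^ 2 * (2 / r) * (‖D s‖ ^ 2 * I (z k s))) := by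
    intro s
    obtain ⟨p, hp1, hp2, hp3⟩ := projection_displacement (γ := γ) (z := z) M.mu_pos hγ hc hconv hw
      hR hr hball k s
    set m := mulNoise μ (e s) (z k s) with hm
    have hgap : gap Ω μ γ wopt w₀ z (k + 1) s = ((1 - α) • D s + α • m) + p := by
      rw [hm, hD, gap, gap, hp1, linIter, descentDir_eq]
      module
    have hmle : ‖m‖ ≤ h (z k s) :=
      norm_mulNoise_le_dirBound M.mu_pos (norm_sgdError_le hc hconv hw hR k s) _
    have hmle2 : ‖m‖ ^ 2 ≤ ‖e s‖ ^ 2 * (1 + 1 / μ * ‖(z k s).1‖ ^ 2) ^ 2 := by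
      rw [← mul_pow]
      gcongr
      exact norm_mulNoise_le M.mu_pos le_rfl _
    have hVn : ‖(1 - α) • D s + α • m‖ ≤ ‖D s‖ + α * h (z k s) := by
      refine (norm_add_le _ _).trans (add_le_add ?_ ?_)
      · rw [norm_smul, Real.norm_eq_abs, abs_of_nonneg (by linarith)]
        exact mul_le_of_le_one_left (norm_nonneg _) (by linarith)
      · rw [norm_smul, Real.norm_eq_abs, abs_of_pos hα]
        exact mul_le_mul_of_nonneg_left hmle hα.le
    have hcost := displacement_cost hα hα1 (norm_nonneg (D s)) (N.bound_nonneg (z k s)) hr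
      (norm_nonneg p) hp2 (X := 16 / r ^ 2 * excess (r / 4) (e s) ^ 2) (by positivity)
      (hI0 (z k s)) (by
        rcases hp3 with h1 | h1 | h1
        · exact Or.inl h1
        · exact Or.inr (Or.inl h1)
        · exact Or.inr (Or.inr ⟨h1, Set.indicator_of_mem (s := {ζ | r / 2 < α * h ζ}) h1 _⟩))
    have hVsq : ‖(1 - α) • D s + α • m‖ ^ 2 = (1 - α) ^ 2 * ‖D s‖ ^ 2 +
        2 * (1 - α) * α * inner ℝ (D s) m + α ^ 2 * ‖m‖ ^ 2 := by
      rw [norm_add_sq_real, norm_smul, norm_smul, real_inner_smul_left, real_inner_smul_right,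
        mul_pow, mul_pow, Real.norm_eq_abs, Real.norm_eq_abs, sq_abs, sq_abs]
      ring
    have hVp : inner ℝ ((1 - α) • D s + α • m) p ≤ (‖D s‖ + α * h (z k s)) * ‖p‖ :=
      (real_inner_le_norm _ _).trans (mul_le_mul_of_nonneg_right hVn (norm_nonneg _))
    have hm3 := mul_le_mul_of_nonneg_left hmle2 (sq_nonneg α)
    rw [hgap, norm_add_sq_real, hVsq]
    linarith
  have hmono := integral_mono
    (memLp_gap (γ := γ) M H hc hconv hw hopt hR (k + 1)).norm.integrable_sq (j1.add j2) hpt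
  refine hmono.trans (le_of_eq ?_)
  simp only [Pi.add_apply]
  rw [integral_add j1 j2, integral_add_add (i1.const_mul _) (i2.const_mul _) (i3.const_mul _),
    integral_add_add (i4.const_mul _) (i5.const_mul _) (i6.const_mul _)]
  simp only [integral_const_mul]
  rw [e2, e3, e4, e5, e6]
  have hαk : α * (γ + k) = γ := by
    rw [hαdef, alpha]
    have : γ + (k : ℝ) ≠ 0 := by positivity
    field_simp
  -- This term carries only one power of `α`. The second is produced from `α * (γ + k) = γ`, at the
  -- price of a factor `γ + k` that the `o(1 / k)` bound on the excess absorbs.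
  have e7 : 4 * α * (16 / r ^ 2) * ((∫ s, excess (r / 4) (e s) ^ 2 ∂P) * ∫ ζ, h ζ ^ 2 ∂ν) =
      α ^ 2 * (4 * (16 / r ^ 2) / γ * (∫ ζ, h ζ ^ 2 ∂ν) *
          ((γ + k) * ∫ s, excess (r / 4) (e s) ^ 2 ∂P)) := by
    have : α ^ 2 * (4 * (16 / r ^ 2) / γ * (∫ ζ, h ζ ^ 2 ∂ν) *
          ((γ + k) * ∫ s, excess (r / 4) (e s) ^ 2 ∂P)) = α * (α * (γ + k) / γ) *
          (4 * (16 / r ^ 2) * (∫ ζ, h ζ ^ 2 ∂ν) * ∫ s, excess (r / 4) (e s) ^ 2 ∂P) := by ring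
    rw [this, hαk, div_self hγ.ne']
    ring
  rw [e7]
  ring

/-- Projected SGD is asymptotically linear in mean square. -/
theorem tendsto_gap (M : LinearModel ν wopt μ σ) (H : Stream P ν w₀ z) (hγ : 1 < γ)
    (hc : IsCompact Ω) (hconv : Convex ℝ Ω) (hw : ∀ s, w₀ s ∈ Ω)
    (hint : wopt ∈ interior Ω) :
    Tendsto (fun k : ℕ => (γ + k) * ∫ s, ‖gap Ω μ γ wopt w₀ z k s‖ ^ 2 ∂P) atTop (𝓝 0) := by
  have hγ0 : 0 < γ := by linarith
  obtain ⟨R, hR⟩ : ∃ R, ∀ y ∈ Ω, ‖y - wopt‖ ≤ R := by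
    obtain ⟨R, hR⟩ := hc.isBounded.subset_closedBall wopt
    exact ⟨R, fun y hy => by simpa [dist_eq_norm] using hR hy⟩
  obtain ⟨r, hr, hball⟩ := Metric.nhds_basis_closedBall.mem_iff.1 (mem_interior_iff_mem_nhds.1 hint)
  have hopt : wopt ∈ Ω := interior_subset hint
  have N := noisyContraction_sgdError (γ := γ) M H hc hconv hw hopt hR
  obtain ⟨C, hC0, hC⟩ := N.second_moment_bound (by linarith)
  have hu := tendsto_of_mul_bounded hγ0 (fun k => integral_nonneg fun s => sq_nonneg _) hC
  have hx := N.tendsto_excess (by linarith) (ρ := r / 4) (by positivity)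
  have hι := tendsto_integral_truncated_sq N.meas_bound N.memLp_bound (γ := γ) (c := r / 2)
    (by positivity)
  -- The rate is `1` instead of `2` because the projection cost has used up `α_k ‖D‖²`; hence `γ >
  -- 1`.
  refine tendsto_mul_zero_of_step hγ0 (c := 1) (by linarith)
    (fun k => integral_nonneg fun s => sq_nonneg _) ?_ ?_
    (integral_gap_sq_succ_le M H hγ0 hc hconv hw hR hr hball)
  · have h1 := ((tendsto_alpha γ).const_sub 1).sub
      (((tendsto_alpha γ).mul_const (2 / r)).mul hι)
    simp only [sub_zero, mul_zero] at h1
    refine h1.congr fun k => ?_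
    have := (alpha_pos hγ0 k).ne'
    field_simp
    ring
  · have h1 := ((hu.mul_const (∫ ζ : Vec d × ℝ, (1 + 1 / μ * ‖ζ.1‖ ^ 2) ^ 2 ∂ν)).add
      (hx.const_mul (4 * (16 / r ^ 2) / γ * ∫ ζ, dirBound wopt μ R ζ ^ 2 ∂ν))).add
      (hι.const_mul (2 / r + 3))
    simpa using h1

theorem weight_nonneg (hγ : 0 < γ) (k i : ℕ) : 0 ≤ weight γ k i := by
  have := alpha_pos hγ
  unfold weight
  exact div_nonneg (one_div_nonneg.2 (this i).le)
    (Finset.sum_nonneg fun r _ => one_div_nonneg.2 (this r).le)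

theorem sum_weight (hγ : 0 < γ) (k : ℕ) : ∑ i ∈ Finset.range (k + 1), weight γ k i = 1 := by
  unfold weight
  rw [← Finset.sum_div, div_self]
  rw [sum_one_div_alpha hγ.ne']
  positivity

/-- Weighted averages of a sequence that is `o(1 / k)` in mean square are `o(1 / k)` in mean
square. -/
theorem tendsto_weighted_avg {E : Type*} [NormedAddCommGroup E] [InnerProductSpace ℝ E]
    {D : ℕ → S → E} (hγ : 0 < γ) (hD : ∀ k, MemLp (D k) 2 P)
    (h : Tendsto (fun k : ℕ => (γ + k) * ∫ s, ‖D k s‖ ^ 2 ∂P) atTop (𝓝 0)) :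
    Tendsto (fun k : ℕ => (k : ℝ) *
      ∫ s, ‖∑ i ∈ Finset.range (k + 1), weight γ k i • D i s‖ ^ 2 ∂P) atTop (𝓝 0) := by
  -- By Jensen the mean square of the average is at most the weighted mean of the `E‖D_i‖²`. As the
  -- weights are proportional to `(γ + i) / γ`, this is a Cesàro mean of a null sequence, up to a
  -- factor of order `1 / k`.
  have hces := ((h.div_const γ).cesaro)
  rw [zero_div] at hces
  have hces1 := (tendsto_add_atTop_iff_nat 1).2 hces
  have h1 := (((tendsto_natCast_div_add (2 * γ)).const_mul (2 * γ)).mul hces1)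
  rw [mul_zero] at h1
  refine squeeze_zero (fun k => mul_nonneg (Nat.cast_nonneg _)
    (integral_nonneg fun s => sq_nonneg _)) (fun k => ?_) h1
  have hpt : ∀ s, ‖∑ i ∈ Finset.range (k + 1), weight γ k i • D i s‖ ^ 2 ≤
      ∑ i ∈ Finset.range (k + 1), weight γ k i * ‖D i s‖ ^ 2 := by
    intro s
    calc ‖∑ i ∈ Finset.range (k + 1), weight γ k i • D i s‖ ^ 2
        ≤ (∑ i ∈ Finset.range (k + 1), weight γ k i * ‖D i s‖) ^ 2 := by
          gcongr
          refine (norm_sum_le _ _).trans (Finset.sum_le_sum fun i _ => ?_)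
          rw [norm_smul, Real.norm_eq_abs, abs_of_nonneg (weight_nonneg hγ _ _)]
      _ ≤ _ := Real.pow_arith_mean_le_arith_mean_pow _ _ _ (fun i _ => weight_nonneg hγ _ _)
          (sum_weight hγ k) (fun i _ => norm_nonneg _) 2
  have hsum : MemLp (fun s => ∑ i ∈ Finset.range (k + 1), weight γ k i • D i s) 2 P :=
    memLp_finsetSum _ fun i _ => (hD i).const_smul (weight γ k i)
  have hi : ∀ i ∈ Finset.range (k + 1), Integrable (fun s => weight γ k i * ‖D i s‖ ^ 2) P :=
    fun i _ => (hD i).norm.integrable_sq.const_mul _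
  have h2 := integral_mono hsum.norm.integrable_sq (integrable_finsetSum _ hi) hpt
  rw [integral_finsetSum _ hi] at h2
  refine (mul_le_mul_of_nonneg_left h2 (Nat.cast_nonneg k)).trans (le_of_eq ?_)
  have hterm : ∀ i, ∫ s, weight γ k i * ‖D i s‖ ^ 2 ∂P =
      (1 / ((1 + k) * (2 * γ + k) / (2 * γ))) * ((γ + i) * (∫ s, ‖D i s‖ ^ 2 ∂P) / γ) := by
    intro i
    rw [integral_const_mul, weight, sum_one_div_alpha hγ.ne', alpha]
    have : γ + (i : ℝ) ≠ 0 := by positivity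
    have : 2 * γ + (k : ℝ) ≠ 0 := by positivity
    have : 1 + (k : ℝ) ≠ 0 := by positivity
    field_simp
  simp only [hterm]
  rw [← Finset.mul_sum]
  push_cast
  have h3 : 2 * γ + (k : ℝ) ≠ 0 := by positivity
  have h4 : (k : ℝ) + 1 ≠ 0 := by positivity
  have h5 : 1 + (k : ℝ) ≠ 0 := by positivity
  field_simp
  ring

theorem avgIter_sub (hγ : 0 < γ) (k : ℕ) (s : S) :
    avgIter Ω μ γ (w₀ s) (fun i => z i s) k - wopt =
      ∑ i ∈ Finset.range (k + 1), weight γ k i • linIter γ (fun i => noise wopt μ (z i s)) i +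
      ∑ i ∈ Finset.range (k + 1), weight γ k i • gap Ω μ γ wopt w₀ z i s := by
  rw [← Finset.sum_add_distrib]
  have e : ∀ i, weight γ k i • linIter γ (fun i => noise wopt μ (z i s)) i +
      weight γ k i • gap Ω μ γ wopt w₀ z i s =
      weight γ k i • iter Ω μ γ (w₀ s) (fun i => z i s) i - weight γ k i • wopt := by
    intro i
    rw [gap, sgdError]
    module
  simp only [e]
  rw [Finset.sum_sub_distrib, ← Finset.sum_smul, sum_weight hγ, one_smul, avgIter]

/-- Exact asymptotics of the mean squared error of the weighted average of projected SGD. -/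
theorem tendsto_avgIter (M : LinearModel ν wopt μ σ) (H : Stream P ν w₀ z) (hγ : 1 < γ)
    (hc : IsCompact Ω) (hconv : Convex ℝ Ω) (hw : ∀ s, w₀ s ∈ Ω)
    (hint : wopt ∈ interior Ω) :
    Tendsto (fun k : ℕ => (k : ℝ) *
      ∫ s, ‖avgIter Ω μ γ (w₀ s) (fun i => z i s) k - wopt‖ ^ 2 ∂P) atTop
      (𝓝 (8 * γ ^ 2 * (d * σ ^ 2 / μ) / (3 * (γ + 1) * (2 * γ - 1)))) := by
  have hγ0 : 0 < γ := by linarith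
  obtain ⟨R, hR⟩ : ∃ R, ∀ y ∈ Ω, ‖y - wopt‖ ≤ R := by
    obtain ⟨R, hR⟩ := hc.isBounded.subset_closedBall wopt
    exact ⟨R, fun y hy => by simpa [dist_eq_norm] using hR hy⟩
  have hopt : wopt ∈ Ω := interior_subset hint
  have hD : ∀ k, MemLp (gap Ω μ γ wopt w₀ z k) 2 P := memLp_gap M H hc hconv hw hopt hR
  simp only [avgIter_sub hγ0 (wopt := wopt)]
  have h1 := H.tendsto_linAvg (γ := γ) measurable_noise M.memLp_noise' M.integral_noise'
    (by linarith)
  rw [M.integral_noise_sq] at h1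
  refine tendsto_sq_norm_add (fun k => ?_) (fun k => ?_) h1
    (tendsto_weighted_avg hγ0 hD (tendsto_gap M H hγ hc hconv hw hint))
  · exact memLp_finsetSum _ fun i _ =>
      (H.memLp_linIter M.memLp_noise' γ i).const_smul (weight γ k i)
  · exact memLp_finsetSum _ fun i _ => (hD i).const_smul (weight γ k i)

theorem integrable_risk_of_mem (M : LinearModel ν wopt μ σ) (hc : IsCompact Ω)
    {w : S → Vec d} (hwm : AEStronglyMeasurable w P) (hmem : ∀ᵐ s ∂P, w s ∈ Ω) :
    Integrable (fun s => risk ν (w s)) P ∧ MemLp (fun s => w s - wopt) 2 P := by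
  obtain ⟨R, hR⟩ : ∃ R, ∀ y ∈ Ω, ‖y - wopt‖ ≤ R := by
    obtain ⟨R, hR⟩ := hc.isBounded.subset_closedBall wopt
    exact ⟨R, fun y hy => by simpa [dist_eq_norm] using hR hy⟩
  have h2 : MemLp (fun s => w s - wopt) 2 P :=
    MemLp.of_bound (hwm.sub aestronglyMeasurable_const) R
      (hmem.mono fun s hs => hR _ hs)
  refine ⟨?_, h2⟩
  have h3 : Integrable (fun s => risk ν wopt + μ * ‖w s - wopt‖ ^ 2) P :=
    (integrable_const _).add (h2.norm.integrable_sq.const_mul μ)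
  exact h3.congr (ae_of_all _ fun s => (M.risk_eq (w s)).symm)

theorem integral_risk_sub (M : LinearModel ν wopt μ σ)
    {w : S → Vec d} (h : MemLp (fun s => w s - wopt) 2 P) :
    ∫ s, risk ν (w s) ∂P - risk ν wopt = μ * ∫ s, ‖w s - wopt‖ ^ 2 ∂P := by
  have : ∀ s, risk ν (w s) = risk ν wopt + μ * ‖w s - wopt‖ ^ 2 := fun s => M.risk_eq (w s)
  simp only [this]
  rw [integral_add (integrable_const _) (h.norm.integrable_sq.const_mul μ), integral_const_mul]
  simp

theorem avgIter_mem (hγ : 0 < γ) (hc : IsCompact Ω) (hconv : Convex ℝ Ω) (hw : ∀ s, w₀ s ∈ Ω)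
    (k : ℕ) (s : S) : avgIter Ω μ γ (w₀ s) (fun i => z i s) k ∈ Ω :=
  hconv.sum_mem (fun i _ => weight_nonneg hγ k i) (sum_weight hγ k)
    fun i _ => iter_mem hc hconv (hw s) i

theorem measurable_avgIter (H : Stream P ν w₀ z) (hc : IsCompact Ω) (hconv : Convex ℝ Ω)
    (hw : ∀ s, w₀ s ∈ Ω) (hne : Ω.Nonempty) (k : ℕ) :
    Measurable (fun s => avgIter Ω μ γ (w₀ s) (fun i => z i s) k) := by
  unfold avgIter
  exact Finset.measurable_fun_sum _ fun i _ =>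
    (H.measurable (measurable_iter hc hconv hw hne z i)).const_smul (weight γ k i)

end Gap

/-! ### Deterministic analysis of the empirical risk -/

section EmpiricalRisk

variable {d : ℕ} {wopt : Vec d} {μ σ : ℝ} {Ω : Set (Vec d)}

/-- The rank one matrix `u wᵀ` as a vector of its entries. -/
noncomputable def outer (u w : Vec d) : EuclideanSpace ℝ (Fin d × Fin d) :=
  WithLp.toLp 2 fun p => u p.1 * w p.2

/-- The deviation `x xᵀ - μ I` as a vector of its entries. -/
noncomputable def covNoise (μ : ℝ) (ζ : Vec d × ℝ) : EuclideanSpace ℝ (Fin d × Fin d) :=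
  WithLp.toLp 2 fun p => ζ.1 p.1 * ζ.1 p.2 - if p.1 = p.2 then μ else 0

theorem norm_outer (u w : Vec d) : ‖outer u w‖ = ‖u‖ * ‖w‖ := by
  have h : ‖outer u w‖ ^ 2 = (‖u‖ * ‖w‖) ^ 2 := by
    rw [mul_pow, EuclideanSpace.norm_sq_eq, EuclideanSpace.norm_sq_eq, EuclideanSpace.norm_sq_eq,
      Fintype.sum_prod_type, Finset.sum_mul_sum]
    simp [outer, mul_pow]
  exact (sq_eq_sq₀ (norm_nonneg _) (by positivity)).1 h

theorem outer_sub_smul (u h : Vec d) (t : ℝ) :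
    outer (u - t • h) (u - t • h) =
      outer u u - t • (outer u h + outer h u) + t ^ 2 • outer h h := by
  ext p
  simp [outer]
  ring

theorem inner_covNoise (ζ : Vec d × ℝ) (u : Vec d) :
    inner ℝ (covNoise μ ζ) (outer u u) = inner ℝ ζ.1 u ^ 2 - μ * ‖u‖ ^ 2 := by
  rw [EuclideanSpace.norm_sq_eq, PiLp.inner_apply, PiLp.inner_apply, Fintype.sum_prod_type, sq,
    Finset.sum_mul_sum, Finset.mul_sum, ← Finset.sum_sub_distrib]
  refine Finset.sum_congr rfl fun i _ => ?_
  have e : ∀ j : Fin d, inner ℝ ((covNoise μ ζ) (i, j)) ((outer u u) (i, j)) =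
      inner ℝ (ζ.1 i) (u i) * inner ℝ (ζ.1 j) (u j) - if i = j then μ * (u i * u j) else 0 := by
    intro j
    simp only [covNoise, outer, RCLike.inner_apply, conj_trivial]
    split_ifs <;> ring
  simp only [e]
  rw [Finset.sum_sub_distrib]
  simp [sq]

/-- For `γ = 1` the step is `1 / (k + 1)` and the recursion is that of the running mean. Empirical
means thereby inherit the estimates for noisy contractions. -/
theorem linIter_one {E : Type*} [NormedAddCommGroup E] [InnerProductSpace ℝ E] (Z : ℕ → E)
    (k : ℕ) : linIter 1 Z k = (1 / (k : ℝ)) • ∑ i ∈ Finset.range k, Z i := by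
  induction k with
  | zero => simp [linIter]
  | succ k ih =>
    rw [linIter, ih, Finset.sum_range_succ, smul_add, smul_smul, alpha]
    rcases Nat.eq_zero_or_pos k with h0 | hpos
    · simp [h0]
    · have hk : (k : ℝ) ≠ 0 := by positivity
      have hk1 : 1 + (k : ℝ) ≠ 0 := by positivity
      congr 2
      · push_cast
        rw [add_comm (k : ℝ) 1]
        field_simp
        ring
      · push_cast
        rw [add_comm]

theorem inner_linIter_one {E : Type*} [NormedAddCommGroup E] [InnerProductSpace ℝ E] (Z : ℕ → E)
    (k : ℕ) (u : E) :
    inner ℝ (linIter 1 Z k) u = 1 / (k : ℝ) * ∑ i ∈ Finset.range k, inner ℝ (Z i) u := by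
  rw [linIter_one, real_inner_smul_left, sum_inner]

/-- The empirical risk is a perturbation of an isotropic quadratic. -/
theorem empRisk_eq (hμ : μ ≠ 0) (z : ℕ → Vec d × ℝ) {k : ℕ} (hk : k ≠ 0) (w : Vec d) :
    empRisk z k w = empRisk z k wopt + μ * ‖w - wopt‖ ^ 2 +
      inner ℝ (linIter 1 (fun i => covNoise μ (z i)) k) (outer (w - wopt) (w - wopt)) -
      2 * μ * inner ℝ (linIter 1 (fun i => noise wopt μ (z i)) k) (w - wopt) := by
  have hk' : (k : ℝ) ≠ 0 := by exact_mod_cast hk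
  have e : ∀ i, (inner ℝ (z i).1 w - (z i).2) ^ 2 =
      (inner ℝ (z i).1 wopt - (z i).2) ^ 2 + μ * ‖w - wopt‖ ^ 2 +
        inner ℝ (covNoise μ (z i)) (outer (w - wopt) (w - wopt)) -
        2 * μ * inner ℝ (noise wopt μ (z i)) (w - wopt) := by
    intro i
    rw [inner_covNoise, noise, real_inner_smul_left, real_inner_smul_left]
    have := residual_eq w wopt (z i)
    unfold residual at this ⊢
    rw [this]
    field_simp
    ring
  rw [inner_linIter_one, inner_linIter_one, empRisk, empRisk]
  simp only [e]
  rw [Finset.sum_sub_distrib, Finset.sum_add_distrib, Finset.sum_add_distrib, Finset.sum_const,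
    Finset.card_range, ← Finset.mul_sum]
  simp only [nsmul_eq_mul]
  field_simp

/-- On the event that the empirical moments are accurate, the empirical risk minimizer is close
to the averaged noise. -/
theorem erm_sub_noise_le (hμ : 0 < μ) {r ε : ℝ} (hr : 0 < r)
    (hball : Metric.closedBall wopt r ⊆ Ω) (z : ℕ → Vec d × ℝ) {k : ℕ} (hk : k ≠ 0) {w : Vec d}
    (hw : IsERM Ω z k w) (hε : ε ≤ μ / 2) (hεr : 4 * ε < r)
    (hC : ‖linIter 1 (fun i => covNoise μ (z i)) k‖ ≤ ε)
    (hn : ‖linIter 1 (fun i => noise wopt μ (z i)) k‖ ≤ ε) :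
    ‖w - wopt - linIter 1 (fun i => noise wopt μ (z i)) k‖ ≤
      4 * ε / μ * ‖linIter 1 (fun i => noise wopt μ (z i)) k‖ := by
  set C := linIter 1 (fun i => covNoise μ (z i)) k with hCdef
  set n := linIter 1 (fun i => noise wopt μ (z i)) k with hndef
  set e := w - wopt with he
  have hε0 : 0 ≤ ε := (norm_nonneg _).trans hC
  have hB : ∀ u v : Vec d, |inner ℝ C (outer u v)| ≤ ε * (‖u‖ * ‖v‖) := by
    intro u v
    refine (abs_real_inner_le_norm _ _).trans ?_
    rw [norm_outer]
    exact mul_le_mul_of_nonneg_right hC (by positivity)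
  have hopt : wopt ∈ Ω := hball (Metric.mem_closedBall_self hr.le)
  -- Comparison with `wopt`: since `ε ≤ μ / 2`, half of the curvature survives the perturbation `C`.
  have he4 : ‖e‖ ≤ 4 * ‖n‖ := by
    have h1 : empRisk z k w ≤ empRisk z k wopt := hw.2 hopt
    rw [empRisk_eq (wopt := wopt) hμ.ne' z hk w] at h1
    have h2 := (abs_le.1 (hB e e)).1
    have h3 := real_inner_le_norm n e
    have h4 : 2 * μ * inner ℝ n e ≤ 2 * μ * (‖n‖ * ‖e‖) :=
      mul_le_mul_of_nonneg_left h3 (by positivity)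
    have h5 : ε * (‖e‖ * ‖e‖) ≤ μ / 2 * (‖e‖ * ‖e‖) :=
      mul_le_mul_of_nonneg_right hε (by positivity)
    have h6 : μ / 2 * (‖e‖ * ‖e‖) ≤ 2 * μ * (‖n‖ * ‖e‖) := by nlinarith
    by_contra hlt
    push Not at hlt
    have h7 : 0 < ‖e‖ := lt_of_le_of_lt (by positivity) hlt
    have h8 := mul_lt_mul_of_pos_left hlt (mul_pos hμ h7)
    nlinarith
  set h := e - n with hh
  set l := 2 * μ * ‖h‖ ^ 2 + inner ℝ C (outer e h + outer h e) with hl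
  set K := μ * ‖h‖ ^ 2 + inner ℝ C (outer h h) with hK
  -- Minimality against the move `w - t • h`, which stays in the ball because `‖e‖ ≤ 4 ε < r`. Here
  -- `l` is the first order coefficient and `K` the second order one, so small `t` forces `l ≤ 0`.
  have hstep : ∀ t : ℝ, 0 < t → t * ‖h‖ ≤ r - 4 * ε → l ≤ t * K := by
    intro t ht htr
    have hmem : w - t • h ∈ Ω := by
      apply hball
      rw [Metric.mem_closedBall, dist_eq_norm, show w - t • h - wopt = e - t • h by rw [he]; abel]
      have h1 := norm_sub_le e (t • h)
      rw [norm_smul, Real.norm_eq_abs, abs_of_pos ht] at h1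
      linarith
    have h1 : empRisk z k w ≤ empRisk z k (w - t • h) := hw.2 hmem
    rw [empRisk_eq (wopt := wopt) hμ.ne' z hk w,
      empRisk_eq (wopt := wopt) hμ.ne' z hk (w - t • h),
      show w - t • h - wopt = e - t • h by rw [he]; abel, ← he, ← hCdef, ← hndef, outer_sub_smul,
      norm_sub_sq_real e (t • h), inner_sub_right n e (t • h), inner_add_right C,
      inner_sub_right C,
      real_inner_smul_right, real_inner_smul_right, real_inner_smul_right, real_inner_smul_right,
      norm_smul, mul_pow, Real.norm_eq_abs, sq_abs] at h1
    have h2 : ‖h‖ ^ 2 = inner ℝ e h - inner ℝ n h := by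
      rw [← real_inner_self_eq_norm_sq, ← inner_sub_left]
    have h3 : t * l ≤ t * (t * K) := by
      rw [hl, hK]
      have : t * (2 * μ * ‖h‖ ^ 2) = 2 * μ * t * (inner ℝ e h - inner ℝ n h) := by rw [h2]; ring
      nlinarith
    exact le_of_mul_le_mul_left h3 ht
  have hl0 : l ≤ 0 := by
    have hK1 : 0 ≤ |K| + 1 := by positivity
    by_contra hpos
    push Not at hpos
    set t := min ((r - 4 * ε) / (‖h‖ + 1)) (l / (2 * (|K| + 1))) with ht
    have hh1 : 0 < ‖h‖ + 1 := by positivity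
    have ht0 : 0 < t := lt_min (div_pos (by linarith) hh1) (by positivity)
    have ht1 : t * (‖h‖ + 1) ≤ r - 4 * ε := by
      rw [← le_div_iff₀ hh1]; exact min_le_left _ _
    have ht2 : t * (2 * (|K| + 1)) ≤ l := by
      rw [← le_div_iff₀ (by positivity)]; exact min_le_right _ _
    have h1 := hstep t ht0 (by nlinarith)
    have h2 : t * K ≤ t * |K| := mul_le_mul_of_nonneg_left (le_abs_self K) ht0.le
    nlinarith
  have hcross : -(2 * ε * (‖e‖ * ‖h‖)) ≤ inner ℝ C (outer e h + outer h e) := by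
    rw [inner_add_right]
    have h1 := (abs_le.1 (hB e h)).1
    have h2 := (abs_le.1 (hB h e)).1
    nlinarith
  have hfin : μ * ‖h‖ ≤ ε * ‖e‖ := by
    by_contra hlt
    push Not at hlt
    have h0 : 0 < ‖h‖ := by
      by_contra h00
      have : ‖h‖ = 0 := le_antisymm (not_lt.1 h00) (norm_nonneg _)
      rw [this, mul_zero] at hlt
      have : 0 ≤ ε * ‖e‖ := by positivity
      linarith
    have := mul_lt_mul_of_pos_right hlt h0
    nlinarith
  have h9 : ε * ‖e‖ ≤ ε * (4 * ‖n‖) := mul_le_mul_of_nonneg_left he4 hε0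
  rw [div_mul_eq_mul_div, le_div_iff₀ hμ]
  linarith

end EmpiricalRisk

/-! ### Asymptotics of the empirical risk minimizer -/

section ERMAsymptotics

variable {d : ℕ} {ν : Measure (Vec d × ℝ)} [IsProbabilityMeasure ν] {wopt : Vec d} {μ σ : ℝ}
  {S : Type*} [MeasurableSpace S] {P : Measure S} [IsProbabilityMeasure P]
  {Ω : Set (Vec d)} {w₀ : S → Vec d} {z : ℕ → S → Vec d × ℝ} {R r : ℝ}

theorem measurable_covNoise : Measurable (covNoise (d := d) μ) := by
  unfold covNoise
  fun_prop

theorem LinearModel.memLp_coord_mul (M : LinearModel ν wopt μ σ) (i j : Fin d) :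
    MemLp (fun ζ : Vec d × ℝ => ζ.1 i * ζ.1 j) 2 ν := by
  refine (memLp_two_norm_sq M.memLp_x).mono (by fun_prop) (ae_of_all _ fun ζ => ?_)
  rw [norm_mul, norm_pow, norm_norm, sq]
  exact mul_le_mul (PiLp.norm_apply_le ζ.1 i) (PiLp.norm_apply_le ζ.1 j) (norm_nonneg _)
    (norm_nonneg _)

theorem LinearModel.memLp_covNoise (M : LinearModel ν wopt μ σ) : MemLp (covNoise μ) 2 ν :=
  MemLp.of_eval_piLp fun p => (M.memLp_coord_mul p.1 p.2).sub (memLp_const _)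

theorem LinearModel.integral_covNoise (M : LinearModel ν wopt μ σ) :
    ∫ ζ, covNoise μ ζ ∂ν = 0 := by
  ext p
  rw [eval_integral_piLp fun p => (M.memLp_covNoise.eval_piLp p).integrable one_le_two]
  have hi := (M.memLp_coord_mul p.1 p.2).integrable one_le_two
  simp only [covNoise]
  rw [integral_sub hi (integrable_const _), M.corr]
  simp

/-- The pointwise bound on the linearization error of the empirical risk minimizer, including the
exceptional event. -/
theorem erm_sub_noise_sq_le (hμ : 0 < μ) {ε : ℝ} (hr : 0 < r)
    (hball : Metric.closedBall wopt r ⊆ Ω) (hR : ∀ y ∈ Ω, ‖y - wopt‖ ≤ R) (z : ℕ → Vec d × ℝ)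
    {k : ℕ} (hk : k ≠ 0) {w : Vec d} (hw : IsERM Ω z k w) (hε0 : 0 < ε) (hε : ε ≤ μ / 2)
    (hεr : 4 * ε < r) :
    ‖w - wopt - linIter 1 (fun i => noise wopt μ (z i)) k‖ ^ 2 ≤
      (4 * ε / μ) ^ 2 * ‖linIter 1 (fun i => noise wopt μ (z i)) k‖ ^ 2 +
      (8 * R ^ 2 / ε ^ 2 + 8) *
        excess (ε / 2) (linIter 1 (fun i => noise wopt μ (z i)) k) ^ 2 +
      (8 * R ^ 2 / ε ^ 2 + 8) *
        excess (ε / 2) (linIter 1 (fun i => covNoise μ (z i)) k) ^ 2 := by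
  set C := linIter 1 (fun i => covNoise μ (z i)) k with hCdef
  set n := linIter 1 (fun i => noise wopt μ (z i)) k with hndef
  have t1 : 0 ≤ (4 * ε / μ) ^ 2 * ‖n‖ ^ 2 := by positivity
  have t2 : 0 ≤ (8 * R ^ 2 / ε ^ 2 + 8) * excess (ε / 2) n ^ 2 := by positivity
  have t3 : 0 ≤ (8 * R ^ 2 / ε ^ 2 + 8) * excess (ε / 2) C ^ 2 := by positivity
  -- Used when `‖C‖` or `‖n‖` exceeds `ε`. The excess over `ε / 2` is then at least `ε / 2`,
  -- respectively `‖n‖ / 2`, and the constant `8 R² / ε² + 8` is chosen to dominate this bound.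
  have hcrude : ‖w - wopt - n‖ ^ 2 ≤ 2 * R ^ 2 + 2 * ‖n‖ ^ 2 := by
    have h1 := norm_sub_le (w - wopt) n
    have h2 := hR w hw.1
    have h3 := norm_nonneg (w - wopt - n)
    have h4 := norm_nonneg n
    nlinarith [sq_nonneg (R - ‖n‖)]
  by_cases hn : ‖n‖ ≤ ε
  · by_cases hC : ‖C‖ ≤ ε
    · have h1 := erm_sub_noise_le hμ hr hball z hk hw hε hεr hC hn
      have h2 : ‖w - wopt - n‖ ^ 2 ≤ (4 * ε / μ * ‖n‖) ^ 2 := by gcongr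
      rw [mul_pow] at h2
      linarith
    · push Not at hC
      have h1 : ε / 2 ≤ excess (ε / 2) C := le_max_of_le_left (by linarith)
      have h2 : (ε / 2) ^ 2 ≤ excess (ε / 2) C ^ 2 := by gcongr
      have h3 : (8 * R ^ 2 / ε ^ 2 + 8) * (ε / 2) ^ 2 ≤
          (8 * R ^ 2 / ε ^ 2 + 8) * excess (ε / 2) C ^ 2 :=
        mul_le_mul_of_nonneg_left h2 (by positivity)
      have h4 : (8 * R ^ 2 / ε ^ 2 + 8) * (ε / 2) ^ 2 = 2 * R ^ 2 + 2 * ε ^ 2 := by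
        field_simp; ring
      have h5 : ‖n‖ ^ 2 ≤ ε ^ 2 := by gcongr
      linarith
  · push Not at hn
    have h1 : ‖n‖ / 2 ≤ excess (ε / 2) n := le_max_of_le_left (by linarith)
    have h2 : (‖n‖ / 2) ^ 2 ≤ excess (ε / 2) n ^ 2 := by gcongr
    have h3 : (8 * R ^ 2 / ε ^ 2 + 8) * (‖n‖ / 2) ^ 2 ≤
        (8 * R ^ 2 / ε ^ 2 + 8) * excess (ε / 2) n ^ 2 :=
      mul_le_mul_of_nonneg_left h2 (by positivity)
    have h4 : 2 * R ^ 2 + 2 * ‖n‖ ^ 2 ≤ (8 * R ^ 2 / ε ^ 2 + 8) * (‖n‖ / 2) ^ 2 := by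
      have e : (8 * R ^ 2 / ε ^ 2 + 8) * (‖n‖ / 2) ^ 2 =
          2 * R ^ 2 * (‖n‖ ^ 2 / ε ^ 2) + 2 * ‖n‖ ^ 2 := by
        field_simp; ring
      rw [e]
      have h5 : 1 ≤ ‖n‖ ^ 2 / ε ^ 2 := by
        rw [one_le_div (by positivity)]; gcongr
      nlinarith [sq_nonneg R]
    linarith

theorem tendsto_natCast_mul_of_add_mul {u : ℕ → ℝ} {a l : ℝ}
    (h : Tendsto (fun k : ℕ => (a + k) * u k) atTop (𝓝 l)) (ha : 0 < a) :
    Tendsto (fun k : ℕ => (k : ℝ) * u k) atTop (𝓝 l) := by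
  have h1 := (tendsto_natCast_div_add a).mul h
  rw [one_mul] at h1
  refine h1.congr fun k => ?_
  have : a + (k : ℝ) ≠ 0 := by positivity
  field_simp

/-- The empirical risk minimizer is asymptotically linear in mean square. -/
theorem tendsto_erm_sub_noise (M : LinearModel ν wopt μ σ) (H : Stream P ν w₀ z)
    (hc : IsCompact Ω) (hint : wopt ∈ interior Ω) {werm : ℕ → S → Vec d}
    (hmeas : ∀ k, AEStronglyMeasurable (werm k) P)
    (herm : ∀ k, ∀ᵐ s ∂P, IsERM Ω (fun i => z i s) k (werm k s)) :
    Tendsto (fun k : ℕ => (k : ℝ) *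
      ∫ s, ‖werm k s - wopt - linIter 1 (fun i => noise wopt μ (z i s)) k‖ ^ 2 ∂P)
      atTop (𝓝 0) := by
  obtain ⟨R, hR⟩ : ∃ R, ∀ y ∈ Ω, ‖y - wopt‖ ≤ R := by
    obtain ⟨R, hR⟩ := hc.isBounded.subset_closedBall wopt
    exact ⟨R, fun y hy => by simpa [dist_eq_norm] using hR hy⟩
  obtain ⟨r, hr, hball⟩ := Metric.nhds_basis_closedBall.mem_iff.1 (mem_interior_iff_mem_nhds.1 hint)
  have hμ := M.mu_pos
  have Nn := H.noisyContraction_linIter measurable_noise M.memLp_noise' M.integral_noise' 1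
  have NC := H.noisyContraction_linIter measurable_covNoise M.memLp_covNoise M.integral_covNoise 1
  have hn := tendsto_natCast_mul_of_add_mul
    (H.tendsto_linIter measurable_noise M.memLp_noise' M.integral_noise' (γ := 1) (by norm_num))
    one_pos
  set s₂ := 1 ^ 2 * (∫ ζ, ‖noise wopt μ ζ‖ ^ 2 ∂ν) / (2 * 1 - 1) with hs₂
  refine tendsto_order.2 ⟨fun a ha => Eventually.of_forall fun k => lt_of_lt_of_le ha
    (mul_nonneg (Nat.cast_nonneg _) (integral_nonneg fun s => sq_nonneg _)), fun δ hδ => ?_⟩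
  -- For fixed `ε` both excess terms vanish in the limit, leaving `(4ε/μ)² s₂`, which is below `δ`
  -- once `ε` is small.
  have hε : ∃ ε : ℝ, 0 < ε ∧ ε ≤ μ / 2 ∧ 4 * ε < r ∧ (4 * ε / μ) ^ 2 * s₂ < δ := by
    have h1 : Tendsto (fun ε : ℝ => (4 * ε / μ) ^ 2 * s₂) (𝓝[>] 0) (𝓝 0) := by
      have : Continuous fun ε : ℝ => (4 * ε / μ) ^ 2 * s₂ := by fun_prop
      have := (this.tendsto 0).mono_left (nhdsWithin_le_nhds (s := Set.Ioi 0))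
      simpa using this
    have h2 : Tendsto (fun ε : ℝ => 4 * ε) (𝓝[>] 0) (𝓝 0) := by
      have : Continuous fun ε : ℝ => 4 * ε := by fun_prop
      have := (this.tendsto 0).mono_left (nhdsWithin_le_nhds (s := Set.Ioi 0))
      simpa using this
    have h3 : ∀ᶠ ε : ℝ in 𝓝[>] 0, ε < μ / 2 :=
      nhdsWithin_le_nhds (gt_mem_nhds (half_pos hμ))
    obtain ⟨ε, ⟨⟨h4, h5⟩, h6⟩, h7⟩ := (((h1.eventually (gt_mem_nhds hδ)).and
      (h2.eventually (gt_mem_nhds hr))).and h3).and self_mem_nhdsWithin |>.exists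
    exact ⟨ε, h7, h6.le, h5, h4⟩
  obtain ⟨ε, hε0, hεμ, hεr, hεδ⟩ := hε
  have hxn := tendsto_natCast_mul_of_add_mul
    (Nn.tendsto_excess (by norm_num) (half_pos hε0)) one_pos
  have hxC := tendsto_natCast_mul_of_add_mul
    (NC.tendsto_excess (by norm_num) (half_pos hε0)) one_pos
  have hlim := ((hn.const_mul ((4 * ε / μ) ^ 2)).add (hxn.const_mul (8 * R ^ 2 / ε ^ 2 + 8))).add
    (hxC.const_mul (8 * R ^ 2 / ε ^ 2 + 8))
  rw [mul_zero, add_zero, add_zero] at hlim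
  filter_upwards [hlim.eventually (gt_mem_nhds hεδ), eventually_ne_atTop 0] with k hk hk0
  refine lt_of_le_of_lt ?_ hk
  have hL := H.memLp_linIter M.memLp_noise' 1 k
  have hW := (integrable_risk_of_mem M hc (hmeas k) ((herm k).mono fun s hs => hs.1)).2
  have i1 := hL.norm.integrable_sq
  have i2 := (Nn.memLp_excess (half_pos hε0).le k).integrable_sq
  have i3 := (NC.memLp_excess (half_pos hε0).le k).integrable_sq
  have hmono := integral_mono_ae (hW.sub hL).norm.integrable_sq
    (((i1.const_mul ((4 * ε / μ) ^ 2)).add (i2.const_mul (8 * R ^ 2 / ε ^ 2 + 8))).add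
      (i3.const_mul (8 * R ^ 2 / ε ^ 2 + 8)))
    ((herm k).mono fun s hs =>
      erm_sub_noise_sq_le hμ hr hball hR (fun i => z i s) hk0 hs hε0 hεμ hεr)
  simp only [Pi.add_apply, Pi.sub_apply] at hmono
  rw [integral_add_add (i1.const_mul _) (i2.const_mul _) (i3.const_mul _), integral_const_mul,
    integral_const_mul, integral_const_mul] at hmono
  have := mul_le_mul_of_nonneg_left hmono (Nat.cast_nonneg (α := ℝ) k)
  linarith

theorem tendsto_erm (M : LinearModel ν wopt μ σ) (H : Stream P ν w₀ z)
    (hc : IsCompact Ω) (hint : wopt ∈ interior Ω) {werm : ℕ → S → Vec d}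
    (hmeas : ∀ k, AEStronglyMeasurable (werm k) P)
    (herm : ∀ k, ∀ᵐ s ∂P, IsERM Ω (fun i => z i s) k (werm k s)) :
    Tendsto (fun k : ℕ => (k : ℝ) * ∫ s, ‖werm k s - wopt‖ ^ 2 ∂P) atTop
      (𝓝 (d * σ ^ 2 / μ)) := by
  have hn := tendsto_natCast_mul_of_add_mul
    (H.tendsto_linIter measurable_noise M.memLp_noise' M.integral_noise' (γ := 1) (by norm_num))
    one_pos
  rw [M.integral_noise_sq] at hn
  have hW := fun k =>
    (integrable_risk_of_mem M hc (hmeas k) ((herm k).mono fun s hs => hs.1)).2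
  have h1 := tendsto_sq_norm_add (H.memLp_linIter M.memLp_noise' 1)
    (fun k => (hW k).sub (H.memLp_linIter M.memLp_noise' 1 k)) hn
    (tendsto_erm_sub_noise M H hc hint hmeas herm)
  norm_num at h1
  exact h1

end ERMAsymptotics

end PSGDWA

/-! ### The main theorem -/

theorem mainTheorem2 {d : ℕ} (hd : 1 ≤ d)
    -- the joint law of `(x, y)`; `x` has a finite fourth moment
    (ν : Measure (PSGDWA.Vec d × ℝ)) [IsProbabilityMeasure ν]
    (hx4 : MemLp (fun z : PSGDWA.Vec d × ℝ => z.1) 4 ν)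
    -- `R_x` is invertible with smallest eigenvalue `μ`
    (hR : IsUnit (PSGDWA.corrMatrix ν)) (μ : ℝ)
    (hμ : IsLeast {t : ℝ |
      Module.End.HasEigenvalue (Matrix.toLin' (PSGDWA.corrMatrix ν)) t} μ)
    -- the components of `x` are identically distributed and uncorrelated
    (hident : ∀ i j : Fin d, IdentDistrib
      (fun z : PSGDWA.Vec d × ℝ => z.1 i) (fun z : PSGDWA.Vec d × ℝ => z.1 j) ν ν)
    (huncorr : ∀ i j : Fin d, i ≠ j → ∫ z, z.1 i * z.1 j ∂ν = 0)
    -- the constraint set and the optimal parameter in its interior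
    (Ω : Set (PSGDWA.Vec d)) (hΩc : IsCompact Ω) (hΩ : Convex ℝ Ω)
    (wopt : PSGDWA.Vec d) (hint : wopt ∈ interior Ω)
    (hmin : IsMinOn (PSGDWA.risk ν) Ω wopt)
    -- the noise `v = xᵀω* - y` has, given `x`, mean zero and variance `σ²`
    (σ : ℝ) (hv2 : MemLp (PSGDWA.residual wopt) 2 ν)
    (hv_mean : ν[PSGDWA.residual wopt |
      MeasurableSpace.comap (fun z : PSGDWA.Vec d × ℝ => z.1) inferInstance] =ᵐ[ν]
        fun _ => 0)
    (hv_var : ν[fun z => PSGDWA.residual wopt z ^ 2 |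
      MeasurableSpace.comap (fun z : PSGDWA.Vec d × ℝ => z.1) inferInstance] =ᵐ[ν]
        fun _ => σ ^ 2)
    -- i.i.d. samples `(x_k, y_k)`, and an independent initial estimate in `Ω`
    {S : Type*} [MeasurableSpace S] (P : Measure S) [IsProbabilityMeasure P]
    (sample : ℕ → S → PSGDWA.Vec d × ℝ) (hmeas : ∀ k, Measurable (sample k))
    (hlaw : ∀ k, P.map (sample k) = ν) (hindep : iIndepFun sample P)
    (w₀ : S → PSGDWA.Vec d) (hw₀meas : Measurable w₀) (hw₀mem : ∀ s, w₀ s ∈ Ω)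
    (hw₀indep : IndepFun w₀ (fun s k => sample k s) P)
    (γ : ℝ) (hγ : 2 ≤ γ) :
    -- the weighted average of projected SGD
    ((∀ k : ℕ, Integrable (fun s => PSGDWA.risk ν
        (PSGDWA.avgIter Ω μ γ (w₀ s) (fun i => sample i s) k)) P) ∧
      ∃ L : ℝ, L ≤ 4 * d * σ ^ 2 ∧
        Tendsto (fun k : ℕ => (k : ℝ) *
          ((∫ s, PSGDWA.risk ν (PSGDWA.avgIter Ω μ γ (w₀ s) (fun i => sample i s) k) ∂P)
            - PSGDWA.risk ν wopt)) atTop (𝓝 L)) ∧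
    -- comparison with any measurable version of the empirical risk minimizer
    ∀ werm : ℕ → S → PSGDWA.Vec d,
      (∀ k, AEStronglyMeasurable (werm k) P) →
      (∀ k, ∀ᵐ s ∂P, PSGDWA.IsERM Ω (fun i => sample i s) k (werm k s)) →
      (∀ k : ℕ, Integrable (fun s => PSGDWA.risk ν (werm k s)) P) ∧
      Tendsto (fun k : ℕ => (k : ℝ) *
        ((∫ s, PSGDWA.risk ν (werm k s) ∂P) - PSGDWA.risk ν wopt)) atTop
          (𝓝 (d * σ ^ 2)) ∧
      (σ ≠ 0 → ∃ ρ : ℝ, ρ ≤ 4 ∧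
        Tendsto (fun k : ℕ =>
          ((∫ s, PSGDWA.risk ν (PSGDWA.avgIter Ω μ γ (w₀ s) (fun i => sample i s) k) ∂P)
            - PSGDWA.risk ν wopt) /
          ((∫ s, PSGDWA.risk ν (werm k s) ∂P) - PSGDWA.risk ν wopt)) atTop (𝓝 ρ)) := by
  obtain ⟨hμ0, hcorr⟩ := PSGDWA.corrMatrix_diag hR hd hμ hident huncorr
  have M := PSGDWA.linearModel_of_condExp hx4 hμ0 hcorr hv2 hv_mean hv_var
  have H : PSGDWA.Stream P ν w₀ sample := ⟨hw₀meas, hmeas, hlaw, hindep, hw₀indep⟩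
  have hγ0 : 0 < γ := by linarith
  have hne : Ω.Nonempty := ⟨wopt, interior_subset hint⟩
  have havg := fun k => PSGDWA.integrable_risk_of_mem (P := P) M hΩc
    (PSGDWA.measurable_avgIter (μ := μ) (γ := γ) H hΩc hΩ hw₀mem hne k).aestronglyMeasurable
    (ae_of_all _ fun s => PSGDWA.avgIter_mem hγ0 hΩc hΩ hw₀mem k s)
  -- This is the exact limit. The bound `4` on its coefficient amounts to `8γ² ≤ 12(γ + 1)(2γ - 1)`,
  -- which has ample slack for `γ ≥ 2`.
  set L : ℝ := 8 * γ ^ 2 / (3 * (γ + 1) * (2 * γ - 1)) * (d * σ ^ 2) with hL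
  have hcoef : 8 * γ ^ 2 / (3 * (γ + 1) * (2 * γ - 1)) ≤ 4 := by
    rw [div_le_iff₀ (by nlinarith)]
    nlinarith
  have hdσ : 0 ≤ (d : ℝ) * σ ^ 2 := by positivity
  have hLle : L ≤ 4 * d * σ ^ 2 := by
    rw [mul_assoc 4]
    exact mul_le_mul_of_nonneg_right hcoef hdσ
  have hlim : Tendsto (fun k : ℕ => (k : ℝ) *
      ((∫ s, PSGDWA.risk ν (PSGDWA.avgIter Ω μ γ (w₀ s) (fun i => sample i s) k) ∂P)
        - PSGDWA.risk ν wopt)) atTop (𝓝 L) := by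
    have h1 := (PSGDWA.tendsto_avgIter (γ := γ) M H (by linarith) hΩc hΩ hw₀mem hint).const_mul μ
    have e : μ * (8 * γ ^ 2 * (d * σ ^ 2 / μ) / (3 * (γ + 1) * (2 * γ - 1))) = L := by
      rw [hL]
      field_simp
    rw [e] at h1
    refine h1.congr fun k => ?_
    rw [PSGDWA.integral_risk_sub M (havg k).2]
    ring
  refine ⟨⟨fun k => (havg k).1, L, hLle, hlim⟩, fun werm hwm hwe => ?_⟩
  have herm := fun k => PSGDWA.integrable_risk_of_mem M hΩc (hwm k) ((hwe k).mono fun s hs => hs.1)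
  have hlim2 : Tendsto (fun k : ℕ => (k : ℝ) *
      ((∫ s, PSGDWA.risk ν (werm k s) ∂P) - PSGDWA.risk ν wopt)) atTop (𝓝 (d * σ ^ 2)) := by
    have h1 := (PSGDWA.tendsto_erm M H hΩc hint hwm hwe).const_mul μ
    rw [mul_div_cancel₀ _ hμ0.ne'] at h1
    refine h1.congr fun k => ?_
    rw [PSGDWA.integral_risk_sub M (herm k).2]
    ring
  refine ⟨fun k => (herm k).1, hlim2, fun hσ => ?_⟩
  have hd0 : (0 : ℝ) < d := by exact_mod_cast hd
  have hpos : 0 < (d : ℝ) * σ ^ 2 := by positivity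
  refine ⟨L / (d * σ ^ 2), ?_, ?_⟩
  · rw [div_le_iff₀ hpos]
    linarith
  -- The factors `k` cancel for `k ≠ 0`, and the denominator has the nonzero limit `dσ²`.
  · refine (hlim.div hlim2 hpos.ne').congr' ?_
    filter_upwards [eventually_ne_atTop 0] with k hk
    have hk' : (k : ℝ) ≠ 0 := by exact_mod_cast hk
    simp only [Pi.div_apply]
    rw [mul_div_mul_left _ _ hk']
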